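/- Fix integers $n,D\ge 0$; put $G=\mathbb T^n=\mathbb R^n/\mathbb Z^n$, $\mathfrak g=\mathfrak g^*=\mathbb R^n$ (paired by the standard inner product), and let $B\subseteq\mathfrak g$ be the open ball of radius $1/(2\pi)$ around $0$; $[x]$ denotes the class of $x$. *Lattices.* A lattice is a finite set $l$ of edges $e=(x,y)\in\mathbb R^D\times\mathbb R^D$ with $x<y$ in the lexicographical order and such that the open segments of distinct edges are disjoint; $d_e=\|x-y\|$. Write $l\le m$ if for every $(x_1,x_2)\in l$ there are $0=t_0<t_1<\dots<t_{N+1}=1$ such that, with $y_s=(1-t_s)x_1+t_sx_2$, all $(y_s,y_{s+1})$ lie in $m$ (these are the pieces of $(x_1,x_2)$ in $m$). Let $X^l=G^l\times(\mathfrak g^*)^l$ and, for $l\le m$, let $\gamma_{lm}=(\gamma^{conf}_{lm},\gamma^{mom}_{lm}):X^m\to X^l$ be given by $\gamma_{lm}^{conf}(q)_e=\sum_{e'}q_{e'}$ and $\gamma_{lm}^{mom}(v)_e=\sum_{e'}\tfrac{d_{e'}}{d_e}v_{e'}$, the sums running over the pieces $e'$ of $e$ in $m$. Let $X^\infty=\varprojlim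 X^l$ with projections $\gamma_l:X^\infty\to X^l$. *Classical algebras.* Let $\mathcal A_0^l\subseteq C_b(X^l)$ be the span of the functions $e_b\otimes e^{i\xi\cdot}(g\circ P_U)$, where $b\in(\mathbb Z^n)^l$, $e_b[x]=e^{2\pi i b\cdot x}$, $U\subseteq\mathfrak g^l$ is a linear subspace with orthogonal projection $P_U$, $g$ is a Schwartz function on $U$ whose Fourier transform has compact support, and $\xi\in\mathfrak g^l$. For a finite complex Borel measure $\mu$ on $\mathfrak g^l$ put $\check\mu(p)=\int e^{i\xi\cdot p}\,d\mu(\xi)$. Let $\mathcal M_0^l\subseteq\mathcal A_0^l$ be the span of those $g\otimes\check\mu\in\mathcal A_0^l$ with $g\in C(G^l)$ and $\operatorname{supp}\mu\subseteq B^l$. Let $\mathcal A_0^\infty\subseteq C_b(X^\infty)$ be the *-algebra generated by all $f\circ\gamma_l$ with $f\in\mathcal A_0^l$, and $A_0^\infty$ its closure. *Quantization.* Let $\mathcal H^l=L^2(G^l)$, let $\mathcal H^\infty$ be the direct limit of the Hilbert spaces $\mathcal H^l$ along the isometries $\psi\mapsto\psi\circ\gamma_{lm}^{conf}$ ($l\le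 m$), and let $u^l:\mathcal H^l\to\mathcal H^\infty$ be the canonical isometries. **Theorem.** 1. $\mathcal A_0^\infty=\{f\circ\gamma_l: l \text{ a lattice},\ f\in\mathcal A_0^l\}=\{f\circ\gamma_l: l\text{ a lattice},\ f\in\mathcal M_0^l\}$, and $\{f\circ\gamma_l,g\circ\gamma_l\}:=\{f,g\}\circ\gamma_l$ ($f,g\in\mathcal A_0^l$), with $\{f,g\}=\sum_j\big(\frac{\partial f}{\partial p_j}\frac{\partial g}{\partial q_j}-\frac{\partial f}{\partial q_j}\frac{\partial g}{\partial p_j}\big)$ on $X^l$, is a well-defined operation on $\mathcal A_0^\infty$. 2. Every $f\in\mathcal M_0^l$ can be written as $f=\sum_{k=1}^K g_k\otimes\check\mu_k$ with $g_k\in C(G^l)$ and $\operatorname{supp}\mu_k\subseteq B^l$, and for $\hbar\in[-1,1]$ there is a bounded operator $Q_\hbar^l(f)$ on $\mathcal H^l$, independent of the chosen expression, with $$Q_\hbar^l(f)\psi[y]=\sum_{k=1}^K\int g_k[y+\tfrac12\hbar\xi]\,\psi[y+\hbar\xi]\,d\mu_k(\xi).$$ 3. For $\hbar\in[-1,1]$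 there is a well-defined map $Q_\hbar^\infty:\mathcal A_0^\infty\to\mathcal B(\mathcal H^\infty)$ with $Q_\hbar^\infty(f\circ\gamma_l)u^m\psi=u^mQ_\hbar^m(f\circ\gamma_{lm})\psi$ for all $f\in\mathcal M_0^l$, $m\ge l$, $\psi\in\mathcal H^m$. 4. For $\hbar\ne0$ let $A_\hbar^\infty\subseteq\mathcal B(\mathcal H^\infty)$ be the C*-algebra generated by $Q_\hbar^\infty(\mathcal A_0^\infty)$; at $\hbar=0$ replace the map of part 3 by $Q_0^\infty:=\mathrm{id}:\mathcal A_0^\infty\to A_0^\infty$. Then, with $I=[-1,1]$, the maps $Q_\hbar^\infty:\mathcal A_0^\infty\to A_\hbar^\infty$ ($\hbar\in I$) form a strict deformation quantization of $\mathcal A_0^\infty$. That is: $\mathcal A_0^\infty$ is a complex Poisson algebra, dense in $A_0^\infty$, with $\{f,g\}^*=\{f^*,g^*\}$; each $Q_\hbar^\infty$ is linear, injective and *-preserving, and its image is a dense *-subalgebra of $A_\hbar^\infty$; and for all $f,g\in\mathcal A_0^\infty$ * (von Neumann) $\lim_{\hbar\to0}\|Q_\hbar^\infty(f)Q_\hbar^\infty(g)-Q_\hbar^\infty(fg)\|=0$;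 * (Dirac) $\lim_{\hbar\to0}\|(-i\hbar)^{-1}[Q_\hbar^\infty(f),Q_\hbar^\infty(g)]-Q_\hbar^\infty(\{f,g\})\|=0$; * (Rieffel) $\hbar\mapsto\|Q_\hbar^\infty(f)\|$ is continuous on $[-1,1]$ (with value $\|f\|_\infty$ at $\hbar=0$). -/

import Mathlib

open MeasureTheory Filter Topology
open scoped FourierTransform SchwartzMap ENNReal

noncomputable section

namespace LatticeGauge

/-! ### Strict deformation quantization -/

/-- `bracket` makes the commutative *-algebra `𝒜` a complex Poisson algebra whose bracket is
compatible with the involution. -/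
structure IsPoissonStarBracket {A : Type*} [CStarAlgebra A] (𝒜 : StarSubalgebra ℂ A)
    (bracket : 𝒜 → 𝒜 → 𝒜) : Prop where
  mul_comm : ∀ f g : 𝒜, f * g = g * f
  add_left : ∀ f g h : 𝒜, bracket (f + g) h = bracket f h + bracket g h
  smul_left : ∀ (c : ℂ) (f g : 𝒜), bracket (c • f) g = c • bracket f g
  skew : ∀ f g : 𝒜, bracket f g = -bracket g f
  jacobi : ∀ f g h : 𝒜,
    bracket f (bracket g h) + bracket g (bracket h f) + bracket h (bracket f g) = 0
  leibniz : ∀ f g h : 𝒜, bracket f (g * h) = bracket f g * h + g * bracket f h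
  star_bracket : ∀ f g : 𝒜, star (bracket f g) = bracket (star f) (star g)

/-- Strict deformation quantization of a Poisson *-algebra `𝒜₀` that is dense in a C*-algebra `A₀`.
The fibre over `ℏ = 0` is the C*-algebra `A₀`, with quantization map the identity (inclusion) of
`𝒜₀`. The fibre over `ℏ ∈ I`, `ℏ ≠ 0`, is the C*-algebra `Aq ℏ`, realized as a closed *-subalgebra
of the C*-algebra `B`, with quantization map `Q ℏ : 𝒜₀ → Aq ℏ`. The values of `Aq` and `Q` at
`ℏ = 0` and outside of `I` play no role. -/
structure IsStrictDeformationQuantization {A B : Type*} [CStarAlgebra A] [CStarAlgebra B]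
    (𝒜₀ : StarSubalgebra ℂ A) (bracket : 𝒜₀ → 𝒜₀ → 𝒜₀) (A₀ : StarSubalgebra ℂ A)
    (I : Set ℝ) (Aq : ℝ → StarSubalgebra ℂ B) (Q : ℝ → 𝒜₀ → B) : Prop where
  poisson : IsPoissonStarBracket 𝒜₀ bracket
  zero_mem : (0 : ℝ) ∈ I
  zero_mem_closure : (0 : ℝ) ∈ closure (I \ {0})
  isClosed_classical : IsClosed (A₀ : Set A)
  dense_classical : closure (𝒜₀ : Set A) = A₀
  isClosed_quantum : ∀ ℏ ∈ I \ {0}, IsClosed (Aq ℏ : Set B)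
  linear : ∀ ℏ ∈ I \ {0}, IsLinearMap ℂ (Q ℏ)
  map_star : ∀ ℏ ∈ I \ {0}, ∀ f : 𝒜₀, Q ℏ (star f) = star (Q ℏ f)
  injective : ∀ ℏ ∈ I \ {0}, Function.Injective (Q ℏ)
  range_starSubalgebra : ∀ ℏ ∈ I \ {0},
    ∃ S : StarSubalgebra ℂ B, (S : Set B) = Set.range (Q ℏ)
  dense_range : ∀ ℏ ∈ I \ {0}, closure (Set.range (Q ℏ)) = Aq ℏ
  vonNeumann : ∀ f g : 𝒜₀,
    Tendsto (fun ℏ : ℝ => ‖Q ℏ f * Q ℏ g - Q ℏ (f * g)‖) (𝓝[I \ {0}] 0) (𝓝 0)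
  dirac : ∀ f g : 𝒜₀,
    Tendsto (fun ℏ : ℝ => ‖(-(Complex.I * (ℏ : ℂ)))⁻¹ • (Q ℏ f * Q ℏ g - Q ℏ g * Q ℏ f)
      - Q ℏ (bracket f g)‖) (𝓝[I \ {0}] 0) (𝓝 0)
  rieffel : ∀ f : 𝒜₀,
    ContinuousOn (fun ℏ : ℝ => if ℏ = 0 then ‖(f : A)‖ else ‖Q ℏ f‖) I

/-! ### Lattices -/

/-- A directed straight edge `(x, y)` from `x` to `y` in `ℝ^D`. -/
abbrev Edge (D : ℕ) : Type := EuclideanSpace ℝ (Fin D) × EuclideanSpace ℝ (Fin D)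

/-- The length of an edge. -/
def Edge.length {D : ℕ} (e : Edge D) : ℝ := ‖e.1 - e.2‖

/-- The closed straight segment spanned by an edge. -/
def Edge.seg {D : ℕ} (e : Edge D) : Set (EuclideanSpace ℝ (Fin D)) := segment ℝ e.1 e.2

/-- A lattice: a finite set of edges, each increasing for the lexicographical order, such that
distinct edges do not intersect except possibly at their boundaries. -/
structure Lattice (D : ℕ) where
  edges : Finset (Edge D)
  lex_lt : ∀ e ∈ edges, toLex e.1.ofLp < toLex e.2.ofLp
  disjoint : ∀ e ∈ edges, ∀ e' ∈ edges, e ≠ e' →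
    Disjoint (openSegment ℝ e.1 e.2) (openSegment ℝ e'.1 e'.2)

/-- `l ≤ m` if every edge `(x₁, x₂)` of `l` is subdivided in `m`: there are
`0 = t₀ < t₁ < ⋯ < t_{N+1} = 1` such that for `y_s = (1 - t_s) x₁ + t_s x₂` all the edges
`(y_s, y_{s+1})` are in `m`. -/
instance (D : ℕ) : LE (Lattice D) where
  le l m := ∀ e ∈ l.edges, ∃ (N : ℕ) (t : Fin (N + 2) → ℝ), StrictMono t ∧ t 0 = 0 ∧
    t (Fin.last (N + 1)) = 1 ∧ ∀ s : Fin (N + 1),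
      (AffineMap.lineMap e.1 e.2 (t s.castSucc), AffineMap.lineMap e.1 e.2 (t s.succ)) ∈ m.edges

variable {D : ℕ}

open Classical in
/-- The edges of `m` lying inside the edge `e`. If `l ≤ m` and `e` is an edge of `l`, these are
precisely the edges of `m` obtained by subdivision from `e`. -/
def pieces (m : Lattice D) (e : Edge D) : Finset m.edges :=
  Finset.univ.filter fun e' => e'.1.seg ⊆ e.seg

theorem mem_pieces {m : Lattice D} {e : Edge D} {e' : m.edges} :
    e' ∈ pieces m e ↔ e'.1.seg ⊆ e.seg := by simp [pieces]

/-! ### Classical systems -/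

/-- The configuration space `G^l`, where `G = 𝕋^n`; a point has coordinates `q (e, i) ∈ ℝ/ℤ`. -/
abbrev Conf (n : ℕ) (l : Lattice D) : Type := UnitAddTorus (l.edges × Fin n)

/-- The space `𝔤^l = (ℝ^n)^l`, identified with `(𝔤*)^l` by the standard inner product. -/
abbrev Mom (n : ℕ) (l : Lattice D) : Type := EuclideanSpace ℝ (l.edges × Fin n)

/-- The phase space `X^l = T*G^l = G^l × (𝔤*)^l`. -/
abbrev Phase (n : ℕ) (l : Lattice D) : Type := Conf n l × Mom n l

/-- The exponential map `x ↦ [x]` from `𝔤^l` to `G^l`. -/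
def toConf {n : ℕ} {l : Lattice D} (x : Mom n l) : Conf n l := fun j => ((x j : ℝ) : UnitAddCircle)

/-- The normalized Haar measure on `G^l`. -/
def confHaar (n : ℕ) (l : Lattice D) : Measure (Conf n l) :=
  Measure.pi fun _ => AddCircle.haarAddCircle

/-- The connecting map `γ_{lm}^conf : G^m → G^l`: along an edge of `l`, the configurations on its
pieces are added up; edges of `m` that are not obtained by subdivision are forgotten. -/
def confMap (n : ℕ) (l m : Lattice D) : Conf n m →+ Conf n l where
  toFun q := fun j => ∑ e' ∈ pieces m j.1.1, q (e', j.2)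
  map_zero' := by ext j; simp
  map_add' q r := by ext j; simp [Finset.sum_add_distrib]

/-- The connecting map `γ_{lm}^mom : (𝔤*)^m → (𝔤*)^l`: along an edge of `l`, the average over its
pieces, weighted by their lengths; edges that are not obtained by subdivision are forgotten. -/
def momMap (n : ℕ) (l m : Lattice D) (v : Mom n m) : Mom n l :=
  WithLp.toLp 2 fun j =>
    ∑ e' ∈ pieces m j.1.1, (Edge.length e'.1 / Edge.length j.1.1) * v (e', j.2)

theorem continuous_confMap (n : ℕ) (l m : Lattice D) : Continuous (confMap n l m) := by
  refine continuous_pi fun j => ?_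
  exact continuous_finsetSum _ fun e' _ => continuous_apply _

theorem continuous_momMap (n : ℕ) (l m : Lattice D) : Continuous (momMap n l m) := by
  refine (PiLp.continuous_toLp 2 _).comp (continuous_pi fun j => ?_)
  fun_prop

/-- The connecting map `γ_{lm} : X^m → X^l`. -/
def phaseMap (n : ℕ) (l m : Lattice D) : C(Phase n m, Phase n l) where
  toFun x := (confMap n l m x.1, momMap n l m x.2)
  continuous_toFun := ((continuous_confMap n l m).comp continuous_fst).prodMk
    ((continuous_momMap n l m).comp continuous_snd)

/-- The continuum phase space `X^∞`, the inverse limit of the spaces `X^l`. -/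
def PhaseInf (n D : ℕ) : Type :=
  {x : ∀ l : Lattice D, Phase n l // ∀ l m : Lattice D, l ≤ m → phaseMap n l m (x m) = x l}

instance (n D : ℕ) : TopologicalSpace (PhaseInf n D) :=
  inferInstanceAs (TopologicalSpace
    {x : ∀ l : Lattice D, Phase n l // ∀ l m : Lattice D, l ≤ m → phaseMap n l m (x m) = x l})

/-- The canonical map `γ_l : X^∞ → X^l`. -/
def phaseProj (n : ℕ) (l : Lattice D) : C(PhaseInf n D, Phase n l) where
  toFun x := x.1 l
  continuous_toFun := (continuous_apply l).comp continuous_subtype_val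

/-- The *-algebra `𝒜_0^l`: the linear span of the functions
`e_b ⊗ e^{iξ·} (g ∘ P_U)` with `b ∈ (ℤ^n)^l`, `U ⊆ 𝔤^l` linear, `ξ ∈ 𝔤^l` and `g` a Schwartz
function on `U` with compactly supported Fourier transform. -/
def latticeAlgebra (n : ℕ) (l : Lattice D) : Submodule ℂ (BoundedContinuousFunction (Phase n l) ℂ) :=
  Submodule.span ℂ {f | ∃ (b : l.edges × Fin n → ℤ) (U : Submodule ℝ (Mom n l)) (g : 𝓢(U, ℂ))
    (ξ : Mom n l), HasCompactSupport (𝓕 (g : U → ℂ)) ∧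
    ∀ (q : Conf n l) (p : Mom n l), f (q, p) =
      UnitAddTorus.mFourier b q *
        (Complex.exp (Complex.I * (inner ℝ ξ p : ℝ)) * g (U.orthogonalProjectionOnto p))}

/-- The set `B^l ⊆ 𝔤^l`, where `B` is the open ball of radius `1/(2π)` around `0` in `𝔤 = ℝ^n`. -/
def ballB (n : ℕ) (l : Lattice D) : Set (Mom n l) :=
  {ξ | ∀ e : l.edges, ‖(WithLp.toLp 2 fun i => ξ (e, i) : EuclideanSpace ℝ (Fin n))‖
    < 1 / (2 * Real.pi)}

/-- The integral of `φ` with respect to the complex measure `μ`. -/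
def cintegral {X : Type*} [MeasurableSpace X] (μ : ComplexMeasure X) (φ : X → ℂ) : ℂ :=
  VectorMeasure.integral μ φ (ContinuousLinearMap.mul ℝ ℂ)

/-- The support of the complex measure `μ` is contained in `B^l`. (As `B^l` is bounded and a
support is closed, the support is then compact.) -/
def SupportedInBall {n : ℕ} {l : Lattice D} (μ : ComplexMeasure (Mom n l)) : Prop :=
  ∃ K : Set (Mom n l), IsCompact K ∧ K ⊆ ballB n l ∧
    ∀ s : Set (Mom n l), MeasurableSet s → Disjoint s K → μ s = 0

/-- The inverse Fourier transform `μ̌(p) = ∫ e^{iξ·p} dμ(ξ)` of a complex measure. -/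
def invFourier {n : ℕ} {l : Lattice D} (μ : ComplexMeasure (Mom n l)) (p : Mom n l) : ℂ :=
  cintegral μ fun ξ => Complex.exp (Complex.I * (inner ℝ ξ p : ℝ))

/-- The operator system `ℳ_0^l`: the linear span of the functions `g ⊗ μ̌ ∈ 𝒜_0^l` with
`supp μ ⊆ B^l`. -/
def operatorSystem (n : ℕ) (l : Lattice D) : Submodule ℂ (BoundedContinuousFunction (Phase n l) ℂ) :=
  Submodule.span ℂ {f | f ∈ latticeAlgebra n l ∧
    ∃ (g : C(Conf n l, ℂ)) (μ : ComplexMeasure (Mom n l)), SupportedInBall μ ∧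
      ∀ (q : Conf n l) (p : Mom n l), f (q, p) = g q * invFourier μ p}

/-- The *-algebra `𝒜_0^∞ ⊆ C_b(X^∞)`: the *-algebra generated by the functions `f ∘ γ_l` with
`l` a lattice and `f ∈ 𝒜_0^l`. -/
def classicalAlgebra (n D : ℕ) : StarSubalgebra ℂ (BoundedContinuousFunction (PhaseInf n D) ℂ) :=
  StarAlgebra.adjoin ℂ {F | ∃ l : Lattice D, ∃ f ∈ latticeAlgebra n l,
    F = f.compContinuous (phaseProj n l)}

/-- The classical C*-algebra `A_0^∞`, the closure of `𝒜_0^∞` in `C_b(X^∞)`. -/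
def classicalCStar (n D : ℕ) : StarSubalgebra ℂ (BoundedContinuousFunction (PhaseInf n D) ℂ) :=
  (classicalAlgebra n D).topologicalClosure

/-! ### Poisson bracket -/

open Classical in
/-- The derivative in the configuration coordinate `j`. -/
def confDeriv {n : ℕ} {l : Lattice D} (j : l.edges × Fin n) (f : Phase n l → ℂ)
    (x : Phase n l) : ℂ :=
  deriv (fun t : ℝ => f (x.1 + toConf (EuclideanSpace.single j t), x.2)) 0

open Classical in
/-- The derivative in the momentum coordinate `j`. -/
def momDeriv {n : ℕ} {l : Lattice D} (j : l.edges × Fin n) (f : Phase n l → ℂ)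
    (x : Phase n l) : ℂ :=
  deriv (fun t : ℝ => f (x.1, x.2 + EuclideanSpace.single j t)) 0

/-- The Poisson bracket `{f, g} = ∑ⱼ (∂f/∂pⱼ ∂g/∂qⱼ - ∂f/∂qⱼ ∂g/∂pⱼ)` on `X^l = T*G^l`. -/
def latticeBracket {n : ℕ} {l : Lattice D} (f g : Phase n l → ℂ) (x : Phase n l) : ℂ :=
  ∑ j : l.edges × Fin n, (momDeriv j f x * confDeriv j g x - confDeriv j f x * momDeriv j g x)

/-- `H = {F, G}` on the continuum: `{f ∘ γ_l, g ∘ γ_l} = {f, g} ∘ γ_l`, whichever way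
`F` and `G` are written as `f ∘ γ_l` and `g ∘ γ_l` on a common lattice `l`. -/
def IsContinuumBracket {n D : ℕ} (F G H : classicalAlgebra n D) : Prop :=
  ∀ (l : Lattice D), ∀ f ∈ latticeAlgebra n l, ∀ g ∈ latticeAlgebra n l,
    F.1 = f.compContinuous (phaseProj n l) → G.1 = g.compContinuous (phaseProj n l) →
    ∀ x : PhaseInf n D, H.1 x = latticeBracket f g (phaseProj n l x)

/-- The Poisson bracket on `𝒜_0^∞`: the element characterized by `IsContinuumBracket`. -/
def continuumBracket {n D : ℕ} (F G : classicalAlgebra n D) : classicalAlgebra n D :=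
  Classical.epsilon fun H => IsContinuumBracket F G H

/-! ### Quantization on a lattice -/

/-- The Hilbert space `ℋ^l = L²(G^l)`. -/
abbrev LatticeHilbert (n : ℕ) (l : Lattice D) : Type := Lp ℂ 2 (confHaar n l)

/-- A way of writing `f = ∑ₖ gₖ ⊗ μ̌ₖ`, with `gₖ ∈ C(G^l)` and complex measures `μₖ` supported
in `B^l`. -/
structure Expansion {n : ℕ} {l : Lattice D} (f : BoundedContinuousFunction (Phase n l) ℂ) where
  K : ℕ
  g : Fin K → C(Conf n l, ℂ)
  μ : Fin K → ComplexMeasure (Mom n l)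
  supported : ∀ k, SupportedInBall (μ k)
  eq_sum : ∀ (q : Conf n l) (p : Mom n l), f (q, p) = ∑ k, g k q * invFourier (μ k) p

/-- `T` is the quantization of `f`: for every expansion `f = ∑ₖ gₖ ⊗ μ̌ₖ` one has
`(T ψ)[y] = ∑ₖ ∫ gₖ[y + ℏξ/2] ψ[y + ℏξ] dμₖ(ξ)`. -/
def IsLatticeQuantization {n : ℕ} {l : Lattice D} (ℏ : ℝ)
    (f : BoundedContinuousFunction (Phase n l) ℂ)
    (T : LatticeHilbert n l →L[ℂ] LatticeHilbert n l) : Prop :=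
  ∀ (r : Expansion f) (ψ : LatticeHilbert n l),
    (T ψ : Conf n l → ℂ) =ᵐ[confHaar n l] fun y =>
      ∑ k, cintegral (r.μ k) fun ξ =>
        r.g k (y + toConf ((ℏ / 2) • ξ)) * (ψ : Conf n l → ℂ) (y + toConf (ℏ • ξ))

/-- The quantization map `Q_ℏ^l` (relevant on `ℳ_0^l`): the operator characterized by
`IsLatticeQuantization`. -/
def latticeQuantization {n : ℕ} {l : Lattice D} (ℏ : ℝ)
    (f : BoundedContinuousFunction (Phase n l) ℂ) : LatticeHilbert n l →L[ℂ] LatticeHilbert n l :=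
  Classical.epsilon fun T => IsLatticeQuantization ℏ f T

/-! ### The direct limit of Hilbert spaces -/

/-- The group of compatible families of configurations, as a subgroup of `∏ₗ G^l`. -/
def confInfSubgroup (n D : ℕ) : AddSubgroup (∀ l : Lattice D, Conf n l) where
  carrier := {q | ∀ l m : Lattice D, l ≤ m → confMap n l m (q m) = q l}
  add_mem' {q r} hq hr l m h := by simp [hq l m h, hr l m h]
  zero_mem' l m h := by simp
  neg_mem' {q} hq l m h := by simp [hq l m h]

/-- The compact group `G^∞`, the inverse limit of the groups `G^l`. -/
def ConfInf (n D : ℕ) : Type := confInfSubgroup n D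

instance (n D : ℕ) : AddCommGroup (ConfInf n D) :=
  inferInstanceAs (AddCommGroup (confInfSubgroup n D))

instance (n D : ℕ) : TopologicalSpace (ConfInf n D) :=
  inferInstanceAs (TopologicalSpace (confInfSubgroup n D))

instance (n D : ℕ) : IsTopologicalAddGroup (ConfInf n D) :=
  inferInstanceAs (IsTopologicalAddGroup (confInfSubgroup n D))

instance (n D : ℕ) : T2Space (ConfInf n D) :=
  inferInstanceAs (T2Space (confInfSubgroup n D))

instance (n D : ℕ) : MeasurableSpace (ConfInf n D) := borel _

instance (n D : ℕ) : BorelSpace (ConfInf n D) := ⟨rfl⟩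

theorem isClosed_confInfSubgroup (n D : ℕ) :
    IsClosed (confInfSubgroup n D : Set (∀ l : Lattice D, Conf n l)) := by
  have : (confInfSubgroup n D : Set (∀ l : Lattice D, Conf n l)) =
      ⋂ (l : Lattice D) (m : Lattice D) (_ : l ≤ m), {q | confMap n l m (q m) = q l} := by
    ext q
    simp [confInfSubgroup]
  rw [this]
  refine isClosed_iInter fun l => isClosed_iInter fun m => isClosed_iInter fun _ => ?_
  exact isClosed_eq ((continuous_confMap n l m).comp (continuous_apply m)) (continuous_apply l)

instance (n D : ℕ) : CompactSpace (ConfInf n D) :=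
  isCompact_iff_compactSpace.mp (isClosed_confInfSubgroup n D).isCompact

/-- The canonical homomorphism `γ_l^conf : G^∞ → G^l`. -/
def confProj (n : ℕ) (l : Lattice D) : ConfInf n D →+ Conf n l where
  toFun q := q.1 l
  map_zero' := rfl
  map_add' _ _ := rfl

theorem continuous_confProj (n : ℕ) (l : Lattice D) : Continuous (confProj n l) :=
  (continuous_apply l).comp continuous_subtype_val

/-- The normalized Haar measure on `G^∞`. -/
def confInfHaar (n D : ℕ) : Measure (ConfInf n D) := Measure.addHaarMeasure ⊤

theorem exists_step {N : ℕ} (t : Fin (N + 2) → ℝ) (s : ℝ) (h0 : t 0 ≤ s)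
    (h1 : s ≤ t (Fin.last (N + 1))) : ∃ i : Fin (N + 1), t i.castSucc ≤ s ∧ s ≤ t i.succ := by
  induction N with
  | zero => exact ⟨0, h0, h1⟩
  | succ N ih =>
    by_cases h : s ≤ t (Fin.last (N + 1)).castSucc
    · obtain ⟨i, hi, hi'⟩ := ih (fun j => t j.castSucc) h0 h
      exact ⟨i.castSucc, hi, hi'⟩
    · exact ⟨Fin.last (N + 1), (not_le.mp h).le, h1⟩

theorem Edge.seg_eq_image (e : Edge D) : e.seg = AffineMap.lineMap e.1 e.2 '' Set.Icc (0 : ℝ) 1 :=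
  segment_eq_image_lineMap ℝ e.1 e.2

theorem lineMap_seg (e : Edge D) (a b : ℝ) (hab : a ≤ b) :
    Edge.seg (AffineMap.lineMap e.1 e.2 a, AffineMap.lineMap e.1 e.2 b) =
      AffineMap.lineMap e.1 e.2 '' Set.Icc a b := by
  rw [← segment_eq_Icc hab, image_segment]
  rfl

/-- If `l ≤ m`, then every edge of `l` is covered by its pieces in `m`. -/
theorem seg_eq_iUnion_pieces {l m : Lattice D} (h : l ≤ m) {e : Edge D} (he : e ∈ l.edges) :
    e.seg = ⋃ e' ∈ pieces m e, e'.1.seg := by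
  apply Set.Subset.antisymm
  · intro x hx
    rw [Edge.seg_eq_image] at hx
    obtain ⟨s, ⟨hs0, hs1⟩, rfl⟩ := hx
    obtain ⟨N, t, ht, t0, t1, hm⟩ := h e he
    obtain ⟨i, hi, hi'⟩ := exists_step t s (t0 ▸ hs0) (t1 ▸ hs1)
    have hlt : t i.castSucc ≤ t i.succ := hi.trans hi'
    refine Set.mem_iUnion₂.mpr ⟨⟨_, hm i⟩, ?_, ?_⟩
    · simp only [pieces, Finset.mem_filter, Finset.mem_univ, true_and]
      rw [lineMap_seg _ _ _ hlt, Edge.seg_eq_image]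
      refine Set.image_mono (Set.Icc_subset_Icc ?_ ?_)
      · rw [← t0]; exact ht.monotone (Fin.zero_le _)
      · rw [← t1]; exact ht.monotone (Fin.le_last _)
    · rw [lineMap_seg _ _ _ hlt]
      exact ⟨s, ⟨hi, hi'⟩, rfl⟩
  · intro x hx
    obtain ⟨e', he', hx'⟩ := Set.mem_iUnion₂.mp hx
    exact mem_pieces.mp he' hx'

/-- The length of the part of the edge `e'` that lies on the edge `e`. -/
def overlap (e e' : Edge D) : ℝ := (μH[1] (e.seg ∩ e'.seg)).toReal

theorem measurableSet_seg (e : Edge D) : MeasurableSet e.seg := by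
  rw [Edge.seg_eq_image]
  exact (isCompact_Icc.image (by fun_prop)).isClosed.measurableSet

theorem hausdorff_seg (e : Edge D) : μH[1] e.seg = edist e.1 e.2 :=
  hausdorffMeasure_segment _ _

theorem hausdorff_inter_ne_top (e e' : Edge D) : μH[1] (e.seg ∩ e'.seg) ≠ ∞ :=
  ((measure_mono Set.inter_subset_left).trans_lt
    (by rw [hausdorff_seg]; exact edist_lt_top _ _)).ne

/-- Distinct edges of a lattice overlap in a set of length zero. -/
theorem hausdorff_inter_eq_zero (m : Lattice D) {e e' : Edge D} (he : e ∈ m.edges)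
    (he' : e' ∈ m.edges) (hne : e ≠ e') : μH[1] (e.seg ∩ e'.seg) = 0 := by
  have hfin : Set.Finite ({e.1, e.2, e'.1, e'.2} : Set (EuclideanSpace ℝ (Fin D))) := by simp
  have := Measure.nullSingletonClass_hausdorff (EuclideanSpace ℝ (Fin D)) (zero_lt_one' ℝ)
  refine measure_mono_null ?_ (hfin.measure_zero _)
  rintro x ⟨hx, hx'⟩
  by_contra hcon
  simp only [Set.mem_insert_iff, Set.mem_singleton_iff, not_or] at hcon
  exact Set.disjoint_left.mp (m.disjoint e he e' he' hne)
    (mem_openSegment_of_ne_left_right (Ne.symm hcon.1) (Ne.symm hcon.2.1) hx)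
    (mem_openSegment_of_ne_left_right (Ne.symm hcon.2.2.1) (Ne.symm hcon.2.2.2) hx')

theorem sum_overlap {l m : Lattice D} (h : l ≤ m) {e' : Edge D} (he' : e' ∈ l.edges) (e : Edge D) :
    ∑ e'' ∈ pieces m e', overlap e e''.1 = overlap e e' := by
  unfold overlap
  rw [← ENNReal.toReal_sum fun a _ => hausdorff_inter_ne_top _ _]
  conv_rhs => rw [seg_eq_iUnion_pieces h he', Set.inter_iUnion₂]
  rw [measure_biUnion_finset₀]
  · intro a _ b _ hab
    refine measure_mono_null ?_ (hausdorff_inter_eq_zero m a.2 b.2 fun hc => hab (Subtype.ext hc))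
    exact fun x hx => ⟨hx.1.2, hx.2.2⟩
  · exact fun b _ => ((measurableSet_seg _).inter (measurableSet_seg _)).nullMeasurableSet

theorem overlap_self (e : Edge D) : overlap e e = e.length := by
  rw [overlap, Set.inter_self, hausdorff_seg, Edge.length, edist_dist, dist_eq_norm,
    ENNReal.toReal_ofReal (norm_nonneg _)]

theorem Lattice.length_pos (l : Lattice D) {e : Edge D} (he : e ∈ l.edges) : 0 < e.length := by
  refine norm_pos_iff.mpr (sub_ne_zero.mpr fun h => ?_)
  have := l.lex_lt e he
  rw [h] at this
  exact lt_irrefl _ this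

/-- Every configuration on a lattice extends to the continuum. -/
theorem confProj_surjective (n : ℕ) (l : Lattice D) : Function.Surjective (confProj n l) := by
  intro q
  have hx : ∀ j, ∃ x : ℝ, (x : UnitAddCircle) = q j := fun j => QuotientAddGroup.mk_surjective _
  choose x hx using hx
  let r : ∀ m : Lattice D, Conf n m := fun m j =>
    ((∑ e : l.edges, overlap e.1 j.1.1 / e.1.length * x (e, j.2) : ℝ) : UnitAddCircle)
  refine ⟨⟨r, ?_⟩, ?_⟩
  · intro m₁ m₂ h
    funext j
    change ∑ e' ∈ pieces m₂ j.1.1, r m₂ (e', j.2) = r m₁ j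
    simp only [r]
    refine (map_sum (QuotientAddGroup.mk' (AddSubgroup.zmultiples (1 : ℝ))) _ _).symm.trans ?_
    rw [QuotientAddGroup.mk'_apply, Finset.sum_comm]
    congr 1
    refine Finset.sum_congr rfl fun e _ => ?_
    rw [← Finset.sum_mul, ← Finset.sum_div, sum_overlap h j.1.2]
  · funext j
    change r l j = q j
    rw [← hx j]
    simp only [r]
    congr 1
    rw [Finset.sum_eq_single j.1]
    · rw [overlap_self, div_self (l.length_pos j.1.2).ne', one_mul]
    · intro e _ hne
      rw [overlap, hausdorff_inter_eq_zero l e.2 j.1.2 fun h => hne (Subtype.ext h)]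
      simp
    · simp

instance (n D : ℕ) : (confInfHaar n D).IsAddHaarMeasure := by
  unfold confInfHaar; infer_instance

instance (n : ℕ) (l : Lattice D) : (confHaar n l).IsAddHaarMeasure := by
  unfold confHaar; infer_instance

theorem measurePreserving_confProj (n : ℕ) (l : Lattice D) :
    MeasurePreserving (confProj n l) (confInfHaar n D) (confHaar n l) := by
  refine AddMonoidHom.measurePreserving (continuous_confProj n l) (confProj_surjective n l) ?_
  have h1 : confInfHaar n D Set.univ = 1 := Measure.addHaarMeasure_self (K₀ := ⊤)
  rw [h1, confHaar, measure_univ]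

/-- The isometry `(γ_l^conf)^* : ℋ^l → L²(G^∞)`. -/
def pullback (n : ℕ) (l : Lattice D) : LatticeHilbert n l →ₗᵢ[ℂ] Lp ℂ 2 (confInfHaar n D) :=
  Lp.compMeasurePreservingₗᵢ ℂ (confProj n l) (measurePreserving_confProj n l)

/-- The closure in `L²(G^∞)` of the union of the spaces `(γ_l^conf)^* ℋ^l`. -/
def hilbertSubspace (n D : ℕ) : Submodule ℂ (Lp ℂ 2 (confInfHaar n D)) :=
  (⨆ l : Lattice D, LinearMap.range (pullback n l).toLinearMap).topologicalClosure

/-- The Hilbert space `ℋ^∞`, the direct limit of the Hilbert spaces `ℋ^l`: the completion of the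
union of the spaces `(γ_l^conf)^* ℋ^l`, realized inside `L²(G^∞)`. -/
def HilbertInf (n D : ℕ) : Type := hilbertSubspace n D

instance (n D : ℕ) : NormedAddCommGroup (HilbertInf n D) :=
  inferInstanceAs (NormedAddCommGroup (hilbertSubspace n D))

instance (n D : ℕ) : InnerProductSpace ℂ (HilbertInf n D) :=
  inferInstanceAs (InnerProductSpace ℂ (hilbertSubspace n D))

instance (n D : ℕ) : CompleteSpace (HilbertInf n D) :=
  Submodule.topologicalClosure.completeSpace _

/-- The canonical isometry `u^l = (γ_l^conf)^* : ℋ^l → ℋ^∞`. -/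
def hilbertEmb (n : ℕ) (l : Lattice D) : LatticeHilbert n l →ₗᵢ[ℂ] HilbertInf n D where
  toFun ψ := ⟨pullback n l ψ, Submodule.le_topologicalClosure _
    (Submodule.mem_iSup_of_mem l (LinearMap.mem_range_self (pullback n l).toLinearMap ψ))⟩
  map_add' ψ φ := Subtype.ext (map_add (pullback n l) ψ φ)
  map_smul' c ψ := Subtype.ext (map_smul (pullback n l) c ψ)
  norm_map' ψ := (pullback n l).norm_map ψ

/-! ### Quantization on the continuum -/

/-- `T` is the quantization of `F ∈ 𝒜_0^∞`: whenever `F = f ∘ γ_l` with `f ∈ ℳ_0^l`, one has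
`T u^m ψ = u^m Q_ℏ^m(f ∘ γ_{lm}) ψ` for all `m ≥ l` and `ψ ∈ ℋ^m`. -/
def IsContinuumQuantization {n D : ℕ} (ℏ : ℝ) (F : classicalAlgebra n D)
    (T : HilbertInf n D →L[ℂ] HilbertInf n D) : Prop :=
  ∀ l : Lattice D, ∀ f ∈ operatorSystem n l, F.1 = f.compContinuous (phaseProj n l) →
    ∀ m : Lattice D, l ≤ m → ∀ ψ : LatticeHilbert n m,
      T (hilbertEmb n m ψ) =
        hilbertEmb n m (latticeQuantization ℏ (f.compContinuous (phaseMap n l m)) ψ)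

/-- The quantization map `Q_ℏ^∞ : 𝒜_0^∞ → ℬ(ℋ^∞)`: the bounded operator characterized by
`IsContinuumQuantization`. -/
def continuumQuantization {n D : ℕ} (ℏ : ℝ) (F : classicalAlgebra n D) :
    HilbertInf n D →L[ℂ] HilbertInf n D :=
  Classical.epsilon fun T => IsContinuumQuantization ℏ F T

/-- The quantum C*-algebra `A_ℏ^∞ ⊆ ℬ(ℋ^∞)`: the closure of the *-algebra (generated by)
`𝒜_ℏ^∞ = Q_ℏ^∞(𝒜_0^∞)`. -/
def quantumCStar (n D : ℕ) (ℏ : ℝ) : StarSubalgebra ℂ (HilbertInf n D →L[ℂ] HilbertInf n D) :=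
  (StarAlgebra.adjoin ℂ
    (Set.range (continuumQuantization (n := n) (D := D) ℏ))).topologicalClosure

end LatticeGauge

end

/-! On Fourier modes Weyl quantization is explicit. For f = ∑ᵢ e_{bᵢ} ⊗ hᵢ the integral formula
gives e_a ↦ ∑ᵢ hᵢ(πℏ(2a + bᵢ)) e_{a+bᵢ}, a finite sum of weighted shifts. The characters of G^∞ form
a Hilbert basis of ℋ^∞ (`charBasis`). Each character χ has a momentum P χ on every lattice
(`charMom`), and the quantization of f ∘ γ_l is e_χ ↦ ∑ᵢ hᵢ(πℏ P(2χ + bᵢ)) e_{χ+bᵢ} (`continuumOp`).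
Its matrix elements are integrals over G^∞ of the character χ - χ' against F at momentum πℏ(χ + χ')
(`inner_continuumOp`). They involve F alone, which yields well-definedness, linearity and
compatibility with the involution.

On the classical side, any two lattices have a common refinement, obtained by cutting all edges at
endpoints and crossing points (`exists_subdivides`). Hence the cylinder functions already form a
*-algebra. The transpose of γ^mom multiplies frequencies by d_{e'}/d_e. The momentum factors have
bounded frequencies, so these enter B after a fine enough refinement (`exists_operatorSystem_rep`).

Von Neumann's and Dirac's conditions follow from an exact composition law (`continuumOp_mul`): the
momentum factors are multiplied after translations of order ℏ, and a Taylor estimate uniform in p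
bounds the error in operator norm.

Rieffel's condition and injectivity rest on a feature of the continuum. Put y + · in place of the
argument of each hᵢ to get a family of operators indexed by y (`fibreOp`). Conjugation with e_χ ↦
e_{χ+η} translates y by 2πℏ P η. The momenta P η are dense, because refinement produces arbitrarily
small weights (`denseRange_charMom`). So for ℏ ≠ 0 the norm of the quantization is the supremum over
y of the norms in the family (`fibreNorm`). At ℏ = 0 the operator at y is multiplication by f(·, y),
and the same supremum is the sup norm (`norm_eq_fibreNorm`). It remains to see that `fibreNorm` is
continuous in ℏ. The norm of a finite sum of shifts is detected, up to ε, by vectors whose momenta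
lie in a ball of fixed radius (`exists_localization`). On a ball around z, changing ℏ into ℏ' nearly
amounts to translating y by 2π(ℏ - ℏ')z, which the supremum absorbs (`fibreOp_compare`). Finally, if
the quantization vanishes at some ℏ ≠ 0, so does the whole family at ℏ, hence at 0, because the
matrix elements at ℏ are those at 0 for a translated y. -/

noncomputable section
open scoped ContDiff
namespace LatticeGauge

/-! ### Weighted shifts along a Hilbert basis -/

section WeightedShift

variable {Λ H : Type*} [AddCommGroup Λ] [NormedAddCommGroup H] [InnerProductSpace ℂ H]

omit [AddCommGroup Λ] in
theorem HilbertBasis.ext_clm {H' : Type*} [NormedAddCommGroup H'] [NormedSpace ℂ H']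
    (e : HilbertBasis Λ ℂ H) {S T : H →L[ℂ] H'}
    (h : ∀ χ, S (e χ) = T (e χ)) : S = T := by
  refine ContinuousLinearMap.ext_on (s := Set.range e) ?_ ?_
  · exact Submodule.dense_iff_topologicalClosure_eq_top.mpr e.dense_span
  · rintro _ ⟨χ, rfl⟩
    exact h χ

/-- In coordinates the operator is f ↦ k(· - b) f(· - b) on ℓ², the composite of a permutation of
coordinates and a multiplication by a function bounded by C. -/
theorem exists_weightedShift (e : HilbertBasis Λ ℂ H) (b : Λ) (k : Λ → ℂ) (C : ℝ)
    (hk : ∀ χ, ‖k χ‖ ≤ C) :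
    ∃ T : H →L[ℂ] H, (∀ χ, T (e χ) = k χ • e (χ + b)) ∧ ‖T‖ ≤ C := by
  classical
  have hC : 0 ≤ C := (norm_nonneg _).trans (hk 0)
  have hmem : ∀ f : lp (fun _ : Λ => ℂ) 2, Memℓp (fun χ => k (χ - b) * f (χ - b)) 2 := by
    intro f
    refine memℓp_gen ?_
    have h1 := ((lp.memℓp f).summable (by norm_num)).mul_left (C ^ 2)
    have h2 := (Equiv.subRight b).summable_iff.mpr h1
    refine h2.of_nonneg_of_le (fun χ => by positivity) fun χ => ?_
    simp only [Function.comp, Equiv.subRight_apply, norm_mul, ENNReal.toReal_ofNat, Real.rpow_ofNat,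
      mul_pow]
    gcongr
    exact hk _
  let S : lp (fun _ : Λ => ℂ) 2 →ₗ[ℂ] lp (fun _ : Λ => ℂ) 2 :=
    { toFun := fun f => ⟨_, hmem f⟩
      map_add' := fun f g => by
        ext χ
        simp only [lp.coeFn_add, Pi.add_apply, mul_add]
      map_smul' := fun c f => by
        ext χ
        simp [mul_left_comm] }
  have hS : ∀ f, ‖S f‖ ≤ C * ‖f‖ := by
    intro f
    refine lp.norm_le_of_tsum_le (by norm_num) (by positivity) ?_
    have h1 := ((lp.memℓp f).summable (by norm_num)).mul_left (C ^ 2)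
    have h2 := (Equiv.subRight b).summable_iff.mpr h1
    have h3 := lp.norm_rpow_eq_tsum (by norm_num : (0:ℝ) < (2 : ℝ≥0∞).toReal) f
    have h4 : (C * ‖f‖) ^ (2 : ℝ≥0∞).toReal = ∑' χ, C ^ 2 * ‖f (χ - b)‖ ^ (2 : ℝ≥0∞).toReal := by
      rw [Real.mul_rpow hC (norm_nonneg _), h3, tsum_mul_left]
      congr 1
      · simp
      · exact ((Equiv.subRight b).tsum_eq fun χ => ‖f χ‖ ^ (2 : ℝ≥0∞).toReal).symm
    rw [h4]
    have h5 : ∀ χ, ‖S f χ‖ ^ (2 : ℝ≥0∞).toReal ≤ C ^ 2 * ‖f (χ - b)‖ ^ (2 : ℝ≥0∞).toReal := by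
      intro χ
      change ‖k (χ - b) * f (χ - b)‖ ^ (2 : ℝ≥0∞).toReal ≤ _
      simp only [norm_mul, ENNReal.toReal_ofNat, Real.rpow_ofNat, mul_pow]
      gcongr
      exact hk _
    exact ((lp.memℓp (S f)).summable (by norm_num)).tsum_le_tsum h5 h2
  let T := e.repr.symm.toContinuousLinearEquiv.toContinuousLinearMap ∘L
    (S.mkContinuous C hS) ∘L e.repr.toContinuousLinearEquiv.toContinuousLinearMap
  refine ⟨T, fun χ => ?_, ContinuousLinearMap.opNorm_le_bound _ hC fun f => ?_⟩
  · apply e.repr.injective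
    simp only [T, ContinuousLinearMap.comp_apply, map_smul]
    simp only [ContinuousLinearEquiv.coe_coe, LinearIsometryEquiv.coe_toContinuousLinearEquiv,
      LinearIsometryEquiv.apply_symm_apply, LinearMap.mkContinuous_apply, HilbertBasis.repr_self]
    ext χ'
    change k (χ' - b) * (lp.single 2 χ (1 : ℂ) : Λ → ℂ) (χ' - b) = k χ * (lp.single 2 (χ + b) (1 : ℂ) : Λ → ℂ) χ'
    by_cases h : χ' - b = χ
    · have : χ' = χ + b := by rw [← h]; abel
      subst this
      simp
    · have : χ' ≠ χ + b := by rintro rfl; exact h (by abel)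
      simp [lp.single_apply, h, this]
  · change ‖e.repr.symm (S (e.repr f))‖ ≤ _
    rw [LinearIsometryEquiv.norm_map]
    exact (hS _).trans_eq (by rw [LinearIsometryEquiv.norm_map])

open Classical in
/-- The weighted shift `e_χ ↦ k(χ) e_{χ+b}`, for a bounded function `k`. -/
def weightedShift (e : HilbertBasis Λ ℂ H) (b : Λ) (k : Λ → ℂ) : H →L[ℂ] H :=
  if h : ∃ C, ∀ χ, ‖k χ‖ ≤ C then (exists_weightedShift e b k h.choose h.choose_spec).choose else 0

theorem weightedShift_apply (e : HilbertBasis Λ ℂ H) (b : Λ) {k : Λ → ℂ}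
    (hk : ∃ C, ∀ χ, ‖k χ‖ ≤ C) (χ : Λ) : weightedShift e b k (e χ) = k χ • e (χ + b) := by
  rw [weightedShift, dif_pos hk]
  exact (exists_weightedShift e b k hk.choose hk.choose_spec).choose_spec.1 χ

/-- The operator is defined from some chosen bound, not from C. The one built from C agrees with it
on the basis, so the sharper bound carries over. -/
theorem norm_weightedShift_le (e : HilbertBasis Λ ℂ H) (b : Λ) {k : Λ → ℂ} {C : ℝ}
    (hk : ∀ χ, ‖k χ‖ ≤ C) : ‖weightedShift e b k‖ ≤ C := by
  obtain ⟨T, hT, hTC⟩ := exists_weightedShift e b k C hk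
  have : weightedShift e b k = T := HilbertBasis.ext_clm e fun χ => by
    rw [hT, weightedShift_apply e b ⟨C, hk⟩]
  rwa [this]

theorem weightedShift_mul (e : HilbertBasis Λ ℂ H) (b b' : Λ) {k k' : Λ → ℂ}
    (hk : ∃ C, ∀ χ, ‖k χ‖ ≤ C) (hk' : ∃ C, ∀ χ, ‖k' χ‖ ≤ C) :
    weightedShift e b k * weightedShift e b' k' =
      weightedShift e (b' + b) fun χ => k (χ + b') * k' χ := by
  obtain ⟨C, hC⟩ := hk
  obtain ⟨C', hC'⟩ := hk'
  refine HilbertBasis.ext_clm e fun χ => ?_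
  have h : ∃ C, ∀ χ, ‖k (χ + b') * k' χ‖ ≤ C := ⟨C * C', fun χ => by
    rw [norm_mul]
    exact mul_le_mul (hC _) (hC' _) (norm_nonneg _) ((norm_nonneg _).trans (hC χ))⟩
  rw [mul_apply_eq_comp, weightedShift_apply e b' ⟨C', hC'⟩, map_smul,
    weightedShift_apply e b ⟨C, hC⟩, weightedShift_apply e _ h, smul_smul, mul_comm, add_assoc]

theorem weightedShift_add (e : HilbertBasis Λ ℂ H) (b : Λ) {k k' : Λ → ℂ}
    (hk : ∃ C, ∀ χ, ‖k χ‖ ≤ C) (hk' : ∃ C, ∀ χ, ‖k' χ‖ ≤ C) :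
    weightedShift e b k + weightedShift e b k' = weightedShift e b fun χ => k χ + k' χ := by
  obtain ⟨C, hC⟩ := hk
  obtain ⟨C', hC'⟩ := hk'
  refine HilbertBasis.ext_clm e fun χ => ?_
  rw [add_apply, weightedShift_apply e b ⟨C, hC⟩, weightedShift_apply e b ⟨C', hC'⟩,
    weightedShift_apply e b ⟨C + C', fun χ => (norm_add_le _ _).trans (add_le_add (hC χ) (hC' χ))⟩,
    add_smul]

theorem weightedShift_sub (e : HilbertBasis Λ ℂ H) (b : Λ) {k k' : Λ → ℂ}
    (hk : ∃ C, ∀ χ, ‖k χ‖ ≤ C) (hk' : ∃ C, ∀ χ, ‖k' χ‖ ≤ C) :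
    weightedShift e b k - weightedShift e b k' = weightedShift e b fun χ => k χ - k' χ := by
  obtain ⟨C, hC⟩ := hk
  obtain ⟨C', hC'⟩ := hk'
  refine HilbertBasis.ext_clm e fun χ => ?_
  rw [sub_apply, weightedShift_apply e b ⟨C, hC⟩, weightedShift_apply e b ⟨C', hC'⟩,
    weightedShift_apply e b ⟨C + C', fun χ => (norm_sub_le _ _).trans (add_le_add (hC χ) (hC' χ))⟩,
    sub_smul]

theorem weightedShift_apply_sum (e : HilbertBasis Λ ℂ H) (b : Λ) {k : Λ → ℂ}
    (hk : ∃ C, ∀ χ, ‖k χ‖ ≤ C) (s : Finset Λ) (c : Λ → ℂ) :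
    weightedShift e b k (∑ χ ∈ s, c χ • e χ) = ∑ χ ∈ s, (c χ * k χ) • e (χ + b) := by
  rw [map_sum]
  refine Finset.sum_congr rfl fun χ _ => ?_
  rw [map_smul, weightedShift_apply e b hk, smul_smul]

theorem norm_sq_sum_basis (e : HilbertBasis Λ ℂ H) (b : Λ) (s : Finset Λ) (c : Λ → ℂ) :
    ‖∑ χ ∈ s, c χ • e (χ + b)‖ ^ 2 = ∑ χ ∈ s, ‖c χ‖ ^ 2 := by
  have h := (e.orthonormal.comp (fun χ => χ + b) (add_left_injective b)).inner_sum c c s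
  rw [Function.comp_def, inner_self_eq_norm_sq_to_K] at h
  have h2 : ∑ i ∈ s, (starRingEnd ℂ) (c i) * c i = ((∑ χ ∈ s, ‖c χ‖ ^ 2 : ℝ) : ℂ) := by
    push_cast
    refine Finset.sum_congr rfl fun χ _ => ?_
    rw [mul_comm, Complex.mul_conj, Complex.normSq_eq_norm_sq]
    push_cast
    rfl
  rw [h2] at h
  exact Complex.ofReal_injective (by simpa using h)

omit [AddCommGroup Λ] in
theorem exists_eq_sum_of_mem_span (e : HilbertBasis Λ ℂ H) {ψ : H}
    (h : ψ ∈ Submodule.span ℂ (Set.range e)) :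
    ∃ (s : Finset Λ) (c : Λ → ℂ), ψ = ∑ χ ∈ s, c χ • e χ := by
  obtain ⟨c, rfl⟩ := Finsupp.mem_span_range_iff_exists_finsupp.mp h
  exact ⟨c.support, c, rfl⟩

omit [AddCommGroup Λ] in
theorem opNorm_le_of_span (e : HilbertBasis Λ ℂ H) (T : H →L[ℂ] H) {M : ℝ} (hM : 0 ≤ M)
    (h : ∀ (s : Finset Λ) (c : Λ → ℂ),
      ‖T (∑ χ ∈ s, c χ • e χ)‖ ≤ M * ‖∑ χ ∈ s, c χ • e χ‖) : ‖T‖ ≤ M := by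
  refine T.opNorm_le_bound hM fun φ => ?_
  have hd : Dense (Submodule.span ℂ (Set.range e) : Set H) :=
    Submodule.dense_iff_topologicalClosure_eq_top.mpr e.dense_span
  refine hd.induction (P := fun φ => ‖T φ‖ ≤ M * ‖φ‖) ?_ ?_ φ
  · intro φ hφ
    obtain ⟨s, c, rfl⟩ := exists_eq_sum_of_mem_span e hφ
    exact h s c
  · exact isClosed_le (by fun_prop) (by fun_prop)

end WeightedShift

/-! ### Localization of finite-range operators in momentum balls -/

section Localization

/-- Large balls are almost invariant under bounded translations: B(x, R) \ B(y, R) lies in the shell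
of thickness r around B(y, R), of relative volume (1 + r/R)^d - 1, which tends to 0 as R → ∞. -/
theorem exists_ball_symmDiff_le {V : Type*} [NormedAddCommGroup V] [NormedSpace ℝ V]
    [FiniteDimensional ℝ V] [MeasurableSpace V] [BorelSpace V] (μ : Measure V) [μ.IsAddHaarMeasure]
    (r : ℝ) (hr : 0 ≤ r) {ε : ℝ} (hε : 0 < ε) :
    ∃ R > 0, ∀ x y : V, ‖x - y‖ ≤ r →
      μ.real (symmDiff (Metric.ball x R) (Metric.ball y R)) ≤ ε * μ.real (Metric.ball 0 R) := by
  set d := Module.finrank ℝ V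
  have hlim : Tendsto (fun R : ℝ => 2 * ((1 + r / R) ^ d - 1)) atTop (𝓝 (2 * ((1 + 0) ^ d - 1))) := by
    refine (((tendsto_const_nhds.add ?_).pow d).sub_const 1).const_mul 2
    exact tendsto_const_nhds.div_atTop tendsto_id
  have h0 : 2 * ((1 + (0 : ℝ)) ^ d - 1) < ε := by simpa using hε
  obtain ⟨R, hR, hR0⟩ := ((hlim.eventually_lt_const h0).and (eventually_gt_atTop 0)).exists
  refine ⟨R, hR0, fun x y hxy => ?_⟩
  have hball : ∀ (x : V) {t : ℝ}, 0 < t → μ.real (Metric.ball x t) = t ^ d * μ.real (Metric.ball 0 1) := by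
    intro x t ht
    rw [measureReal_def, Measure.addHaar_ball_of_pos μ x ht, ENNReal.toReal_mul,
      ENNReal.toReal_ofReal (by positivity), measureReal_def]
  have hdiff : ∀ x y : V, ‖x - y‖ ≤ r → μ.real (Metric.ball x R \ Metric.ball y R) ≤
      ((R + r) ^ d - R ^ d) * μ.real (Metric.ball 0 1) := by
    intro x y hxy
    have hsub : Metric.ball x R \ Metric.ball y R ⊆ Metric.ball y (R + r) \ Metric.ball y R := by
      refine Set.sdiff_subset_sdiff_left (Metric.ball_subset_ball' ?_)
      rw [dist_eq_norm]; linarith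
    refine (measureReal_mono hsub ((measure_mono Set.sdiff_subset).trans_lt measure_ball_lt_top).ne).trans_eq ?_
    rw [measureReal_sdiff (Metric.ball_subset_ball (by linarith)) measurableSet_ball, hball y hR0,
      hball y (by linarith : 0 < R + r)]
    ring
  have h1 := hdiff x y hxy
  have h2 := hdiff y x (by rwa [norm_sub_rev])
  have h3 : μ.real (symmDiff (Metric.ball x R) (Metric.ball y R)) ≤
      2 * ((R + r) ^ d - R ^ d) * μ.real (Metric.ball 0 1) := by
    rw [Set.symmDiff_def]
    refine (measureReal_union_le _ _).trans ?_
    linarith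
  refine h3.trans ?_
  rw [hball 0 hR0, ← mul_assoc]
  refine mul_le_mul_of_nonneg_right ?_ measureReal_nonneg
  have h4 : (1 + r / R) ^ d * R ^ d = (R + r) ^ d := by
    rw [← mul_pow]; congr 1; field_simp
  have h5 : 0 ≤ R ^ d := by positivity
  nlinarith

variable {Λ H V : Type*} [AddCommGroup Λ] [NormedAddCommGroup H] [InnerProductSpace ℂ H]
  [NormedAddCommGroup V]

open Classical in
/-- The indicator function of `{χ | P χ ∈ B(z, R)}`. -/
def cutoff (P : Λ →+ V) (z : V) (R : ℝ) (χ : Λ) : ℂ := if P χ ∈ Metric.ball z R then 1 else 0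

theorem norm_cutoff_le (P : Λ →+ V) (z : V) (R : ℝ) (χ : Λ) : ‖cutoff P z R χ‖ ≤ 1 := by
  unfold cutoff; split_ifs <;> simp

/-- Viewed as a function of the centre z, the cutoff at χ is the indicator of a ball around P χ.
Integration over z therefore gives the same volume for every χ. -/
theorem norm_cutoff_sq (P : Λ →+ V) (z : V) (R : ℝ) (χ : Λ) :
    ‖cutoff P z R χ‖ ^ 2 = (Metric.ball (P χ) R).indicator (fun _ => (1 : ℝ)) z := by
  classical
  unfold cutoff
  rw [Set.indicator_apply, Metric.mem_ball_comm]
  split_ifs <;> simp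

theorem norm_cutoff_sub_sq (P : Λ →+ V) (z : V) (R : ℝ) (χ χ' : Λ) :
    ‖cutoff P z R χ - cutoff P z R χ'‖ ^ 2 =
      (symmDiff (Metric.ball (P χ) R) (Metric.ball (P χ') R)).indicator (fun _ => (1 : ℝ)) z := by
  classical
  unfold cutoff
  rw [Set.indicator_apply, Set.mem_symmDiff, Metric.mem_ball_comm (x := z),
    Metric.mem_ball_comm (x := z)]
  by_cases h : P χ ∈ Metric.ball z R <;> by_cases h' : P χ' ∈ Metric.ball z R <;> simp only [h, h'] <;> simp

/-- The commutator with a cutoff is a shift whose weight lives only where χ and χ + b lie on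
different sides of the boundary of the ball. By almost invariance this is negligible on average over
z. -/
theorem cutoff_commutator (e : HilbertBasis Λ ℂ H) (P : Λ →+ V) (z : V) (R : ℝ) (b : Λ) {k : Λ → ℂ}
    (hk : ∃ C, ∀ χ, ‖k χ‖ ≤ C) :
    weightedShift e 0 (cutoff P z R) * weightedShift e b k =
      weightedShift e b k * weightedShift e 0 (cutoff P z R) +
      weightedShift e b fun χ => k χ * (cutoff P z R (χ + b) - cutoff P z R χ) := by
  have hc : ∃ C, ∀ χ, ‖cutoff P z R χ‖ ≤ C := ⟨1, norm_cutoff_le P z R⟩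
  obtain ⟨C, hC⟩ := id hk
  rw [weightedShift_mul e _ _ hc hk, weightedShift_mul e _ _ hk hc, add_zero, zero_add,
    weightedShift_add e b]
  · congr 1
    ext χ
    rw [add_zero]; ring
  · refine ⟨C * 1, fun χ => ?_⟩
    rw [norm_mul]
    exact mul_le_mul (hC _) (norm_cutoff_le _ _ _ _) (norm_nonneg _) ((norm_nonneg _).trans (hC χ))
  · refine ⟨C * (1 + 1), fun χ => ?_⟩
    rw [norm_mul]
    exact mul_le_mul (hC _) ((norm_sub_le _ _).trans (add_le_add (norm_cutoff_le _ _ _ _)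
      (norm_cutoff_le _ _ _ _))) (norm_nonneg _) ((norm_nonneg _).trans (hC χ))

/-- Integration over the centre z of the pointwise estimate in `exists_localization`. -/
theorem sum_measureReal_le {α κ ι : Type*} [Fintype ι] [MeasurableSpace α] (μ : Measure α)
    (s' s : Finset κ) (u' u w : κ → ℝ) (B : κ → Set α) (D : ι → κ → Set α)
    (hB : ∀ χ, MeasurableSet (B χ)) (hD : ∀ i χ, MeasurableSet (D i χ)) (hBt : ∀ χ, μ (B χ) ≠ ⊤)
    (hDt : ∀ i χ, μ (D i χ) ≠ ⊤) (a c : ℝ)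
    (h : ∀ z, ∑ χ ∈ s', u' χ * (B χ).indicator (fun _ => (1 : ℝ)) z ≤
      a * ∑ χ ∈ s, u χ * (B χ).indicator (fun _ => (1 : ℝ)) z +
        c * ∑ i, ∑ χ ∈ s, w χ * (D i χ).indicator (fun _ => (1 : ℝ)) z) :
    ∑ χ ∈ s', u' χ * μ.real (B χ) ≤
      a * ∑ χ ∈ s, u χ * μ.real (B χ) + c * ∑ i, ∑ χ ∈ s, w χ * μ.real (D i χ) := by
  have h1 : ∀ (A : Set α) (r : ℝ), MeasurableSet A → μ A ≠ ⊤ →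
      Integrable (fun z => r * A.indicator (fun _ => (1 : ℝ)) z) μ := fun A r hA hAt =>
    ((integrable_indicator_iff hA).mpr (integrableOn_const hAt)).const_mul r
  have h2 : ∀ (A : Set α) (r : ℝ), MeasurableSet A → 
      ∫ z, r * A.indicator (fun _ => (1 : ℝ)) z ∂μ = r * μ.real A := by
    intro A r hA
    rw [integral_const_mul, integral_indicator hA, setIntegral_const, smul_eq_mul, mul_one]
  have i1 := fun (t : Finset κ) (r : κ → ℝ) =>
    integrable_finsetSum t fun χ _ => h1 (B χ) (r χ) (hB χ) (hBt χ)
  have i2 := integrable_finsetSum (Finset.univ : Finset ι) fun i _ => integrable_finsetSum s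
    fun χ _ => h1 (D i χ) (w χ) (hD i χ) (hDt i χ)
  have h3 := integral_mono (i1 s' u') (((i1 s u).const_mul a).add (i2.const_mul c)) h
  have e1 : ∀ (t : Finset κ) (r : κ → ℝ), ∫ z, ∑ χ ∈ t, r χ * (B χ).indicator (fun _ => (1 : ℝ)) z ∂μ
      = ∑ χ ∈ t, r χ * μ.real (B χ) := fun t r => by
    rw [integral_finsetSum _ fun χ _ => h1 (B χ) (r χ) (hB χ) (hBt χ)]
    exact Finset.sum_congr rfl fun χ _ => h2 _ _ (hB χ)
  have e2 : ∫ z, ∑ i, ∑ χ ∈ s, w χ * (D i χ).indicator (fun _ => (1 : ℝ)) z ∂μ =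
      ∑ i, ∑ χ ∈ s, w χ * μ.real (D i χ) := by
    rw [integral_finsetSum _ fun i _ => integrable_finsetSum s
      fun χ _ => h1 (D i χ) (w χ) (hD i χ) (hDt i χ)]
    refine Finset.sum_congr rfl fun i _ => ?_
    rw [integral_finsetSum _ fun χ _ => h1 (D i χ) (w χ) (hD i χ) (hDt i χ)]
    exact Finset.sum_congr rfl fun χ _ => h2 _ _ (hD i χ)
  rw [e1] at h3
  refine h3.trans_eq ?_
  rw [← e1, ← e2, ← integral_const_mul, ← integral_const_mul]
  exact integral_add ((i1 s u).const_mul a) (i2.const_mul c)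

/-- An operator of finite range (with uniformly bounded coefficients) is controlled by its action
on vectors that are localized in balls of a large radius. -/
theorem exists_localization [NormedSpace ℝ V] [FiniteDimensional ℝ V] (e : HilbertBasis Λ ℂ H) (P : Λ →+ V)
    {ι : Type*} [Fintype ι] (b : ι → Λ) (C : ℝ) {ε : ℝ} (hε : 0 < ε) :
    ∃ R > 0, ∀ k : ι → Λ → ℂ, (∀ i χ, ‖k i χ‖ ≤ C) → ∀ N > 0,
      (∀ (z : V) (φ : H), ‖(∑ i, weightedShift e (b i) (k i)) (weightedShift e 0 (cutoff P z R) φ)‖ ≤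
        N * ‖weightedShift e 0 (cutoff P z R) φ‖) →
      ‖∑ i, weightedShift e (b i) (k i)‖ ≤ N + ε := by
  borelize V
  let μ : Measure V := Measure.addHaar
  set n : ℝ := (Fintype.card ι : ℝ) with hn_def
  have hn : 0 ≤ n := by positivity
  -- The proportion is chosen so that the n commutator terms, after Cauchy–Schwarz, contribute at
  -- most ε²‖φ‖² (see `hq`). The summand 1 keeps the denominator positive.
  obtain ⟨R, hR, hsymm⟩ := exists_ball_symmDiff_le μ (∑ i, ‖P (b i)‖)
    (by positivity) (show 0 < ε ^ 2 / (n * n * C ^ 2 + 1) by positivity)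
  refine ⟨R, hR, fun k hk N hN hloc => ?_⟩
  set v := μ.real (Metric.ball (0 : V) R) with hv
  have hv0 : 0 < v := by
    rw [hv, measureReal_def]
    exact ENNReal.toReal_pos (Metric.measure_ball_pos μ 0 hR).ne' measure_ball_lt_top.ne
  have hvx : ∀ x : V, μ.real (Metric.ball x R) = v := fun x => by
    rw [hv, measureReal_def, measureReal_def, Measure.addHaar_ball_center μ x]
  set A := ∑ i, weightedShift e (b i) (k i) with hA
  have hcut : ∀ z, ∃ C, ∀ χ, ‖cutoff P z R χ‖ ≤ C := fun z => ⟨1, norm_cutoff_le P z R⟩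
  refine opNorm_le_of_span e A (by positivity) fun s c => ?_
  set φ := ∑ χ ∈ s, c χ • e χ with hφ
  -- With φ and A φ both finite combinations of basis vectors, all norms below are finite sums of
  -- squares.
  have hAmem : A φ ∈ Submodule.span ℂ (Set.range e) := by
    rw [hA, sum_apply]
    refine Submodule.sum_mem _ fun i _ => ?_
    rw [hφ, weightedShift_apply_sum e _ ⟨C, hk i⟩]
    exact Submodule.sum_mem _ fun χ _ => Submodule.smul_mem _ _ (Submodule.subset_span ⟨_, rfl⟩)
  obtain ⟨s', c', hc'⟩ := exists_eq_sum_of_mem_span e hAmem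
  have hnorm : ∀ (s : Finset Λ) (c : Λ → ℂ), ‖∑ χ ∈ s, c χ • e χ‖ ^ 2 = ∑ χ ∈ s, ‖c χ‖ ^ 2 := by
    intro s c
    simpa using norm_sq_sum_basis e 0 s c
  have hcutnorm : ∀ (z : V) (s : Finset Λ) (c : Λ → ℂ),
      ‖weightedShift e 0 (cutoff P z R) (∑ χ ∈ s, c χ • e χ)‖ ^ 2 =
        ∑ χ ∈ s, ‖c χ‖ ^ 2 * (Metric.ball (P χ) R).indicator (fun _ => (1 : ℝ)) z := by
    intro z s c
    rw [weightedShift_apply_sum e 0 (hcut z), norm_sq_sum_basis]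
    refine Finset.sum_congr rfl fun χ _ => ?_
    rw [norm_mul, mul_pow, norm_cutoff_sq]
  let Dop : ι → V → H →L[ℂ] H := fun i z =>
    weightedShift e (b i) fun χ => k i χ * (cutoff P z R (χ + b i) - cutoff P z R χ)
  have hDnorm : ∀ i z, ‖Dop i z φ‖ ^ 2 ≤ ∑ χ ∈ s, C ^ 2 * ‖c χ‖ ^ 2 *
      (symmDiff (Metric.ball (P (χ + b i)) R) (Metric.ball (P χ) R)).indicator
        (fun _ => (1 : ℝ)) z := by
    intro i z
    have hb : ∃ C, ∀ χ, ‖k i χ * (cutoff P z R (χ + b i) - cutoff P z R χ)‖ ≤ C := by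
      refine ⟨C * (1 + 1), fun χ => ?_⟩
      rw [norm_mul]
      exact mul_le_mul (hk _ _) ((norm_sub_le _ _).trans (add_le_add (norm_cutoff_le _ _ _ _)
        (norm_cutoff_le _ _ _ _))) (norm_nonneg _) ((norm_nonneg _).trans (hk i χ))
    change ‖weightedShift e (b i) _ φ‖ ^ 2 ≤ _
    rw [hφ, weightedShift_apply_sum e _ hb, norm_sq_sum_basis]
    refine Finset.sum_le_sum fun χ _ => ?_
    rw [norm_mul, norm_mul, mul_pow, mul_pow, norm_cutoff_sub_sq, ← mul_assoc, mul_comm (C ^ 2)]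
    refine mul_le_mul_of_nonneg_right ?_ (Set.indicator_nonneg (fun _ _ => zero_le_one) _)
    gcongr
    exact hk i χ
  have hop : ∀ z, weightedShift e 0 (cutoff P z R) (A φ) =
      A (weightedShift e 0 (cutoff P z R) φ) + ∑ i, Dop i z φ := by
    intro z
    have : weightedShift e 0 (cutoff P z R) * A =
        A * weightedShift e 0 (cutoff P z R) + ∑ i, Dop i z := by
      rw [hA, Finset.mul_sum, Finset.sum_mul, ← Finset.sum_add_distrib]
      exact Finset.sum_congr rfl fun i _ => cutoff_commutator e P z R (b i) ⟨C, hk i⟩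
    have h2 := congrArg (fun T : H →L[ℂ] H => T φ) this
    simpa [sum_apply] using h2
  have hpt : ∀ z, ‖weightedShift e 0 (cutoff P z R) (A φ)‖ ^ 2 ≤
      (1 + ε / N) * N ^ 2 * ‖weightedShift e 0 (cutoff P z R) φ‖ ^ 2 +
        (1 + N / ε) * n * ∑ i, ‖Dop i z φ‖ ^ 2 := by
    intro z
    set a := N * ‖weightedShift e 0 (cutoff P z R) φ‖ with ha
    set d := ∑ i, ‖Dop i z φ‖ with hd
    have h1 : ‖weightedShift e 0 (cutoff P z R) (A φ)‖ ≤ a + d := by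
      rw [hop z]
      exact (norm_add_le _ _).trans (add_le_add (hloc z φ) (norm_sum_le _ _))
    have h2 : d ^ 2 ≤ n * ∑ i, ‖Dop i z φ‖ ^ 2 := by
      have := sq_sum_le_card_mul_sum_sq (s := (Finset.univ : Finset ι)) (f := fun i => ‖Dop i z φ‖)
      simpa [hd, n] using this
    have h3 : ‖weightedShift e 0 (cutoff P z R) (A φ)‖ ^ 2 ≤ (a + d) ^ 2 := by gcongr
    -- Young's inequality with weights such that (1 + ε/N) N² + (1 + N/ε) ε² = (N + ε)².
    have h4 : (a + d) ^ 2 ≤ (1 + ε / N) * a ^ 2 + (1 + N / ε) * d ^ 2 := by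
      have h5 : (1 + ε / N) * a ^ 2 + (1 + N / ε) * d ^ 2 - (a + d) ^ 2 =
          (ε * a - N * d) ^ 2 / (N * ε) := by field_simp; ring
      have h6 : 0 ≤ (ε * a - N * d) ^ 2 / (N * ε) := by positivity
      linarith
    have h7 : (1 + N / ε) * d ^ 2 ≤ (1 + N / ε) * (n * ∑ i, ‖Dop i z φ‖ ^ 2) := by gcongr
    have h8 : a ^ 2 = N ^ 2 * ‖weightedShift e 0 (cutoff P z R) φ‖ ^ 2 := by rw [ha]; ring
    rw [h8] at h4
    linarith
  have hbt : ∀ x : V, μ (Metric.ball x R) ≠ ⊤ := fun x => measure_ball_lt_top.ne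
  have hst : ∀ x y : V, μ (symmDiff (Metric.ball x R) (Metric.ball y R)) ≠ ⊤ := fun x y =>
    ((measure_mono Set.symmDiff_subset_union).trans_lt (measure_union_lt_top
      measure_ball_lt_top measure_ball_lt_top)).ne
  -- Averaging over z: every ball contributes the volume v, so ‖A φ‖² v and ‖φ‖² v appear, while the
  -- commutators contribute volumes of symmetric differences.
  have hmain := sum_measureReal_le μ s' s (fun χ => ‖c' χ‖ ^ 2) (fun χ => ‖c χ‖ ^ 2)
    (fun χ => C ^ 2 * ‖c χ‖ ^ 2) (fun χ => Metric.ball (P χ) R)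
    (fun i χ => symmDiff (Metric.ball (P (χ + b i)) R) (Metric.ball (P χ) R))
    (fun χ => measurableSet_ball) (fun i χ => measurableSet_ball.symmDiff measurableSet_ball)
    (fun χ => hbt _) (fun i χ => hst _ _) ((1 + ε / N) * N ^ 2) ((1 + N / ε) * n) (fun z => by
      have h := hpt z
      rw [hc', hcutnorm, hφ, hcutnorm] at h
      refine h.trans ?_
      have h2 : ∑ i, ‖Dop i z φ‖ ^ 2 ≤ _ := Finset.sum_le_sum fun i _ => hDnorm i z
      have h3 : 0 ≤ (1 + N / ε) * n := by positivity
      exact add_le_add le_rfl (mul_le_mul_of_nonneg_left h2 h3))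
  simp only [hvx] at hmain
  rw [← Finset.sum_mul, ← Finset.sum_mul] at hmain
  have hdiff : ∀ i, ∑ χ ∈ s, C ^ 2 * ‖c χ‖ ^ 2 *
      μ.real (symmDiff (Metric.ball (P (χ + b i)) R) (Metric.ball (P χ) R)) ≤
        C ^ 2 * (∑ χ ∈ s, ‖c χ‖ ^ 2) * (ε ^ 2 / (n * n * C ^ 2 + 1) * v) := by
    intro i
    rw [Finset.mul_sum, Finset.sum_mul]
    refine Finset.sum_le_sum fun χ _ => mul_le_mul_of_nonneg_left (hsymm _ _ ?_) (by positivity)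
    rw [map_add, add_sub_cancel_left]
    exact Finset.single_le_sum (f := fun i => ‖P (b i)‖) (fun _ _ => norm_nonneg _) (Finset.mem_univ i)
  have hsum := Finset.sum_le_sum fun i (_ : i ∈ Finset.univ) => hdiff i
  rw [Finset.sum_const, nsmul_eq_mul, Finset.card_univ] at hsum
  rw [← hnorm, ← hnorm, ← hφ, ← hc'] at hmain
  rw [← hnorm, ← hφ] at hsum
  have hq : n * (C ^ 2 * ‖φ‖ ^ 2 * (ε ^ 2 / (n * n * C ^ 2 + 1) * v)) * n ≤ ε ^ 2 * ‖φ‖ ^ 2 * v := by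
    have h1 : n * (C ^ 2 * ‖φ‖ ^ 2 * (ε ^ 2 / (n * n * C ^ 2 + 1) * v)) * n =
        (n * n * C ^ 2 / (n * n * C ^ 2 + 1)) * (ε ^ 2 * ‖φ‖ ^ 2 * v) := by field_simp
    rw [h1]
    refine mul_le_of_le_one_left (by positivity) ?_
    rw [div_le_one (by positivity)]; linarith
  have hfin : ‖A φ‖ ^ 2 * v ≤ ((N + ε) * ‖φ‖) ^ 2 * v := by
    refine hmain.trans ?_
    have h3 : 0 ≤ (1 + N / ε) * n := by positivity
    have h4 := mul_le_mul_of_nonneg_left hsum h3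
    have h5 : 0 ≤ (1 + N / ε) := by positivity
    have h6 := mul_le_mul_of_nonneg_left hq h5
    have h7 : ((N + ε) * ‖φ‖) ^ 2 * v =
        (1 + ε / N) * N ^ 2 * (‖φ‖ ^ 2 * v) + (1 + N / ε) * (ε ^ 2 * ‖φ‖ ^ 2 * v) := by
      field_simp; ring
    rw [h7]
    have h8 : (1 + N / ε) * n * (n * (C ^ 2 * ‖φ‖ ^ 2 * (ε ^ 2 / (n * n * C ^ 2 + 1) * v))) =
      (1 + N / ε) * (n * (C ^ 2 * ‖φ‖ ^ 2 * (ε ^ 2 / (n * n * C ^ 2 + 1) * v)) * n) := by ring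
    linarith
  have h9 := le_of_mul_le_mul_right hfin hv0
  exact (pow_le_pow_iff_left₀ (norm_nonneg _) (by positivity) two_ne_zero).mp h9

end Localization

/-! ### The family of translated operators and its supremum norm -/

section Fibres

variable {Λ H V : Type*} [AddCommGroup Λ] [NormedAddCommGroup H] [InnerProductSpace ℂ H]
  [NormedAddCommGroup V] [NormedSpace ℝ V]

/-- The operator `∑ᵢ e_{bᵢ} ⊗ hᵢ(y + ·)`, quantized at `ℏ`. -/
def fibreOp (e : HilbertBasis Λ ℂ H) (P : Λ →+ V) {ι : Type*} [Fintype ι] (b : ι → Λ)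
    (h : ι → V → ℂ) (ℏ : ℝ) (y : V) : H →L[ℂ] H :=
  ∑ i, weightedShift e (b i) fun χ => h i (y + (Real.pi * ℏ) • P (χ + (χ + b i)))

variable (e : HilbertBasis Λ ℂ H) (P : Λ →+ V) {ι : Type*} [Fintype ι] (b : ι → Λ) {h : ι → V → ℂ}
  {C L : ℝ}

theorem norm_fibreOp_le (hC : ∀ i p, ‖h i p‖ ≤ C) (ℏ : ℝ) (y : V) :
    ‖fibreOp e P b h ℏ y‖ ≤ Fintype.card ι * C := by
  refine (norm_sum_le _ _).trans ((Finset.sum_le_sum fun i _ =>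
    norm_weightedShift_le e (b i) fun χ => hC i _).trans_eq ?_)
  simp

theorem norm_fibreOp_sub_le (hC : ∀ i p, ‖h i p‖ ≤ C) (hL : ∀ i p p', ‖h i p - h i p'‖ ≤ L * ‖p - p'‖)
    (ℏ : ℝ) (y y' : V) :
    ‖fibreOp e P b h ℏ y - fibreOp e P b h ℏ y'‖ ≤ Fintype.card ι * (L * ‖y - y'‖) := by
  rw [fibreOp, fibreOp, ← Finset.sum_sub_distrib]
  refine (norm_sum_le _ _).trans ((Finset.sum_le_sum (g := fun _ => L * ‖y - y'‖) fun i _ => ?_).trans_eq ?_)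
  · rw [weightedShift_sub e _ ⟨C, fun χ => hC i _⟩ ⟨C, fun χ => hC i _⟩]
    refine norm_weightedShift_le e _ fun χ => (hL i _ _).trans_eq ?_
    rw [add_sub_add_right_eq_sub]
  · simp

/-- Shifting the basis by η replaces χ + (χ + b) by itself plus 2η in the argument of each weight.
-/
theorem fibreOp_translate (hC : ∀ i p, ‖h i p‖ ≤ C) (ℏ : ℝ) (y : V) (η : Λ) :
    fibreOp e P b h ℏ (y + (2 * Real.pi * ℏ) • P η) =
      weightedShift e (-η) (fun _ => 1) * fibreOp e P b h ℏ y * weightedShift e η (fun _ => 1) := by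
  have h1 : ∃ C, ∀ χ : Λ, ‖(1 : ℂ)‖ ≤ C := ⟨1, by simp⟩
  rw [fibreOp, fibreOp, Finset.mul_sum, Finset.sum_mul]
  refine Finset.sum_congr rfl fun i _ => ?_
  rw [weightedShift_mul e _ _ h1 ⟨C, fun χ => hC i _⟩, weightedShift_mul e _ _
    ⟨C, fun χ => by rw [one_mul]; exact hC i _⟩ h1]
  congr 1
  · abel
  · ext χ
    simp only [one_mul, mul_one, map_add]
    congr 1
    module

/-- By `fibreOp_translate` the norms at the points 2πℏ P η do not exceed the norm at 0. These points
are dense because ℏ ≠ 0, and the norm is Lipschitz in y. -/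
theorem norm_fibreOp_le_of_denseRange (hP : DenseRange P) (hC : ∀ i p, ‖h i p‖ ≤ C)
    (hL : ∀ i p p', ‖h i p - h i p'‖ ≤ L * ‖p - p'‖) {ℏ : ℝ} (hℏ : ℏ ≠ 0) (y : V) :
    ‖fibreOp e P b h ℏ y‖ ≤ ‖fibreOp e P b h ℏ 0‖ := by
  have hcont : Continuous fun y => ‖fibreOp e P b h ℏ y‖ := by
    refine continuous_norm.comp (LipschitzWith.of_dist_le_mul
      (K := (Fintype.card ι * L).toNNReal) fun y y' => ?_).continuous
    rw [dist_eq_norm, dist_eq_norm]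
    refine (norm_fibreOp_sub_le e P b hC hL ℏ y y').trans ?_
    rw [← mul_assoc]
    gcongr
    exact Real.le_coe_toNNReal _
  have hd : DenseRange fun η => (2 * Real.pi * ℏ) • P η :=
    (Homeomorph.smulOfNeZero (α := V) (2 * Real.pi * ℏ)
      (by have := Real.pi_pos; positivity)).surjective.denseRange.comp hP
      (Homeomorph.smulOfNeZero _ _).continuous
  refine hd.induction_on (p := fun y => ‖fibreOp e P b h ℏ y‖ ≤ ‖fibreOp e P b h ℏ 0‖) y
    (isClosed_le hcont continuous_const) fun η => ?_
  have h1 : ∀ η : Λ, ‖weightedShift e η (fun _ => (1 : ℂ))‖ ≤ 1 := fun η =>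
    norm_weightedShift_le e η (by simp)
  have h2 := fibreOp_translate e P b hC ℏ 0 η
  rw [zero_add] at h2
  rw [h2]
  refine (norm_mul_le _ _).trans ((mul_le_mul (norm_mul_le _ _) (h1 η) (norm_nonneg _)
    (by positivity)).trans ?_)
  rw [mul_one]
  exact mul_le_of_le_one_left (norm_nonneg _) (h1 _)

/-- The core of Rieffel's condition. On vectors with P χ within R of z, passing from ℏ to ℏ' changes
the argument by π(ℏ - ℏ')(2 P χ + P b), which is 2π(ℏ - ℏ')z up to |ℏ - ℏ'| π(2R + r). The first
part is a translation of y, harmless since M bounds all translates; the second is small by the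
Lipschitz bound. The radius R depends on ε but not on ℏ, y or z, so δ is uniform. -/
theorem fibreOp_compare [FiniteDimensional ℝ V] (hL0 : 0 ≤ L) (hC : ∀ i p, ‖h i p‖ ≤ C)
    (hL : ∀ i p p', ‖h i p - h i p'‖ ≤ L * ‖p - p'‖) {ε : ℝ} (hε : 0 < ε) :
    ∃ δ > 0, ∀ ℏ ℏ' : ℝ, |ℏ - ℏ'| < δ → ∀ M, 0 ≤ M → (∀ y, ‖fibreOp e P b h ℏ' y‖ ≤ M) →
      ∀ y, ‖fibreOp e P b h ℏ y‖ ≤ M + ε := by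
  obtain ⟨R, hR, hloc⟩ := exists_localization e P b C (half_pos hε)
  set n : ℝ := (Fintype.card ι : ℝ) with hn
  set r := ∑ i, ‖P (b i)‖ with hr
  have hr0 : 0 ≤ r := Finset.sum_nonneg fun _ _ => norm_nonneg _
  have hpi := Real.pi_pos
  set K := n * (L * (Real.pi * (2 * R + r))) with hK
  have hK0 : 0 ≤ K := by positivity
  refine ⟨ε / 2 / (K + 1), by positivity, fun ℏ ℏ' hℏ M hM hM' y => ?_⟩
  have := hloc (fun i χ => h i (y + (Real.pi * ℏ) • P (χ + (χ + b i)))) (fun i χ => hC i _)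
    (M + ε / 2) (by positivity) fun z φ => ?_
  · refine this.trans (by linarith)
  change ‖fibreOp e P b h ℏ y _‖ ≤ _
  set ψ := weightedShift e 0 (cutoff P z R) φ with hψ
  have hcut : ∃ C, ∀ χ, ‖cutoff P z R χ‖ ≤ C := ⟨1, norm_cutoff_le P z R⟩
  -- The cutoff is idempotent, so it may be inserted in front of ψ. The difference of the two
  -- operators then only has to be estimated on the ball.
  have hid : weightedShift e 0 (cutoff P z R) ψ = ψ := by
    rw [hψ, ← mul_apply_eq_comp, weightedShift_mul e 0 0 hcut hcut, zero_add]
    congr 2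
    ext χ
    rw [add_zero, cutoff]
    split_ifs <;> simp
  set y' := y + (2 * Real.pi * (ℏ - ℏ')) • z with hy'
  have hdiff : ‖(fibreOp e P b h ℏ y - fibreOp e P b h ℏ' y') * weightedShift e 0 (cutoff P z R)‖ ≤
      ε / 2 := by
    rw [fibreOp, fibreOp, ← Finset.sum_sub_distrib, Finset.sum_mul]
    refine (norm_sum_le _ _).trans ((Finset.sum_le_sum
      (g := fun _ => L * (|ℏ - ℏ'| * (Real.pi * (2 * R + r)))) fun i _ => ?_).trans ?_)
    · rw [weightedShift_sub e _ ⟨C, fun χ => hC i _⟩ ⟨C, fun χ => hC i _⟩, weightedShift_mul e _ _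
        ⟨C + C, fun χ => (norm_sub_le _ _).trans (add_le_add (hC i _) (hC i _))⟩ hcut]
      refine norm_weightedShift_le e _ fun χ => ?_
      rw [add_zero, norm_mul]
      by_cases hχ : P χ ∈ Metric.ball z R
      · refine (mul_le_of_le_one_right (norm_nonneg _) (norm_cutoff_le _ _ _ _)).trans
          ((hL i _ _).trans (mul_le_mul_of_nonneg_left ?_ hL0))
        have h1 : y + (Real.pi * ℏ) • P (χ + (χ + b i)) - (y' + (Real.pi * ℏ') • P (χ + (χ + b i))) =
            (ℏ - ℏ') • Real.pi • ((2 : ℝ) • (P χ - z) + P (b i)) := by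
          rw [hy']; simp only [map_add]; module
        rw [h1, norm_smul, norm_smul, Real.norm_eq_abs, Real.norm_of_nonneg hpi.le]
        gcongr
        refine (norm_add_le _ _).trans (add_le_add ?_
          (Finset.single_le_sum (f := fun i => ‖P (b i)‖) (fun _ _ => norm_nonneg _)
            (Finset.mem_univ i)))
        rw [norm_smul, Real.norm_of_nonneg zero_le_two]
        gcongr
        exact (mem_ball_iff_norm.mp hχ).le
      · rw [cutoff, if_neg hχ, norm_zero, mul_zero]
        positivity
    · rw [Finset.sum_const, nsmul_eq_mul, Finset.card_univ, ← hn]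
      have h1 : n * (L * (|ℏ - ℏ'| * (Real.pi * (2 * R + r)))) = |ℏ - ℏ'| * K := by rw [hK]; ring
      rw [h1]
      have h2 : |ℏ - ℏ'| * (K + 1) ≤ ε / 2 := (le_div_iff₀ (by positivity)).mp hℏ.le
      nlinarith [abs_nonneg (ℏ - ℏ')]
  have h1 : fibreOp e P b h ℏ y ψ = fibreOp e P b h ℏ' y' ψ +
      ((fibreOp e P b h ℏ y - fibreOp e P b h ℏ' y') * weightedShift e 0 (cutoff P z R)) ψ := by
    rw [mul_apply_eq_comp, hid, sub_apply]; abel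
  rw [h1, add_mul]
  refine (norm_add_le _ _).trans (add_le_add ?_ ?_)
  · exact (ContinuousLinearMap.le_opNorm _ _).trans (by gcongr; exact hM' _)
  · exact (ContinuousLinearMap.le_opNorm _ _).trans (by gcongr)

/-- The supremum of the norms of the operators in a fibre. -/
def fibreNorm (e : HilbertBasis Λ ℂ H) (P : Λ →+ V) {ι : Type*} [Fintype ι] (b : ι → Λ)
    (h : ι → V → ℂ) (ℏ : ℝ) : ℝ := ⨆ y, ‖fibreOp e P b h ℏ y‖

theorem norm_fibreOp_le_fibreNorm (hC : ∀ i p, ‖h i p‖ ≤ C) (ℏ : ℝ) (y : V) :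
    ‖fibreOp e P b h ℏ y‖ ≤ fibreNorm e P b h ℏ :=
  le_ciSup (f := fun y => ‖fibreOp e P b h ℏ y‖)
    ⟨_, by rintro _ ⟨y, rfl⟩; exact norm_fibreOp_le e P b hC ℏ y⟩ y

theorem continuous_fibreNorm [FiniteDimensional ℝ V] (hL0 : 0 ≤ L) (hC : ∀ i p, ‖h i p‖ ≤ C)
    (hL : ∀ i p p', ‖h i p - h i p'‖ ≤ L * ‖p - p'‖) : Continuous (fibreNorm e P b h) := by
  rw [Metric.continuous_iff]
  intro ℏ ε hε
  obtain ⟨δ, hδ, H⟩ := fibreOp_compare e P b hL0 hC hL (half_pos hε)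
  have key : ∀ ℏ ℏ' : ℝ, |ℏ - ℏ'| < δ → fibreNorm e P b h ℏ ≤ fibreNorm e P b h ℏ' + ε / 2 :=
    fun ℏ ℏ' hd => ciSup_le (H ℏ ℏ' hd _ (Real.iSup_nonneg fun _ => norm_nonneg _)
      (norm_fibreOp_le_fibreNorm e P b hC ℏ'))
  refine ⟨δ, hδ, fun ℏ' hd => ?_⟩
  rw [Real.dist_eq] at hd ⊢
  have h1 := key ℏ' ℏ hd
  have h2 := key ℏ ℏ' (by rwa [abs_sub_comm])
  rw [abs_lt]
  constructor <;> linarith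

theorem fibreNorm_eq_of_denseRange (hP : DenseRange P) (hC : ∀ i p, ‖h i p‖ ≤ C)
    (hL : ∀ i p p', ‖h i p - h i p'‖ ≤ L * ‖p - p'‖) {ℏ : ℝ} (hℏ : ℏ ≠ 0) :
    fibreNorm e P b h ℏ = ‖fibreOp e P b h ℏ 0‖ :=
  le_antisymm (ciSup_le (norm_fibreOp_le_of_denseRange e P b hP hC hL hℏ))
    (norm_fibreOp_le_fibreNorm e P b hC ℏ 0)

end Fibres

/-! ### Superpositions of exponentials with bounded frequencies -/

section BandLimited

variable {E F : Type} [NormedAddCommGroup E] [InnerProductSpace ℝ E]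
  [NormedAddCommGroup F] [InnerProductSpace ℝ F]

/-- `h` is a superposition of exponentials with bounded frequencies. -/
def BandLimited [MeasurableSpace E] (h : E → ℂ) : Prop :=
  ∃ (X : Type) (_ : MeasurableSpace X) (ν : Measure X) (_ : SFinite ν) (d : X → ℂ) (s : X → E)
    (R : ℝ), Integrable d ν ∧ Measurable s ∧ (∀ x, ‖s x‖ ≤ R) ∧
    ∀ w, h w = ∫ x, d x * Complex.exp (Complex.I * (inner ℝ (s x) w : ℝ)) ∂ν

variable [MeasurableSpace E] [BorelSpace E] [FiniteDimensional ℝ E]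
  [MeasurableSpace F] [BorelSpace F] [FiniteDimensional ℝ F]

theorem integrable_mul_exp {X : Type*} [MeasurableSpace X] {ν : Measure X} {d : X → ℂ} {t : X → ℝ}
    (hd : Integrable d ν) (ht : Measurable t) :
    Integrable (fun x => d x * Complex.exp (Complex.I * (t x : ℂ))) ν :=
  hd.mul_bdd (c := 1) (by fun_prop) (Eventually.of_forall fun x => (Complex.norm_exp_I_mul_ofReal _).le)

theorem BandLimited.mul {h h' : E → ℂ} (H : BandLimited h) (H' : BandLimited h') :
    BandLimited fun p => h p * h' p := by
  obtain ⟨X, _, ν, _, d, s, R, hd, hs, hR, hh⟩ := H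
  obtain ⟨X', _, ν', _, d', s', R', hd', hs', hR', hh'⟩ := H'
  refine ⟨X × X', inferInstance, ν.prod ν', inferInstance, fun x => d x.1 * d' x.2,
    fun x => s x.1 + s' x.2, R + R', hd.mul_prod hd', by fun_prop,
    fun x => (norm_add_le _ _).trans (add_le_add (hR _) (hR' _)), fun w => ?_⟩
  simp only [hh, hh']
  rw [← integral_prod_mul]
  refine integral_congr_ae (Eventually.of_forall fun x => ?_)
  simp only [inner_add_left, Complex.ofReal_add, mul_add, Complex.exp_add]
  ring

theorem BandLimited.comp_linear {h : F → ℂ} (H : BandLimited h) (A : E →L[ℝ] F) :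
    BandLimited fun p => h (A p) := by
  obtain ⟨X, _, ν, _, d, s, R, hd, hs, hR, hh⟩ := H
  refine ⟨X, inferInstance, ν, inferInstance, d, fun x => A.adjoint (s x), ‖A.adjoint‖ * R, hd,
    A.adjoint.continuous.measurable.comp hs, fun x => (A.adjoint.le_opNorm _).trans (by
      gcongr; exact hR x), fun w => ?_⟩
  simp only [hh, ContinuousLinearMap.adjoint_inner_left]

omit [FiniteDimensional ℝ E] in
theorem BandLimited.exp_mul {h : E → ℂ} (H : BandLimited h) (ξ : E) :
    BandLimited fun p => Complex.exp (Complex.I * (inner ℝ ξ p : ℝ)) * h p := by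
  obtain ⟨X, _, ν, _, d, s, R, hd, hs, hR, hh⟩ := H
  refine ⟨X, inferInstance, ν, inferInstance, d, fun x => ξ + s x, ‖ξ‖ + R, hd, by fun_prop,
    fun x => (norm_add_le _ _).trans (add_le_add le_rfl (hR _)), fun w => ?_⟩
  simp only [hh]
  rw [← integral_const_mul]
  refine integral_congr_ae (Eventually.of_forall fun x => ?_)
  simp only [inner_add_left, Complex.ofReal_add, mul_add, Complex.exp_add]
  ring

theorem BandLimited.translate {h : E → ℂ} (H : BandLimited h) (v : E) :
    BandLimited fun p => h (p + v) := by
  obtain ⟨X, _, ν, _, d, s, R, hd, hs, hR, hh⟩ := H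
  refine ⟨X, inferInstance, ν, inferInstance,
    fun x => d x * Complex.exp (Complex.I * (inner ℝ (s x) v : ℝ)), s, R,
    integrable_mul_exp hd (by fun_prop), hs, hR, fun w => ?_⟩
  simp only [hh]
  refine integral_congr_ae (Eventually.of_forall fun x => ?_)
  simp only [inner_add_right, Complex.ofReal_add, mul_add, Complex.exp_add]
  ring

omit [BorelSpace E] [FiniteDimensional ℝ E] in
theorem BandLimited.const_mul {h : E → ℂ} (H : BandLimited h) (c : ℂ) :
    BandLimited fun p => c * h p := by
  obtain ⟨X, _, ν, _, d, s, R, hd, hs, hR, hh⟩ := H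
  refine ⟨X, inferInstance, ν, inferInstance, fun x => c * d x, s, R, hd.const_mul c, hs, hR,
    fun w => ?_⟩
  simp only [hh, mul_assoc, integral_const_mul]

omit [FiniteDimensional ℝ E] in
theorem BandLimited.conj {h : E → ℂ} (H : BandLimited h) :
    BandLimited fun p => (starRingEnd ℂ) (h p) := by
  obtain ⟨X, _, ν, _, d, s, R, hd, hs, hR, hh⟩ := H
  refine ⟨X, inferInstance, ν, inferInstance, fun x => (starRingEnd ℂ) (d x), fun x => -s x, R,
    ?_, hs.neg, by simpa using hR, fun w => ?_⟩
  · exact hd.congr' (by have := hd.aestronglyMeasurable; exact Complex.continuous_conj.comp_aestronglyMeasurable this) (Eventually.of_forall fun x => by simp)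
  · simp only [hh]
    rw [← integral_conj]
    refine integral_congr_ae (Eventually.of_forall fun x => ?_)
    simp only [map_mul, ← Complex.exp_conj, Complex.conj_I, Complex.conj_ofReal, inner_neg_left,
      Complex.ofReal_neg, neg_mul, mul_neg]

/-- Each exponential with frequency s is ‖s‖-Lipschitz; integrate against |d|. -/
theorem BandLimited.exists_lipschitz {h : E → ℂ} (H : BandLimited h) :
    ∃ L, 0 ≤ L ∧ ∀ p p', ‖h p - h p'‖ ≤ L * ‖p - p'‖ := by
  obtain ⟨X, _, ν, _, d, s, R, hd, hs, hR, hh⟩ := H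
  refine ⟨|R| * ∫ x, ‖d x‖ ∂ν, by positivity, fun p p' => ?_⟩
  rw [hh, hh, ← integral_sub (integrable_mul_exp hd (by fun_prop)) (integrable_mul_exp hd (by fun_prop)),
    mul_right_comm, ← integral_const_mul]
  refine norm_integral_le_of_norm_le (hd.norm.const_mul _) (Eventually.of_forall fun x => ?_)
  rw [← mul_sub, norm_mul, mul_comm]
  gcongr
  have h1 : Complex.exp (Complex.I * (inner ℝ (s x) p : ℝ)) - Complex.exp (Complex.I * (inner ℝ (s x) p' : ℝ))
      = Complex.exp (Complex.I * (inner ℝ (s x) p' : ℝ)) *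
        (Complex.exp (Complex.I * (inner ℝ (s x) (p - p') : ℝ)) - 1) := by
    rw [mul_sub, ← Complex.exp_add, inner_sub_right, mul_one, Complex.ofReal_sub]
    congr 2
    ring
  rw [h1, norm_mul, Complex.norm_exp_I_mul_ofReal, one_mul]
  refine Real.norm_exp_I_mul_ofReal_sub_one_le.trans ((norm_inner_le_norm _ _).trans ?_)
  gcongr
  exact (hR x).trans (le_abs_self R)

/-- Fourier inversion, with density `𝓕 g` and frequency 2πv at v. The frequency is set to 0 outside
a ball containing the support, where the density vanishes anyway. -/
theorem bandLimited_of_hasCompactSupport_fourier (g : 𝓢(E, ℂ))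
    (hg : HasCompactSupport (𝓕 (g : E → ℂ))) : BandLimited (g : E → ℂ) := by
  classical
  obtain ⟨R, hR⟩ := hg.isCompact.isBounded.subset_closedBall (0 : E)
  have hcl : MeasurableSet (Metric.closedBall (0 : E) R) := measurableSet_closedBall
  refine ⟨E, inferInstance, volume, inferInstance, (𝓕 g : 𝓢(E, ℂ)),
    fun v => (Metric.closedBall (0 : E) R).indicator (fun v => (2 * Real.pi) • v) v,
    2 * Real.pi * |R|, (𝓕 g : 𝓢(E, ℂ)).integrable, Measurable.indicator (by fun_prop) hcl,
    fun v => ?_, fun w => ?_⟩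
  · dsimp only
    by_cases hv : v ∈ Metric.closedBall (0 : E) R
    · rw [Set.indicator_of_mem hv, norm_smul, Real.norm_of_nonneg (by positivity)]
      gcongr
      exact (mem_closedBall_zero_iff.mp hv).trans (le_abs_self R)
    · rw [Set.indicator_of_notMem hv, norm_zero]
      positivity
  · have h1 : (𝓕⁻ (𝓕 g) : 𝓢(E, ℂ)) w = g w := by rw [FourierTransform.fourierInv_fourier_eq]
    rw [← h1, SchwartzMap.fourierInv_coe, Real.fourierInv_eq']
    refine integral_congr_ae (Eventually.of_forall fun v => ?_)
    by_cases hv : v ∈ Metric.closedBall (0 : E) R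
    · simp only [Set.indicator_of_mem hv, inner_smul_left, smul_eq_mul, conj_trivial]
      rw [mul_comm, mul_comm Complex.I]
    · have : (𝓕 g : 𝓢(E, ℂ)) v = 0 := by
        by_contra hne
        exact hv (hR (subset_tsupport _ hne))
      simp [this]

/-- If φ is a test function supported off the ball of radius R/(2π), then ∫ φ 𝓕g = ∫ g 𝓕φ = ∫ d(x)
φ(s(x)/2π) dν = 0 by Fubini and inversion. So `𝓕 g` vanishes almost everywhere off that ball, and
everywhere there by continuity. Thus the stability of compact Fourier support under products and
linear maps follows from that of `BandLimited`, where it is formal. -/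
theorem BandLimited.hasCompactSupport_fourier {g : 𝓢(E, ℂ)} (H : BandLimited (g : E → ℂ)) :
    HasCompactSupport (𝓕 (g : E → ℂ)) := by
  obtain ⟨X, _, ν, _, d, s, R, hd, hs, hR, hh⟩ := H
  have hpi := Real.pi_pos
  set U : Set E := (Metric.closedBall (0 : E) (R / (2 * Real.pi)))ᶜ with hU
  have hUo : IsOpen U := Metric.isClosed_closedBall.isOpen_compl
  have hcont : Continuous (𝓕 (g : E → ℂ)) := (𝓕 g : 𝓢(E, ℂ)).continuous
  have key : ∀ φ : E → ℝ, ContDiff ℝ ∞ φ → HasCompactSupport φ → tsupport φ ⊆ U →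
      ∫ x, φ x • 𝓕 (g : E → ℂ) x = 0 := by
    intro φ hφ hφc hφU
    have hΦc : HasCompactSupport fun x => (φ x : ℂ) := hφc.comp_left (g := Complex.ofReal) rfl
    have hΦd : ContDiff ℝ ∞ fun x => (φ x : ℂ) := Complex.ofRealCLM.contDiff.comp hφ
    set Φ : 𝓢(E, ℂ) := hΦc.toSchwartzMap hΦd with hΦ
    have hΦapp : ∀ x, Φ x = (φ x : ℂ) := fun x => rfl
    have h1 : ∫ x, φ x • 𝓕 (g : E → ℂ) x = ∫ x, g x * 𝓕 Φ x := by
      rw [← SchwartzMap.integral_fourier_mul_eq]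
      refine integral_congr_ae (Eventually.of_forall fun x => ?_)
      simp only [hΦapp]
      rw [Complex.real_smul, mul_comm]
      rfl
    rw [h1]
    have h2 : ∀ w, g w * 𝓕 Φ w =
        ∫ x, d x * 𝓕 Φ w * Complex.exp (Complex.I * (inner ℝ (s x) w : ℝ)) ∂ν := by
      intro w
      rw [hh, ← integral_mul_const]
      exact integral_congr_ae (Eventually.of_forall fun x => by ring)
    simp_rw [h2]
    rw [integral_integral_swap]
    · refine integral_eq_zero_of_ae (Eventually.of_forall fun x => ?_)
      have h3 : ∫ w, d x * 𝓕 Φ w * Complex.exp (Complex.I * (inner ℝ (s x) w : ℝ)) =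
          d x * (𝓕⁻ (𝓕 Φ) : 𝓢(E, ℂ)) ((2 * Real.pi)⁻¹ • s x) := by
        rw [SchwartzMap.fourierInv_coe, Real.fourierInv_eq', ← integral_const_mul]
        refine integral_congr_ae (Eventually.of_forall fun w => ?_)
        simp only [inner_smul_right, smul_eq_mul, real_inner_comm (s x)]
        rw [mul_inv_cancel_left₀ (by positivity)]
        rw [mul_assoc, mul_comm Complex.I, mul_comm (Complex.exp _)]
      beta_reduce
      rw [h3, FourierTransform.fourierInv_fourier_eq, hΦapp]
      have h4 : φ ((2 * Real.pi)⁻¹ • s x) = 0 := by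
        by_contra hne
        refine hφU (subset_tsupport _ hne) ?_
        rw [mem_closedBall_zero_iff, norm_smul, Real.norm_of_nonneg (by positivity), inv_mul_eq_div]
        gcongr
        exact hR x
      rw [h4, Complex.ofReal_zero, mul_zero]
      rfl
    · have h5 : Integrable (fun p : E × X => 𝓕 Φ p.1 * d p.2) (volume.prod ν) :=
        (𝓕 Φ : 𝓢(E, ℂ)).integrable.mul_prod hd
      refine (integrable_mul_exp (t := fun p : E × X => inner ℝ (s p.2) p.1) h5 (by fun_prop)).congr
        (Eventually.of_forall fun p => ?_)
      simp only [Function.uncurry]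
      ring
  have hae := hUo.ae_eq_zero_of_integral_contDiff_smul_eq_zero (μ := volume)
    (hcont.locallyIntegrable.locallyIntegrableOn U) key
  have hz : ∀ x ∈ U, 𝓕 (g : E → ℂ) x = 0 := by
    have h1 : 𝓕 (g : E → ℂ) =ᵐ[volume.restrict U] 0 := (ae_restrict_iff' hUo.measurableSet).mpr hae
    exact Measure.eqOn_open_of_ae_eq h1 hUo hcont.continuousOn continuousOn_const
  refine HasCompactSupport.intro (isCompact_closedBall (0 : E) (R / (2 * Real.pi))) fun x hx => hz x hx

end BandLimited

/-! ### Products of Schwartz functions pulled back along linear maps -/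

section SchwartzProduct

variable {E₁ E₂ W : Type*} [NormedAddCommGroup E₁] [NormedSpace ℝ E₁] [NormedAddCommGroup E₂]
  [NormedSpace ℝ E₂] [NormedAddCommGroup W] [NormedSpace ℝ W]

theorem norm_iteratedFDeriv_comp_clm_le (g : 𝓢(E₁, ℂ)) (A : W →L[ℝ] E₁) (i : ℕ) (x : W) :
    ‖iteratedFDeriv ℝ i (fun w => g (A w)) x‖ ≤ ‖A‖ ^ i * ‖iteratedFDeriv ℝ i g (A x)‖ := by
  have h := A.iteratedFDeriv_comp_right (g.smooth i) x (i := i) (by exact_mod_cast le_rfl)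
  change ‖iteratedFDeriv ℝ i (g ∘ A) x‖ ≤ _
  rw [h]
  refine (ContinuousMultilinearMap.norm_compContinuousLinearMap_le _ _).trans_eq ?_
  simp [mul_comm]

/-- Neither factor need decay on W, but hK says that A and B together control ‖w‖. In the Leibniz
formula a power of ‖w‖ splits into one of ‖A w‖, absorbed by g, and one of ‖B w‖, absorbed by g'. -/
theorem exists_schwartzMap_mul (g : 𝓢(E₁, ℂ)) (g' : 𝓢(E₂, ℂ)) (A : W →L[ℝ] E₁) (B : W →L[ℝ] E₂)
    {K : ℝ} (hK0 : 0 ≤ K) (hK : ∀ w, ‖w‖ ≤ K * (‖A w‖ + ‖B w‖)) :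
    ∃ G : 𝓢(W, ℂ), ∀ w, G w = g (A w) * g' (B w) := by
  have hsA : ContDiff ℝ ∞ fun w => g (A w) := (g.smooth ⊤).comp A.contDiff
  have hsB : ContDiff ℝ ∞ fun w => g' (B w) := (g'.smooth ⊤).comp B.contDiff
  refine ⟨⟨fun w => g (A w) * g' (B w), hsA.mul hsB, fun k n => ?_⟩, fun w => rfl⟩
  choose c hc0 hc using g.decay
  choose c' hc0' hc' using g'.decay
  refine ⟨∑ i ∈ Finset.range (n + 1), (n.choose i : ℝ) * (K ^ k * 2 ^ (k - 1) * (‖A‖ ^ i * ‖B‖ ^ (n - i)) *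
    (c k i * c' 0 (n - i) + c 0 i * c' k (n - i))), fun x => ?_⟩
  have h1 := norm_iteratedFDeriv_mul_le (hsA.of_le (m := n) (by exact_mod_cast le_top))
    (hsB.of_le (m := n) (by exact_mod_cast le_top)) x (n := n) le_rfl
  refine (mul_le_mul_of_nonneg_left h1 (by positivity)).trans ?_
  rw [Finset.mul_sum]
  refine Finset.sum_le_sum fun i _ => ?_
  set a := ‖A x‖
  set b := ‖B x‖
  set u := ‖iteratedFDeriv ℝ i g (A x)‖
  set v := ‖iteratedFDeriv ℝ (n - i) g' (B x)‖
  have hx : ‖x‖ ^ k ≤ K ^ k * (2 ^ (k - 1) * (a ^ k + b ^ k)) := by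
    refine (pow_le_pow_left₀ (norm_nonneg _) (hK x) k).trans ?_
    rw [mul_pow]
    gcongr
    exact add_pow_le (norm_nonneg _) (norm_nonneg _) k
  have hu := hc k i (A x)
  have hu0 := hc 0 i (A x)
  have hv := hc' k (n - i) (B x)
  have hv0 := hc' 0 (n - i) (B x)
  rw [pow_zero, one_mul] at hu0 hv0
  have huv : (a ^ k + b ^ k) * (u * v) ≤ c k i * c' 0 (n - i) + c 0 i * c' k (n - i) := by
    have e1 : (a ^ k * u) * v ≤ c k i * c' 0 (n - i) :=
      mul_le_mul hu hv0 (norm_nonneg _) (hc0 _ _).le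
    have e2 : u * (b ^ k * v) ≤ c 0 i * c' k (n - i) :=
      mul_le_mul hu0 hv (by positivity) (hc0 _ _).le
    linarith
  calc ‖x‖ ^ k * ((n.choose i : ℝ) * ‖iteratedFDeriv ℝ i (fun w => g (A w)) x‖ *
        ‖iteratedFDeriv ℝ (n - i) (fun w => g' (B w)) x‖)
      ≤ K ^ k * (2 ^ (k - 1) * (a ^ k + b ^ k)) * ((n.choose i : ℝ) * (‖A‖ ^ i * u) *
        (‖B‖ ^ (n - i) * v)) := by
        gcongr
        · exact norm_iteratedFDeriv_comp_clm_le g A i x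
        · exact norm_iteratedFDeriv_comp_clm_le g' B (n - i) x
    _ = (n.choose i : ℝ) * (K ^ k * 2 ^ (k - 1) * (‖A‖ ^ i * ‖B‖ ^ (n - i)) *
        ((a ^ k + b ^ k) * (u * v))) := by ring
    _ ≤ _ := by gcongr

end SchwartzProduct

/-! ### The momentum factors of the generators -/

section Wave

variable {E F : Type} [NormedAddCommGroup E] [InnerProductSpace ℝ E] [MeasurableSpace E]
  [BorelSpace E] [FiniteDimensional ℝ E] [NormedAddCommGroup F] [InnerProductSpace ℝ F]
  [MeasurableSpace F] [BorelSpace F] [FiniteDimensional ℝ F]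

/-- The functions `e^{iξ·} (g ∘ P_U)`, with `g` a Schwartz function on `U` whose Fourier transform
has compact support. -/
def IsWave (h : E → ℂ) : Prop :=
  ∃ (U : Submodule ℝ E) (g : 𝓢(U, ℂ)) (ξ : E), HasCompactSupport (𝓕 (g : U → ℂ)) ∧
    ∀ p, h p = Complex.exp (Complex.I * (inner ℝ ξ p : ℝ)) * g (U.orthogonalProjectionOnto p)

theorem IsWave.bandLimited {h : E → ℂ} (H : IsWave h) : BandLimited h := by
  obtain ⟨U, g, ξ, hg, hh⟩ := H
  have := ((bandLimited_of_hasCompactSupport_fourier g hg).comp_linear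
    U.orthogonalProjectionOnto).exp_mul ξ
  rwa [← funext hh] at this

theorem IsWave.exists_bound {h : E → ℂ} (H : IsWave h) : ∃ C, ∀ p, ‖h p‖ ≤ C := by
  obtain ⟨U, g, ξ, -, hh⟩ := H
  refine ⟨SchwartzMap.seminorm ℝ 0 0 g, fun p => ?_⟩
  rw [hh, norm_mul, Complex.norm_exp_I_mul_ofReal, one_mul]
  exact g.norm_le_seminorm ℝ _

theorem IsWave.contDiff {h : E → ℂ} (H : IsWave h) : ContDiff ℝ ∞ h := by
  obtain ⟨U, g, ξ, -, hh⟩ := H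
  rw [funext hh]
  have h1 : ContDiff ℝ ∞ fun p => g (U.orthogonalProjectionOnto p) :=
    (g.smooth ⊤).comp U.orthogonalProjectionOnto.contDiff
  have h2 : ContDiff ℝ ∞ fun p : E => ((inner ℝ ξ p : ℝ) : ℂ) :=
    Complex.ofRealCLM.contDiff.comp (innerSL ℝ ξ).contDiff
  exact (contDiff_const.mul h2).cexp.mul h1

theorem IsWave.continuous {h : E → ℂ} (H : IsWave h) : Continuous h := H.contDiff.continuous

theorem IsWave.const_mul {h : E → ℂ} (H : IsWave h) (c : ℂ) : IsWave fun p => c * h p := by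
  obtain ⟨U, g, ξ, hg, hh⟩ := H
  refine ⟨U, c • g, ξ, BandLimited.hasCompactSupport_fourier ?_, fun p => ?_⟩
  · exact (bandLimited_of_hasCompactSupport_fourier g hg).const_mul c
  · beta_reduce
    rw [hh]
    simp only [smul_apply, smul_eq_mul]
    ring

theorem IsWave.conj {h : E → ℂ} (H : IsWave h) : IsWave fun p => (starRingEnd ℂ) (h p) := by
  obtain ⟨U, g, ξ, hg, hh⟩ := H
  refine ⟨U, g.postcompCLM (𝕜 := ℝ) Complex.conjCLE.toContinuousLinearMap, -ξ,
    BandLimited.hasCompactSupport_fourier ?_, fun p => ?_⟩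
  · exact (bandLimited_of_hasCompactSupport_fourier g hg).conj
  · beta_reduce
    rw [hh, map_mul, ← Complex.exp_conj, map_mul, Complex.conj_I, Complex.conj_ofReal,
      inner_neg_left, Complex.ofReal_neg, mul_neg, neg_mul]
    rfl

theorem IsWave.translate {h : E → ℂ} (H : IsWave h) (v : E) : IsWave fun p => h (p + v) := by
  obtain ⟨U, g, ξ, hg, hh⟩ := H
  set c := Complex.exp (Complex.I * (inner ℝ ξ v : ℝ))
  set w := U.orthogonalProjectionOnto v
  have happ : ∀ u : U, (SchwartzMap.compSubConstCLM ℂ (-w) g) u = g (u + w) := fun u => by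
    rw [SchwartzMap.compSubConstCLM_apply, sub_neg_eq_add]
  refine ⟨U, c • SchwartzMap.compSubConstCLM ℂ (-w) g, ξ,
    BandLimited.hasCompactSupport_fourier ?_, fun p => ?_⟩
  · have := ((bandLimited_of_hasCompactSupport_fourier g hg).translate w).const_mul c
    convert this using 2 with u
    rw [smul_apply, happ, smul_eq_mul]
  · beta_reduce
    rw [hh, smul_apply, happ, map_add, inner_add_right, Complex.ofReal_add, mul_add,
      Complex.exp_add, smul_eq_mul, mul_assoc]

/-- With B = P_U ∘ A and W the orthogonal complement of ker B, the restriction of B to W is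
injective, hence bounded below in finite dimension. So g ∘ B|_W is Schwartz on W, and B p depends
only on P_W p. -/
theorem IsWave.comp_linear {h : F → ℂ} (H : IsWave h) (A : E →L[ℝ] F) : IsWave fun p => h (A p) := by
  obtain ⟨U, g, ξ, hg, hh⟩ := H
  set B : E →L[ℝ] U := U.orthogonalProjectionOnto ∘L A
  set W : Submodule ℝ E := (LinearMap.ker B.toLinearMap)ᗮ with hW
  set M : W →L[ℝ] U := B ∘L W.subtypeL with hM
  have hinj : LinearMap.ker M.toLinearMap = ⊥ := by
    rw [LinearMap.ker_eq_bot']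
    intro w hw
    have h1 : (w : E) ∈ LinearMap.ker B.toLinearMap := hw
    have h2 : inner ℝ (w : E) (w : E) = (0 : ℝ) := w.2 _ h1
    exact Subtype.ext (inner_self_eq_zero.mp h2)
  obtain ⟨K, -, hK⟩ := M.toLinearMap.exists_antilipschitzWith hinj
  have hMg : Function.HasTemperateGrowth (M : W → U) := M.hasTemperateGrowth
  refine ⟨W, SchwartzMap.compCLMOfAntilipschitz ℂ hMg hK g, A.adjoint ξ,
    BandLimited.hasCompactSupport_fourier ?_, fun p => ?_⟩
  · exact (bandLimited_of_hasCompactSupport_fourier g hg).comp_linear M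
  · beta_reduce
    rw [hh, ContinuousLinearMap.adjoint_inner_left]
    congr 1
    change g (B p) = g (B (W.orthogonalProjectionOnto p : E))
    have h1 : p - W.orthogonalProjectionOnto p ∈ LinearMap.ker B.toLinearMap := by
      have h2 := W.sub_starProjection_mem_orthogonal p
      exact (Submodule.orthogonal_orthogonal (LinearMap.ker B.toLinearMap)).le h2
    have h3 : B (p - W.orthogonalProjectionOnto p) = 0 := h1
    rw [map_sub, sub_eq_zero] at h3
    rw [h3]

/-- On W = U ⊔ U' the pair (P_U, P_{U'}) is injective, hence bounded below, so the product of the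
two pullbacks is Schwartz on W even though neither factor need be. -/
theorem IsWave.mul {h h' : E → ℂ} (H : IsWave h) (H' : IsWave h') :
    IsWave fun p => h p * h' p := by
  obtain ⟨U, g, ξ, hg, hh⟩ := H
  obtain ⟨U', g', ξ', hg', hh'⟩ := H'
  set W := U ⊔ U' with hW
  set A : W →L[ℝ] U := U.orthogonalProjectionOnto ∘L W.subtypeL with hA
  set B : W →L[ℝ] U' := U'.orthogonalProjectionOnto ∘L W.subtypeL with hB
  have hproj : ∀ (V : Submodule ℝ E), V ≤ W → ∀ p, V.orthogonalProjectionOnto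
      (W.orthogonalProjectionOnto p : E) = V.orthogonalProjectionOnto p := by
    intro V hV p
    have h1 : p - W.orthogonalProjectionOnto p ∈ Vᗮ :=
      Submodule.orthogonal_le hV (W.sub_starProjection_mem_orthogonal p)
    have h2 := Submodule.orthogonalProjectionOnto_eq_zero_iff.mpr h1
    rw [map_sub, sub_eq_zero] at h2
    exact h2.symm
  have hinj : LinearMap.ker (A.prod B).toLinearMap = ⊥ := by
    rw [LinearMap.ker_eq_bot']
    intro w hw
    have h1 : A w = 0 ∧ B w = 0 := Prod.mk_inj.mp hw
    have h2 : (w : E) ∈ Uᗮ := Submodule.orthogonalProjectionOnto_eq_zero_iff.mp h1.1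
    have h3 : (w : E) ∈ U'ᗮ := Submodule.orthogonalProjectionOnto_eq_zero_iff.mp h1.2
    have h4 : (w : E) ∈ Wᗮ := by
      exact (Submodule.inf_orthogonal U U').le ⟨h2, h3⟩
    exact Subtype.ext (inner_self_eq_zero (𝕜 := ℝ).mp (h4 _ w.2))
  obtain ⟨K, -, hK⟩ := (A.prod B).toLinearMap.exists_antilipschitzWith hinj
  obtain ⟨G, hG⟩ := exists_schwartzMap_mul g g' A B K.2 fun w => by
    have h1 := hK.le_mul_dist w 0
    rw [dist_zero_right, map_zero, dist_zero_right] at h1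
    refine h1.trans (mul_le_mul_of_nonneg_left ?_ K.2)
    exact max_le (le_add_of_nonneg_right (norm_nonneg _)) (le_add_of_nonneg_left (norm_nonneg _))
  refine ⟨W, G, ξ + ξ', BandLimited.hasCompactSupport_fourier ?_, fun p => ?_⟩
  · have := ((bandLimited_of_hasCompactSupport_fourier g hg).comp_linear A).mul
      ((bandLimited_of_hasCompactSupport_fourier g' hg').comp_linear B)
    rwa [← funext hG] at this
  · beta_reduce
    rw [hh, hh', hG, inner_add_left, Complex.ofReal_add, mul_add, Complex.exp_add]
    have h1 : A (W.orthogonalProjectionOnto p) = U.orthogonalProjectionOnto p := hproj U le_sup_left p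
    have h2 : B (W.orthogonalProjectionOnto p) = U'.orthogonalProjectionOnto p :=
      hproj U' le_sup_right p
    rw [h1, h2]
    ring

/-- A constant is a Schwartz function on the zero subspace; this makes the algebras unital. -/
theorem isWave_one : IsWave fun _ : E => (1 : ℂ) := by
  have hc : HasCompactSupport fun _ : (⊥ : Submodule ℝ E) => (1 : ℂ) :=
    HasCompactSupport.of_compactSpace _
  refine ⟨⊥, hc.toSchwartzMap contDiff_const, 0, HasCompactSupport.of_compactSpace _, fun p => ?_⟩
  simp

/-- The derivative along v replaces g by i(ξ·v) g + ∂_w g with w = P_U v. On the Fourier side this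
multiplies by an affine function and does not enlarge the support. -/
theorem IsWave.exists_hasDerivAt {h : E → ℂ} (H : IsWave h) (v : E) :
    ∃ h' : E → ℂ, IsWave h' ∧ ∀ p, HasDerivAt (fun t : ℝ => h (p + t • v)) (h' p) 0 := by
  obtain ⟨U, g, ξ, hg, hh⟩ := H
  set w := U.orthogonalProjectionOnto v
  set c : ℂ := Complex.I * (inner ℝ ξ v : ℝ)
  refine ⟨fun p => Complex.exp (Complex.I * (inner ℝ ξ p : ℝ)) *
    (c • g + LineDeriv.lineDerivOp w g) (U.orthogonalProjectionOnto p),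
    ⟨U, _, ξ, ?_, fun p => rfl⟩, fun p => ?_⟩
  · have h1 : (𝓕 ((c • g + LineDeriv.lineDerivOp w g : 𝓢(U, ℂ)) : U → ℂ)) =
        fun x => (c + 2 * Real.pi * Complex.I * (inner ℝ x w : ℝ)) * 𝓕 (g : U → ℂ) x := by
      ext x
      have h2 : (fun y : U => (inner ℝ y w : ℝ)).HasTemperateGrowth :=
        ((innerSL ℝ).flip w).hasTemperateGrowth
      rw [← SchwartzMap.fourier_coe, FourierTransform.fourier_add, FourierTransform.fourier_smul,
        SchwartzMap.fourier_lineDerivOp_eq, add_apply, smul_apply,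
        smul_apply, SchwartzMap.smulLeftCLM_apply_apply h2, SchwartzMap.fourier_coe,
        smul_eq_mul, smul_eq_mul, Complex.real_smul]
      ring
    rw [h1]
    exact hg.mul_left
  · have h1 : HasDerivAt (fun t : ℝ => Complex.exp (Complex.I * (inner ℝ ξ (p + t • v) : ℝ)))
        (Complex.exp (Complex.I * (inner ℝ ξ p : ℝ)) * c) 0 := by
      have h2 : HasDerivAt (fun t : ℝ => Complex.I * ((inner ℝ ξ (p + t • v) : ℝ) : ℂ)) c 0 := by
        have h3 : HasDerivAt (fun t : ℝ => inner ℝ ξ p + t * inner ℝ ξ v) (inner ℝ ξ v) 0 := by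
          simpa using ((hasDerivAt_id (0 : ℝ)).mul_const (inner ℝ ξ v)).const_add (inner ℝ ξ p)
        have h4 := (h3.ofReal_comp).const_mul Complex.I
        have h5 : (fun t : ℝ => Complex.I * ((inner ℝ ξ (p + t • v) : ℝ) : ℂ)) =
            fun t : ℝ => Complex.I * ((inner ℝ ξ p + t * inner ℝ ξ v : ℝ) : ℂ) := by
          ext t
          rw [inner_add_right, inner_smul_right]
        rw [h5]
        exact h4
      have h5 := h2.cexp
      simpa using h5
    have h2 : HasDerivAt (fun t : ℝ => g (U.orthogonalProjectionOnto (p + t • v)))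
        (LineDeriv.lineDerivOp w g (U.orthogonalProjectionOnto p)) 0 := by
      rw [SchwartzMap.lineDerivOp_apply_eq_fderiv]
      have h3 := (g.hasFDerivAt (U.orthogonalProjectionOnto p)).hasLineDerivAt w
      have h4 : HasDerivAt (fun t : ℝ => g (U.orthogonalProjectionOnto p + t • w)) _ 0 := h3
      convert h4 using 3 with t
      simp [w]
    have h3 := h1.mul h2
    have h4 : (fun t : ℝ => h (p + t • v)) = fun t : ℝ =>
        Complex.exp (Complex.I * (inner ℝ ξ (p + t • v) : ℝ)) *
          g (U.orthogonalProjectionOnto (p + t • v)) := funext fun t => hh _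
    rw [h4]
    refine HasDerivAt.congr_deriv h3 ?_
    simp only [add_apply, smul_apply, zero_smul, add_zero, smul_eq_mul]
    ring

end Wave

/-! ### Complex measures as densities -/

section ComplexMeasure

variable {X Y : Type*} [MeasurableSpace X] [MeasurableSpace Y]

theorem integrable_withDensity_enorm_iff {ν : Measure X} {d φ : X → ℂ} (hd : Integrable d ν)
    (hφ : AEStronglyMeasurable φ ν) :
    Integrable φ (ν.withDensity fun x => ‖d x‖ₑ) ↔ Integrable (fun x => φ x * d x) ν := by
  have h1 : (fun x => ‖d x‖ₑ) = fun x => ((‖d x‖₊ : NNReal) : ℝ≥0∞) := rfl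
  rw [h1, integrable_withDensity_iff_integrable_smul₀ hd.aestronglyMeasurable.aemeasurable.nnnorm]
  refine ⟨fun h => h.mono (hφ.mul hd.aestronglyMeasurable) (ae_of_all _ fun x => ?_),
    fun h => h.mono (hd.aestronglyMeasurable.nnnorm.smul hφ) (ae_of_all _ fun x => ?_)⟩
  all_goals simp [NNReal.smul_def, mul_comm]

theorem vectorMeasure_integrable_withDensityᵥ {ν : Measure X} {d φ : X → ℂ} (hd : Integrable d ν)
    (hφ : AEStronglyMeasurable φ ν) (h : Integrable (fun x => φ x * d x) ν) :
    (ν.withDensityᵥ d).Integrable φ := by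
  rw [VectorMeasure.Integrable, Measure.variation_withDensityᵥ hd]
  exact (integrable_withDensity_enorm_iff hd hφ).mpr h

/-- Both sides are continuous in L¹ of the variation |d|ν and agree on indicators. This turns
integrals against complex measures into Bochner integrals, for which Fubini's theorem is at hand. -/
theorem cintegral_withDensityᵥ {ν : Measure X} {d φ : X → ℂ} (hd : Integrable d ν)
    (hdm : Measurable d) (hφ : (ν.withDensityᵥ d).Integrable φ) :
    cintegral (ν.withDensityᵥ d) φ = ∫ x, φ x * d x ∂ν := by
  have hvar := Measure.variation_withDensityᵥ hd
  have hmul : ∀ φ : X → ℂ, Integrable φ (ν.withDensity fun x => ‖d x‖ₑ) →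
      Integrable (fun x => φ x * d x) ν := by
    intro φ hφ
    obtain ⟨φ', hφ', hae⟩ := hφ.aestronglyMeasurable
    have h1 := (integrable_withDensity_enorm_iff hd hφ'.aestronglyMeasurable).mp (hφ.congr hae)
    refine h1.congr ?_
    rw [EventuallyEq, ae_withDensity_iff hdm.enorm] at hae
    filter_upwards [hae] with x hx
    -- Almost everywhere for |d|ν says nothing about points where d vanishes, but there the product
    -- is 0.
    by_cases hdx : d x = 0
    · simp [hdx]
    · rw [hx (by simpa using hdx)]
  have hbound : ∀ φ : X → ℂ, Integrable φ (ν.withDensity fun x => ‖d x‖ₑ) →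
      ∫ x, ‖φ x * d x‖ ∂ν = ∫ x, ‖φ x‖ ∂(ν.withDensity fun x => ‖d x‖ₑ) := by
    intro φ hφ
    have h1 : (fun x => ‖d x‖ₑ) = fun x => ((‖d x‖₊ : NNReal) : ℝ≥0∞) := rfl
    rw [h1, integral_withDensity_eq_integral_smul hdm.nnnorm]
    refine integral_congr_ae (ae_of_all _ fun x => ?_)
    simp [NNReal.smul_def, mul_comm]
  rw [← hvar] at hmul hbound
  refine Integrable.induction (fun φ => cintegral (ν.withDensityᵥ d) φ = ∫ x, φ x * d x ∂ν)
    (fun c s hs hfin => ?_) (fun f g _ hf hg ihf ihg => ?_) ?_ (fun f g hae hf ih => ?_) hφ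
  · rw [cintegral, VectorMeasure.integral_eq_setToFun, setToFun_indicator_const _ hs hfin.ne]
    have h1 : (fun x => s.indicator (fun _ => c) x * d x) = s.indicator fun x => c * d x := by
      ext x
      by_cases hx : x ∈ s <;> simp [hx]
    rw [h1, integral_indicator hs, integral_const_mul, ← withDensityᵥ_apply hd hs]
    rfl
  · rw [cintegral, VectorMeasure.integral_add hf hg]
    have h1 : (fun x => (f + g) x * d x) = fun x => f x * d x + g x * d x := by
      ext x
      simp [add_mul]
    rw [h1, integral_add (hmul f hf) (hmul g hg), ← ihf, ← ihg]
    rfl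
  · refine isClosed_eq VectorMeasure.continuous_integral ?_
    refine (LipschitzWith.of_dist_le_mul (K := 1) fun f g => ?_).continuous
    rw [NNReal.coe_one, one_mul, dist_eq_norm, dist_eq_norm, L1.norm_eq_integral_norm]
    have hf := L1.integrable_coeFn f
    have hg := L1.integrable_coeFn g
    rw [← integral_sub (hmul _ hf) (hmul _ hg)]
    refine (norm_integral_le_integral_norm _).trans (le_of_eq ?_)
    simp_rw [← sub_mul]
    refine (hbound _ (hf.sub hg)).trans (integral_congr_ae ?_)
    filter_upwards [Lp.coeFn_sub f g] with x hx
    rw [hx]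
  · have hg := hf.congr hae
    rw [cintegral, ← VectorMeasure.integral_congr_ae hae]
    refine ih.trans (sub_eq_zero.mp ?_)
    rw [← integral_sub (hmul _ hf) (hmul _ hg)]
    refine norm_eq_zero.mp (le_antisymm ((norm_integral_le_integral_norm _).trans ?_)
      (norm_nonneg _))
    simp_rw [← sub_mul]
    refine ((hbound _ (hf.sub hg)).trans (integral_eq_zero_of_ae ?_)).le
    filter_upwards [hae] with x hx
    simp [hx]

/-- Radon–Nikodym for the real and imaginary parts, both absolutely continuous with respect to the
sum of their total variations. -/
theorem exists_eq_withDensityᵥ (μ : ComplexMeasure X) : ∃ (ν : Measure X) (d : X → ℂ),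
    IsFiniteMeasure ν ∧ Integrable d ν ∧ Measurable d ∧ μ = ν.withDensityᵥ d := by
  set a := ComplexMeasure.re μ
  set b := ComplexMeasure.im μ
  set ν := a.totalVariation + b.totalVariation with hν
  have hfin : IsFiniteMeasure ν := by
    have : IsFiniteMeasure a.totalVariation := by unfold SignedMeasure.totalVariation; infer_instance
    have : IsFiniteMeasure b.totalVariation := by unfold SignedMeasure.totalVariation; infer_instance
    infer_instance
  have ha : ν.withDensityᵥ (a.rnDeriv ν) = a := by
    refine SignedMeasure.withDensityᵥ_rnDeriv_eq a ν ?_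
    refine VectorMeasure.AbsolutelyContinuous.mk fun s hs h0 => ?_
    rw [Measure.toENNRealVectorMeasure_apply_measurable hs, hν, Measure.add_apply] at h0
    exact enorm_eq_zero.mp (le_antisymm ((SignedMeasure.enorm_le_totalVariation a s).trans
      (le_self_add.trans h0.le)) zero_le)
  have hb : ν.withDensityᵥ (b.rnDeriv ν) = b := by
    refine SignedMeasure.withDensityᵥ_rnDeriv_eq b ν ?_
    refine VectorMeasure.AbsolutelyContinuous.mk fun s hs h0 => ?_
    rw [Measure.toENNRealVectorMeasure_apply_measurable hs, hν, Measure.add_apply] at h0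
    exact enorm_eq_zero.mp (le_antisymm ((SignedMeasure.enorm_le_totalVariation b s).trans
      (le_add_self.trans h0.le)) zero_le)
  have hai := SignedMeasure.integrable_rnDeriv a ν
  have hbi := SignedMeasure.integrable_rnDeriv b ν
  have hint : Integrable (fun x => (a.rnDeriv ν x : ℂ) + b.rnDeriv ν x * Complex.I) ν :=
    hai.ofReal.add (hbi.ofReal.mul_const _)
  refine ⟨ν, _, hfin, hint, ?_, ?_⟩
  · have := SignedMeasure.measurable_rnDeriv a ν
    have := SignedMeasure.measurable_rnDeriv b ν
    fun_prop
  · ext s hs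
    rw [withDensityᵥ_apply hint hs, integral_add hai.ofReal.restrict
      (hbi.ofReal.mul_const _).restrict, integral_mul_const, integral_complex_ofReal, integral_complex_ofReal,
      ← withDensityᵥ_apply hai hs, ← withDensityᵥ_apply hbi hs, ha, hb]
    exact (Complex.re_add_im (μ s)).symm

/-- The measure is the image of dν under s; it converts a band-limited representation into the form
required by the operator system. -/
theorem exists_invFourier_eq {n D : ℕ} {l : Lattice D} {ν : Measure X} {d : X → ℂ}
    {s : X → Mom n l} (hd : Integrable d ν) (hs : Measurable s) {K : Set (Mom n l)}
    (hK : IsCompact K) (hKB : K ⊆ ballB n l) (hsK : ∀ x, s x ∈ K) :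
    ∃ μ : ComplexMeasure (Mom n l), SupportedInBall μ ∧ ∀ p, invFourier μ p =
      ∫ x, d x * Complex.exp (Complex.I * (inner ℝ (s x) p : ℝ)) ∂ν := by
  obtain ⟨d', hd', hae⟩ := hd.aestronglyMeasurable
  have hdi := hd.congr hae
  refine ⟨(ν.withDensityᵥ d').map s, ⟨K, hK, hKB, fun t ht hdis => ?_⟩, fun p => ?_⟩
  · rw [VectorMeasure.map_apply _ hs ht]
    have : s ⁻¹' t = ∅ := Set.eq_empty_of_forall_notMem fun x hx =>
      Set.disjoint_left.mp hdis hx (hsK x)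
    rw [this, VectorMeasure.empty]
  · have hc : Continuous fun ξ : Mom n l => Complex.exp (Complex.I * (inner ℝ ξ p : ℝ)) := by
      fun_prop
    have h1 : (ν.withDensityᵥ d').Integrable
        ((fun ξ : Mom n l => Complex.exp (Complex.I * (inner ℝ ξ p : ℝ))) ∘ s) := by
      refine vectorMeasure_integrable_withDensityᵥ hdi
        (hc.measurable.comp hs).aestronglyMeasurable ?_
      exact hdi.bdd_mul (hc.measurable.comp hs).aestronglyMeasurable (c := 1)
        (ae_of_all _ fun x => by simp [Complex.norm_exp_I_mul_ofReal])
    rw [invFourier, cintegral, VectorMeasure.integral_map hs hc.aestronglyMeasurable h1]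
    refine (cintegral_withDensityᵥ hdi hd'.measurable h1).trans ?_
    refine integral_congr_ae ?_
    filter_upwards [hae] with x hx
    rw [hx, mul_comm]
    rfl

end ComplexMeasure

/-! ### Common and fine refinements of lattices -/

section Refinement

variable {D : ℕ}

theorem toLex_lt_iff {x y : EuclideanSpace ℝ (Fin D)} : toLex x.ofLp < toLex y.ofLp ↔
    ∃ i, (∀ j < i, x j = y j) ∧ x i < y i := Iff.rfl

theorem lineMap_sub_lineMap' (e : Edge D) (s t : ℝ) :
    AffineMap.lineMap e.1 e.2 t - AffineMap.lineMap e.1 e.2 s = (t - s) • (e.2 - e.1) := by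
  simp only [AffineMap.lineMap_apply, vsub_eq_sub, vadd_eq_add]
  module

theorem toLex_lineMap_lt {e : Edge D} (he : toLex e.1.ofLp < toLex e.2.ofLp) {s t : ℝ}
    (hst : s < t) : toLex (AffineMap.lineMap e.1 e.2 s : EuclideanSpace ℝ (Fin D)).ofLp <
      toLex (AffineMap.lineMap e.1 e.2 t : EuclideanSpace ℝ (Fin D)).ofLp := by
  obtain ⟨i, hi, hi'⟩ := toLex_lt_iff.mp he
  have key : ∀ j, (AffineMap.lineMap e.1 e.2 t : EuclideanSpace ℝ (Fin D)) j -
      (AffineMap.lineMap e.1 e.2 s : EuclideanSpace ℝ (Fin D)) j = (t - s) * (e.2 j - e.1 j) :=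
    fun j => congrArg (fun v : EuclideanSpace ℝ (Fin D) => v j) (lineMap_sub_lineMap' e s t)
  refine toLex_lt_iff.mpr ⟨i, fun j hj => ?_, ?_⟩
  · have := key j
    rw [hi j hj, sub_self, mul_zero] at this
    linarith
  · have := key i
    nlinarith [mul_pos (sub_pos.mpr hst) (sub_pos.mpr hi')]

/-- Both direction vectors have a positive first nonzero coordinate. Hence parallel edges of
lattices point the same way. -/
theorem pos_of_smul_eq {e e' : Edge D} (he : toLex e.1.ofLp < toLex e.2.ofLp)
    (he' : toLex e'.1.ofLp < toLex e'.2.ofLp) {c : ℝ} (h : e'.2 - e'.1 = c • (e.2 - e.1)) :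
    0 < c := by
  by_contra hc
  push Not at hc
  obtain ⟨i, hi, hi'⟩ := toLex_lt_iff.mp he
  obtain ⟨k, hk, hk'⟩ := toLex_lt_iff.mp he'
  have key : ∀ j, e'.2 j - e'.1 j = c * (e.2 j - e.1 j) :=
    fun j => congrArg (fun v : EuclideanSpace ℝ (Fin D) => v j) h
  have h1 := key k
  rcases lt_trichotomy k i with hki | hki | hki
  · rw [hi k hki, sub_self, mul_zero] at h1
    linarith
  · subst hki
    nlinarith
  · have h2 := key i
    rw [hk i hki, sub_self] at h2
    have : c = 0 := by
      rcases mul_eq_zero.mp h2.symm with h3 | h3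
      · exact h3
      · linarith
    rw [this, zero_mul] at h1
    linarith

theorem lineMap_injective_of_toLex_lt {e : Edge D} (he : toLex e.1.ofLp < toLex e.2.ofLp) :
    Function.Injective (AffineMap.lineMap e.1 e.2 : ℝ → EuclideanSpace ℝ (Fin D)) := by
  intro s t hst
  by_contra hne
  rcases lt_or_gt_of_ne hne with h | h
  · have := toLex_lineMap_lt he h
    rw [hst] at this
    exact lt_irrefl _ this
  · have := toLex_lineMap_lt he h
    rw [hst] at this
    exact lt_irrefl _ this

/-- Segments that are not parallel meet in at most one point. -/
theorem subsingleton_inter_seg {e e' : Edge D}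
    (h : ¬∃ c : ℝ, e'.2 - e'.1 = c • (e.2 - e.1)) : (e.seg ∩ e'.seg).Subsingleton := by
  rintro x ⟨hx, hx'⟩ y ⟨hy, hy'⟩
  rw [Edge.seg_eq_image] at hx hx' hy hy'
  obtain ⟨s, -, rfl⟩ := hx
  obtain ⟨s', -, hs'⟩ := hx'
  obtain ⟨t, -, rfl⟩ := hy
  obtain ⟨t', -, ht'⟩ := hy'
  have h1 := lineMap_sub_lineMap' e' s' t'
  rw [hs', ht', lineMap_sub_lineMap'] at h1
  by_cases h0 : t' - s' = 0
  · rw [h0, zero_smul, ← lineMap_sub_lineMap', sub_eq_zero] at h1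
    exact h1.symm
  · refine absurd ⟨(t' - s')⁻¹ * (t - s), ?_⟩ h
    rw [mul_smul, h1, inv_smul_smul₀ h0]

/-- The edge `e` is subdivided in `m`. -/
def Subdivides (m : Lattice D) (e : Edge D) : Prop :=
  ∃ (N : ℕ) (t : Fin (N + 2) → ℝ), StrictMono t ∧ t 0 = 0 ∧ t (Fin.last (N + 1)) = 1 ∧
    ∀ s : Fin (N + 1),
      (AffineMap.lineMap e.1 e.2 (t s.castSucc), AffineMap.lineMap e.1 e.2 (t s.succ)) ∈ m.edges

/-- The pieces into which a set of points `C` cuts the edges in `E`. -/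
def cutEdges (E : Set (Edge D)) (C : Set (EuclideanSpace ℝ (Fin D))) : Set (Edge D) :=
  {f | ∃ e ∈ E, ∃ s t : ℝ, 0 ≤ s ∧ s < t ∧ t ≤ 1 ∧ f.1 = AffineMap.lineMap e.1 e.2 s ∧
    f.2 = AffineMap.lineMap e.1 e.2 t ∧ f.1 ∈ C ∧ f.2 ∈ C ∧
    ∀ r, s < r → r < t → (AffineMap.lineMap e.1 e.2 r : EuclideanSpace ℝ (Fin D)) ∉ C}

theorem mem_openSegment_lineMap {e : Edge D} {s t : ℝ} (hst : s < t)
    {z : EuclideanSpace ℝ (Fin D)} : z ∈ openSegment ℝ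
      (AffineMap.lineMap e.1 e.2 s : EuclideanSpace ℝ (Fin D)) (AffineMap.lineMap e.1 e.2 t) ↔
      ∃ r, s < r ∧ r < t ∧ z = AffineMap.lineMap e.1 e.2 r := by
  rw [← image_openSegment ℝ (AffineMap.lineMap e.1 e.2 : ℝ →ᵃ[ℝ] EuclideanSpace ℝ (Fin D)),
    openSegment_eq_Ioo hst]
  constructor
  · rintro ⟨r, ⟨h1, h2⟩, rfl⟩
    exact ⟨r, h1, h2, rfl⟩
  · rintro ⟨r, h1, h2, rfl⟩
    exact ⟨r, ⟨h1, h2⟩, rfl⟩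

/-- Suppose two pieces share an interior point. If the edges are not parallel, that point is in C,
contrary to the construction. Otherwise both pieces lie on one line and run in the same direction,
and each has its ends in C but no interior point in C. Neither can end inside the other, so they
coincide. -/
theorem cutEdges_disjoint {E : Set (Edge D)} (hE : ∀ e ∈ E, toLex e.1.ofLp < toLex e.2.ofLp)
    {C : Set (EuclideanSpace ℝ (Fin D))}
    (hC : ∀ e ∈ E, ∀ e' ∈ E, (¬∃ c : ℝ, e'.2 - e'.1 = c • (e.2 - e.1)) → e.seg ∩ e'.seg ⊆ C)
    {f f' : Edge D} (hf : f ∈ cutEdges E C) (hf' : f' ∈ cutEdges E C) (hne : f ≠ f') :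
    Disjoint (openSegment ℝ f.1 f.2) (openSegment ℝ f'.1 f'.2) := by
  obtain ⟨e, he, s, t, hs, hst, ht, h1, h2, hC1, hC2, hcut⟩ := hf
  obtain ⟨e', he', s', t', hs', hst', ht', h1', h2', hC1', hC2', hcut'⟩ := hf'
  rw [Set.disjoint_left]
  intro z hz hz'
  rw [h1, h2, mem_openSegment_lineMap hst] at hz
  rw [h1', h2', mem_openSegment_lineMap hst'] at hz'
  obtain ⟨r, hsr, hrt, hr⟩ := hz
  obtain ⟨r', hsr', hrt', hr'⟩ := hz'
  have hzC : z ∉ C := hr ▸ hcut r hsr hrt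
  have hpar : ∃ c : ℝ, e'.2 - e'.1 = c • (e.2 - e.1) := by
    by_contra hcon
    refine hzC (hC e he e' he' hcon ⟨?_, ?_⟩)
    · rw [Edge.seg_eq_image, hr]
      exact ⟨r, ⟨by linarith, by linarith⟩, rfl⟩
    · rw [Edge.seg_eq_image, hr']
      exact ⟨r', ⟨by linarith, by linarith⟩, rfl⟩
  obtain ⟨c, hc⟩ := hpar
  have hc0 : 0 < c := pos_of_smul_eq (hE e he) (hE e' he') hc
  have key : ∀ u, (AffineMap.lineMap e'.1 e'.2 u : EuclideanSpace ℝ (Fin D)) =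
      AffineMap.lineMap e.1 e.2 (r + c * (u - r')) := by
    intro u
    have a1 := lineMap_sub_lineMap' e' r' u
    have a2 := lineMap_sub_lineMap' e r (r + c * (u - r'))
    rw [← hr', hc, smul_smul] at a1
    rw [← hr, add_sub_cancel_left, mul_comm c] at a2
    rw [mul_comm c]
    exact sub_left_injective (a1.trans a2.symm)
  have key' : ∀ u, (AffineMap.lineMap e.1 e.2 u : EuclideanSpace ℝ (Fin D)) =
      AffineMap.lineMap e'.1 e'.2 (r' + (u - r) / c) := by
    intro u
    rw [key]
    congr 1
    field_simp
    ring
  have es : r + c * (s' - r') = s := by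
    apply le_antisymm
    · by_contra hcon
      push Not at hcon
      exact hcut _ hcon (by nlinarith) (key s' ▸ h1' ▸ hC1')
    · by_contra hcon
      push Not at hcon
      refine hcut' (r' + (s - r) / c) ?_ ?_ (key' s ▸ h1 ▸ hC1)
      · rw [← sub_lt_iff_lt_add', lt_div_iff₀ hc0]; linarith
      · have : (s - r) / c < 0 := div_neg_of_neg_of_pos (by linarith) hc0
        linarith
  have et : r + c * (t' - r') = t := by
    apply le_antisymm
    · by_contra hcon
      push Not at hcon
      refine hcut' (r' + (t - r) / c) ?_ ?_ (key' t ▸ h2 ▸ hC2)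
      · have : 0 < (t - r) / c := div_pos (by linarith) hc0
        linarith
      · rw [← lt_sub_iff_add_lt', div_lt_iff₀ hc0]; linarith
    · by_contra hcon
      push Not at hcon
      exact hcut _ (by nlinarith) hcon (key t' ▸ h2' ▸ hC2')
  refine hne (Prod.ext ?_ ?_)
  · rw [h1, h1', key, es]
  · rw [h2, h2', key, et]

/-- Finitely many edges can be subdivided simultaneously in a lattice, none of whose edges
has any of finitely many given points in its interior. -/
theorem exists_subdivides {E : Set (Edge D)} (hfin : E.Finite)
    (hE : ∀ e ∈ E, toLex e.1.ofLp < toLex e.2.ofLp) {C₀ : Set (EuclideanSpace ℝ (Fin D))}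
    (hC₀ : C₀.Finite) : ∃ m : Lattice D, (∀ e ∈ E, Subdivides m e) ∧
      ∀ f ∈ m.edges, Disjoint (openSegment ℝ f.1 f.2) C₀ := by
  classical
  -- Crossing points are needed only for non-parallel pairs, where there is at most one. Overlapping
  -- parallel edges are handled by their endpoints, which also belong to C.
  set C₁ : Set (EuclideanSpace ℝ (Fin D)) := ⋃ e ∈ E, ⋃ e' ∈ E,
    {x | (¬∃ c : ℝ, e'.2 - e'.1 = c • (e.2 - e.1)) ∧ x ∈ e.seg ∩ e'.seg}
  set C := C₀ ∪ Prod.fst '' E ∪ Prod.snd '' E ∪ C₁ with hCdef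
  have hCfin : C.Finite := by
    refine ((hC₀.union (hfin.image _)).union (hfin.image _)).union ?_
    refine hfin.biUnion fun e _ => hfin.biUnion fun e' _ => ?_
    by_cases h : ∃ c : ℝ, e'.2 - e'.1 = c • (e.2 - e.1)
    · refine Set.finite_empty.subset ?_
      rintro x ⟨hx, -⟩
      exact absurd h hx
    · exact (subsingleton_inter_seg h).finite.subset fun x hx => hx.2
  have hC : ∀ e ∈ E, ∀ e' ∈ E, (¬∃ c : ℝ, e'.2 - e'.1 = c • (e.2 - e.1)) →
      e.seg ∩ e'.seg ⊆ C := fun e he e' he' h x hx =>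
    Or.inr (Set.mem_iUnion₂.mpr ⟨e, he, Set.mem_iUnion₂.mpr ⟨e', he', h, hx⟩⟩)
  have hcutfin : (cutEdges E C).Finite := by
    refine (hCfin.prod hCfin).subset ?_
    rintro f ⟨e, -, s, t, -, -, -, -, -, h1, h2, -⟩
    exact ⟨h1, h2⟩
  refine ⟨⟨hcutfin.toFinset, fun f hf => ?_, fun f hf f' hf' hne => ?_⟩, fun e he => ?_,
    fun f hf => ?_⟩
  · obtain ⟨e, he, s, t, -, hst, -, h1, h2, -⟩ := hcutfin.mem_toFinset.mp hf
    rw [h1, h2]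
    exact toLex_lineMap_lt (hE e he) hst
  · exact cutEdges_disjoint hE hC (hcutfin.mem_toFinset.mp hf) (hcutfin.mem_toFinset.mp hf') hne
  -- The subdivision of e lists in increasing order the parameters of the points of C on e; 0 and 1
  -- are among them, whence at least two.
  · have hT : {t : ℝ | 0 ≤ t ∧ t ≤ 1 ∧ (AffineMap.lineMap e.1 e.2 t :
        EuclideanSpace ℝ (Fin D)) ∈ C}.Finite := by
      refine (hCfin.preimage (lineMap_injective_of_toLex_lt (hE e he)).injOn).subset ?_
      exact fun t ht => ht.2.2
    set T := hT.toFinset with hTdef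
    have hmem : ∀ t, t ∈ T ↔ 0 ≤ t ∧ t ≤ 1 ∧ (AffineMap.lineMap e.1 e.2 t :
        EuclideanSpace ℝ (Fin D)) ∈ C := fun t => by rw [hTdef, hT.mem_toFinset]; rfl
    have h0 : (0 : ℝ) ∈ T := (hmem 0).mpr ⟨le_rfl, zero_le_one, by
      rw [AffineMap.lineMap_apply_zero]
      exact Or.inl (Or.inl (Or.inr ⟨e, he, rfl⟩))⟩
    have h1 : (1 : ℝ) ∈ T := (hmem 1).mpr ⟨zero_le_one, le_rfl, by
      rw [AffineMap.lineMap_apply_one]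
      exact Or.inl (Or.inr ⟨e, he, rfl⟩)⟩
    have hcard : 1 < T.card := Finset.one_lt_card.mpr ⟨0, h0, 1, h1, zero_ne_one⟩
    obtain ⟨N, hN⟩ : ∃ N, T.card = N + 2 := ⟨T.card - 2, by omega⟩
    have hsucc : ∀ s : Fin (N + 1), ∀ r ∈ T, T.orderEmbOfFin hN s.castSucc < r →
        r < T.orderEmbOfFin hN s.succ → False := by
      intro s r hr h2 h3
      obtain ⟨i, rfl⟩ : r ∈ Set.range (T.orderEmbOfFin hN) := by
        rw [Finset.range_orderEmbOfFin]; exact hr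
      rw [OrderEmbedding.lt_iff_lt] at h2 h3
      have := Fin.lt_def.mp h2
      have := Fin.lt_def.mp h3
      simp only [Fin.val_castSucc, Fin.val_succ] at *
      omega
    refine ⟨N, T.orderEmbOfFin hN, (T.orderEmbOfFin hN).strictMono, ?_, ?_, fun s => ?_⟩
    · refine le_antisymm ?_ ((hmem _).mp (T.orderEmbOfFin_mem hN 0)).1
      obtain ⟨i, hi⟩ : (0 : ℝ) ∈ Set.range (T.orderEmbOfFin hN) := by
        rw [Finset.range_orderEmbOfFin]; exact h0
      rw [← hi]
      exact (T.orderEmbOfFin hN).monotone (Fin.zero_le _)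
    · refine le_antisymm ((hmem _).mp (T.orderEmbOfFin_mem hN _)).2.1 ?_
      obtain ⟨i, hi⟩ : (1 : ℝ) ∈ Set.range (T.orderEmbOfFin hN) := by
        rw [Finset.range_orderEmbOfFin]; exact h1
      rw [← hi]
      exact (T.orderEmbOfFin hN).monotone (Fin.le_last _)
    · have a1 := (hmem _).mp (T.orderEmbOfFin_mem hN s.castSucc)
      have a2 := (hmem _).mp (T.orderEmbOfFin_mem hN s.succ)
      refine hcutfin.mem_toFinset.mpr ⟨e, he, _, _, a1.1,
        (T.orderEmbOfFin hN).strictMono Fin.castSucc_lt_succ, a2.2.1, rfl, rfl, a1.2.2, a2.2.2,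
        fun r hr1 hr2 hrC => ?_⟩
      exact hsucc s r ((hmem r).mpr ⟨a1.1.trans hr1.le, hr2.le.trans a2.2.1, hrC⟩) hr1 hr2
  · obtain ⟨e, he, s, t, -, hst, -, h1, h2, -, -, hcut⟩ := hcutfin.mem_toFinset.mp hf
    rw [Set.disjoint_left, h1, h2]
    intro z hz hz0
    obtain ⟨r, hr1, hr2, rfl⟩ := (mem_openSegment_lineMap hst).mp hz
    exact hcut r hr1 hr2 (Or.inl (Or.inl (Or.inl hz0)))

theorem exists_common_refinement (l m : Lattice D) : ∃ k : Lattice D, l ≤ k ∧ m ≤ k := by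
  obtain ⟨k, hk, -⟩ := exists_subdivides (E := (l.edges ∪ m.edges : Set (Edge D)))
    (l.edges.finite_toSet.union m.edges.finite_toSet)
    (fun e he => he.elim (l.lex_lt e) (m.lex_lt e)) Set.finite_empty
  exact ⟨k, fun e he => hk e (Or.inl he), fun e he => hk e (Or.inr he)⟩

/-- Every lattice has refinements with arbitrarily short pieces. -/
theorem exists_fine_refinement (l : Lattice D) (N : ℕ) (hN : 0 < N) : ∃ m : Lattice D, l ≤ m ∧
    ∀ e ∈ l.edges, ∀ e' ∈ pieces m e, Edge.length e'.1 ≤ Edge.length e / N := by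
  -- Division points of the edges at multiples of 1/N. No edge of the refinement has one in its
  -- interior, so no piece covers more than the fraction 1/N. The end k = N is not needed.
  set C₀ : Set (EuclideanSpace ℝ (Fin D)) := ⋃ e ∈ l.edges, ⋃ k ∈ Finset.range N,
    {AffineMap.lineMap e.1 e.2 ((k : ℝ) / N)}
  have hC₀ : C₀.Finite := l.edges.finite_toSet.biUnion fun e _ =>
    (Finset.range N).finite_toSet.biUnion fun k _ => Set.finite_singleton _
  obtain ⟨m, hm, hdis⟩ := exists_subdivides l.edges.finite_toSet l.lex_lt hC₀
  refine ⟨m, hm, fun e he e' he' => ?_⟩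
  have hN' : (0 : ℝ) < N := Nat.cast_pos.mpr hN
  have key : ∀ a b : ℝ, 0 ≤ a → a < b → b ≤ 1 → (∀ r, a < r → r < b →
      (AffineMap.lineMap e.1 e.2 r : EuclideanSpace ℝ (Fin D)) ∈ openSegment ℝ e'.1.1 e'.1.2) →
      b - a ≤ 1 / N := by
    intro a b ha hab hb h
    by_contra hcon
    push Not at hcon
    -- k/N is the first division point strictly after a; an interval longer than 1/N contains it in
    -- its interior.
    set k := ⌊a * N⌋₊ + 1
    have h1 : a * N < k := by
      have := Nat.lt_floor_add_one (a * N); push_cast [k]; exact this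
    have h2 : (k : ℝ) ≤ a * N + 1 := by
      have := Nat.floor_le (mul_nonneg ha hN'.le); push_cast [k]; linarith
    have h3 : a * N + 1 < b * N := by
      rw [div_lt_iff₀ hN'] at hcon; linarith
    have h4 : k < N := by
      have : (k : ℝ) < N := by nlinarith
      exact_mod_cast this
    refine Set.disjoint_left.mp (hdis e'.1 e'.2) (h (k / N) ?_ ?_)
      (Set.mem_iUnion₂.mpr ⟨e, he, Set.mem_iUnion₂.mpr ⟨k, Finset.mem_range.mpr h4, rfl⟩⟩)
    · rw [lt_div_iff₀ hN']; exact h1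
    · rw [div_lt_iff₀ hN']; linarith
  have hseg := mem_pieces.mp he'
  have p1 := hseg (left_mem_segment ℝ e'.1.1 e'.1.2)
  have p2 := hseg (right_mem_segment ℝ e'.1.1 e'.1.2)
  rw [Edge.seg_eq_image] at p1 p2
  obtain ⟨a, ⟨ha0, ha1⟩, ha⟩ := p1
  obtain ⟨b, ⟨hb0, hb1⟩, hb⟩ := p2
  have hab : |b - a| ≤ 1 / N := by
    rcases lt_trichotomy a b with h | h | h
    · rw [abs_of_pos (sub_pos.mpr h)]
      refine key a b ha0 h hb1 fun r hr1 hr2 => ?_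
      rw [← ha, ← hb]
      exact (mem_openSegment_lineMap h).mpr ⟨r, hr1, hr2, rfl⟩
    · rw [h, sub_self, abs_zero]; positivity
    · rw [abs_of_neg (sub_neg.mpr h), neg_sub]
      refine key b a hb0 h ha1 fun r hr1 hr2 => ?_
      rw [← ha, ← hb, openSegment_symm]
      exact (mem_openSegment_lineMap h).mpr ⟨r, hr1, hr2, rfl⟩
  rw [Edge.length, ← ha, ← hb, ← neg_sub, norm_neg, lineMap_sub_lineMap', norm_smul,
    Real.norm_eq_abs, Edge.length, ← norm_neg (e.1 - e.2), neg_sub, div_eq_mul_inv, mul_comm,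
    ← one_div]
  exact mul_le_mul_of_nonneg_left hab (norm_nonneg _)

/-- An edge of `m` is a piece of at most one edge of `l`. -/
theorem eq_of_mem_pieces {l m : Lattice D} {e₁ e₂ : Edge D} (h₁ : e₁ ∈ l.edges)
    (h₂ : e₂ ∈ l.edges) {e' : m.edges} (h₁' : e' ∈ pieces m e₁) (h₂' : e' ∈ pieces m e₂) :
    e₁ = e₂ := by
  by_contra hne
  have h0 := measure_mono_null (Set.subset_inter (mem_pieces.mp h₁') (mem_pieces.mp h₂'))
    (hausdorff_inter_eq_zero l h₁ h₂ hne)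
  have h1 := m.length_pos e'.2
  rw [hausdorff_seg, edist_eq_zero] at h0
  rw [Edge.length, h0, sub_self, norm_zero] at h1
  exact lt_irrefl _ h1

theorem overlap_comm (e e' : Edge D) : overlap e e' = overlap e' e := by
  rw [overlap, overlap, Set.inter_comm]

theorem overlap_of_mem_pieces {m : Lattice D} {e : Edge D} {e' : m.edges} (h : e' ∈ pieces m e) :
    overlap e e'.1 = Edge.length e'.1 := by
  rw [overlap, Set.inter_eq_self_of_subset_right (mem_pieces.mp h), ← overlap_self, overlap,
    Set.inter_self]

theorem overlap_of_ne (l : Lattice D) {e e' : l.edges} (h : e ≠ e') : overlap e.1 e'.1 = 0 := by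
  rw [overlap, hausdorff_inter_eq_zero l e.2 e'.2 fun h' => h (Subtype.ext h'), ENNReal.toReal_zero]

theorem sum_length_pieces {l m : Lattice D} (h : l ≤ m) {e : Edge D} (he : e ∈ l.edges) :
    ∑ e' ∈ pieces m e, Edge.length e'.1 = Edge.length e := by
  rw [← overlap_self, ← sum_overlap h he e]
  exact Finset.sum_congr rfl fun e' he' => (overlap_of_mem_pieces he').symm

theorem length_le_of_mem_pieces {l m : Lattice D} (h : l ≤ m) {e : Edge D} (he : e ∈ l.edges)
    {e' : m.edges} (he' : e' ∈ pieces m e) : Edge.length e'.1 ≤ Edge.length e := by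
  rw [← sum_length_pieces h he]
  exact Finset.single_le_sum (f := fun e' : m.edges => Edge.length e'.1)
    (fun i _ => norm_nonneg _) he'

end Refinement

/-! ### Characters of G^∞ and their momenta -/

section Characters

variable {n D : ℕ}

/-- The compatible family of momenta that restricts to `v` on `m`. -/
def extendMom (m : Lattice D) (v : m.edges × Fin n → ℝ) (l : Lattice D) : Mom n l :=
  WithLp.toLp 2 fun j =>
    ∑ e : m.edges, overlap j.1.1 e.1 / Edge.length j.1.1 * v (e, j.2)

theorem extendMom_apply (m l : Lattice D) (v : m.edges × Fin n → ℝ) (j : l.edges × Fin n) :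
    extendMom m v l j = ∑ e : m.edges, overlap j.1.1 e.1 / Edge.length j.1.1 * v (e, j.2) := rfl

theorem momMap_apply (l m : Lattice D) (v : Mom n m) (j : l.edges × Fin n) :
    momMap n l m v j =
      ∑ e' ∈ pieces m j.1.1, (Edge.length e'.1 / Edge.length j.1.1) * v (e', j.2) := rfl

theorem confMap_apply (l m : Lattice D) (q : Conf n m) (j : l.edges × Fin n) :
    confMap n l m q j = ∑ e' ∈ pieces m j.1.1, q (e', j.2) := rfl

/-- The overlap with a fixed edge is additive over pieces (`sum_overlap`), and the length of a piece
cancels against its weight. -/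
theorem momMap_extendMom {l k : Lattice D} (h : l ≤ k) (m : Lattice D)
    (v : m.edges × Fin n → ℝ) : momMap n l k (extendMom m v k) = extendMom m v l := by
  ext j
  simp only [momMap_apply, extendMom_apply, Finset.mul_sum]
  rw [Finset.sum_comm]
  refine Finset.sum_congr rfl fun e _ => ?_
  rw [overlap_comm, ← sum_overlap h j.1.2, Finset.sum_div, Finset.sum_mul]
  refine Finset.sum_congr rfl fun e' _ => ?_
  have h1 := (k.length_pos e'.2).ne'
  have h2 := (l.length_pos j.1.2).ne'
  rw [overlap_comm]
  field_simp

theorem extendMom_self (m : Lattice D) (v : m.edges × Fin n → ℝ) (j : m.edges × Fin n) :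
    extendMom m v m j = v j := by
  rw [extendMom_apply, Finset.sum_eq_single j.1]
  · rw [overlap_self, div_self (m.length_pos j.1.2).ne', one_mul]
  · intro e _ he
    rw [overlap_of_ne m he.symm, zero_div, zero_mul]
  · simp

open Classical in
/-- The coefficients on `m` that yield the same linear form in the configuration as the
coefficients `a` on the coarser lattice `l`. -/
def refineCoeff {R : Type*} [AddCommMonoid R] (l m : Lattice D) (a : l.edges × Fin n → R) :
    m.edges × Fin n → R :=
  fun j => ∑ e : l.edges, if j.1 ∈ pieces m e.1 then a (e, j.2) else 0

open Classical in
theorem refineCoeff_of_mem {R : Type*} [AddCommMonoid R] {l m : Lattice D}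
    (a : l.edges × Fin n → R) {e : l.edges} {e' : m.edges} (h : e' ∈ pieces m e.1) (i : Fin n) :
    refineCoeff l m a (e', i) = a (e, i) := by
  rw [refineCoeff, Finset.sum_eq_single e]
  · rw [if_pos h]
  · intro f _ hf
    rw [if_neg]
    exact fun h' => hf (Subtype.ext (eq_of_mem_pieces f.2 e.2 h' h))
  · simp

/-- An edge of m is a piece of at most one edge of l. Edges that are pieces of none carry the
coefficient 0, where f vanishes. -/
theorem sum_refineCoeff {R S : Type*} [AddCommMonoid R] [AddCommMonoid S] {l m : Lattice D}
    (a : l.edges × Fin n → R) (i : Fin n) (f : R → m.edges → S) (hf : ∀ e, f 0 e = 0) :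
    ∑ e', f (refineCoeff l m a (e', i)) e' =
      ∑ e : l.edges, ∑ e' ∈ pieces m e.1, f (a (e, i)) e' := by
  classical
  have h1 : ∀ e : l.edges, ∑ e' ∈ pieces m e.1, f (a (e, i)) e' =
      ∑ e', if e' ∈ pieces m e.1 then f (a (e, i)) e' else 0 := fun e => by
    rw [Finset.sum_ite_mem, Finset.univ_inter]
  simp_rw [h1]
  rw [Finset.sum_comm]
  refine Finset.sum_congr rfl fun e' _ => ?_
  by_cases h : ∃ e : l.edges, e' ∈ pieces m e.1
  · obtain ⟨e, he⟩ := h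
    rw [refineCoeff_of_mem a he, Finset.sum_eq_single e]
    · rw [if_pos he]
    · intro f _ hf
      rw [if_neg]
      exact fun h' => hf (Subtype.ext (eq_of_mem_pieces f.2 e.2 h' he))
    · simp
  · push Not at h
    have h0 : refineCoeff l m a (e', i) = 0 := Finset.sum_eq_zero fun e _ => if_neg (h e)
    rw [h0, hf]
    exact (Finset.sum_eq_zero fun e _ => if_neg (h e)).symm

theorem extendMom_refineCoeff {l m : Lattice D} (h : l ≤ m) (v : l.edges × Fin n → ℝ)
    (k : Lattice D) : extendMom m (refineCoeff l m v) k = extendMom l v k := by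
  ext j
  simp only [extendMom_apply]
  rw [sum_refineCoeff v j.2 (fun x e' => overlap j.1.1 e'.1 / Edge.length j.1.1 * x) (by simp)]
  refine Finset.sum_congr rfl fun e _ => ?_
  rw [← Finset.sum_mul, ← Finset.sum_div, sum_overlap h e.2]

theorem refineCoeff_intCast (l m : Lattice D) (a : l.edges × Fin n → ℤ) :
    (fun j => ((refineCoeff l m a j : ℤ) : ℝ)) = refineCoeff l m fun j => (a j : ℝ) := by
  classical
  ext j
  simp only [refineCoeff]
  push_cast
  rfl

/-- The character `q ↦ ∑ⱼ aⱼ qⱼ` of `G^∞`. -/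
def edgeChar (l : Lattice D) (a : l.edges × Fin n → ℤ) : ConfInf n D →+ UnitAddCircle :=
  ∑ j, a j • (Pi.evalAddMonoidHom (fun _ => UnitAddCircle) j).comp (confProj n l)

theorem edgeChar_apply (l : Lattice D) (a : l.edges × Fin n → ℤ) (q : ConfInf n D) :
    edgeChar l a q = ∑ j, a j • confProj n l q j := by
  rw [edgeChar, AddMonoidHom.finsetSum_apply]
  rfl

theorem edgeChar_add (l : Lattice D) (a b : l.edges × Fin n → ℤ) :
    edgeChar l (a + b) = edgeChar l a + edgeChar l b := by
  ext q
  rw [AddMonoidHom.add_apply, edgeChar_apply, edgeChar_apply, edgeChar_apply,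
    ← Finset.sum_add_distrib]
  exact Finset.sum_congr rfl fun j _ => add_smul _ _ _

theorem edgeChar_neg (l : Lattice D) (a : l.edges × Fin n → ℤ) :
    edgeChar l (-a) = -edgeChar l a := by
  ext q
  rw [AddMonoidHom.neg_apply, edgeChar_apply, edgeChar_apply, ← Finset.sum_neg_distrib]
  exact Finset.sum_congr rfl fun j _ => neg_smul _ _

theorem extendMom_add (m : Lattice D) (v w : m.edges × Fin n → ℝ) (l : Lattice D) :
    extendMom m (v + w) l = extendMom m v l + extendMom m w l := by
  ext j
  simp only [extendMom_apply, PiLp.add_apply, Pi.add_apply, mul_add, Finset.sum_add_distrib]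

theorem extendMom_neg (m : Lattice D) (v : m.edges × Fin n → ℝ) (l : Lattice D) :
    extendMom m (-v) l = -extendMom m v l := by
  ext j
  simp only [extendMom_apply, PiLp.neg_apply, Pi.neg_apply, mul_neg, Finset.sum_neg_distrib]

theorem confProj_eq (l m : Lattice D) (h : l ≤ m) (q : ConfInf n D) :
    confMap n l m (confProj n m q) = confProj n l q := q.2 l m h

theorem edgeChar_refineCoeff {l m : Lattice D} (h : l ≤ m) (a : l.edges × Fin n → ℤ) :
    edgeChar m (refineCoeff l m a) = edgeChar l a := by
  ext q
  rw [edgeChar_apply, edgeChar_apply, Fintype.sum_prod_type_right, Fintype.sum_prod_type_right]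
  refine Finset.sum_congr rfl fun i _ => ?_
  rw [sum_refineCoeff a i (fun x e' => x • confProj n m q (e', i)) (by simp)]
  refine Finset.sum_congr rfl fun e _ => ?_
  rw [← Finset.smul_sum, ← confProj_eq l m h q, confMap_apply]

/-- The momenta belonging to the character `edgeChar l a`. -/
def edgePair (l : Lattice D) (a : l.edges × Fin n → ℤ) :
    (ConfInf n D →+ UnitAddCircle) × (∀ m : Lattice D, Mom n m) :=
  (edgeChar l a, extendMom l fun j => (a j : ℝ))

theorem edgePair_refineCoeff {l m : Lattice D} (h : l ≤ m) (a : l.edges × Fin n → ℤ) :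
    edgePair m (refineCoeff l m a) = edgePair l a := by
  refine Prod.ext (edgeChar_refineCoeff h a) (funext fun k => ?_)
  change extendMom m (fun j => ((refineCoeff l m a j : ℤ) : ℝ)) k = _
  rw [refineCoeff_intCast, extendMom_refineCoeff h]
  rfl

theorem edgePair_add (l : Lattice D) (a b : l.edges × Fin n → ℤ) :
    edgePair l (a + b) = edgePair l a + edgePair l b := by
  refine Prod.ext (edgeChar_add l a b) (funext fun k => ?_)
  refine Eq.trans ?_ (extendMom_add l _ _ k)
  simp only [edgePair]
  congr 1
  ext j
  simp

theorem edgePair_neg (l : Lattice D) (a : l.edges × Fin n → ℤ) :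
    edgePair l (-a) = -edgePair l a := by
  refine Prod.ext (edgeChar_neg l a) (funext fun k => ?_)
  refine Eq.trans ?_ (extendMom_neg l _ k)
  simp only [edgePair]
  congr 1
  ext j
  simp

/-- The empty lattice. -/
def emptyLattice (D : ℕ) : Lattice D where
  edges := ∅
  lex_lt := by simp
  disjoint := by simp

/-- The character group of `G^∞`, each character together with its momenta. -/
def CharGroup (n D : ℕ) :
    AddSubgroup ((ConfInf n D →+ UnitAddCircle) × (∀ m : Lattice D, Mom n m)) where
  carrier := {x | ∃ (l : Lattice D) (a : l.edges × Fin n → ℤ), x = edgePair l a}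
  zero_mem' := ⟨emptyLattice D, 0, by
    have := edgePair_add (emptyLattice D) (0 : _ × Fin n → ℤ) 0
    rw [add_zero] at this
    exact (left_eq_add.mp this).symm⟩
  add_mem' := by
    rintro _ _ ⟨l, a, rfl⟩ ⟨m, b, rfl⟩
    obtain ⟨k, hl, hm⟩ := exists_common_refinement l m
    exact ⟨k, refineCoeff l k a + refineCoeff m k b, by
      rw [edgePair_add, edgePair_refineCoeff hl, edgePair_refineCoeff hm]⟩
  neg_mem' := by
    rintro _ ⟨l, a, rfl⟩
    exact ⟨l, -a, (edgePair_neg l a).symm⟩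

/-- The element of the character group given by the coefficients `a` on `l`. -/
def charOf (l : Lattice D) (a : l.edges × Fin n → ℤ) : CharGroup n D := ⟨edgePair l a, l, a, rfl⟩

theorem charOf_add (l : Lattice D) (a b : l.edges × Fin n → ℤ) :
    charOf l (a + b) = charOf l a + charOf l b := Subtype.ext (edgePair_add l a b)

theorem charOf_zero (l : Lattice D) : charOf l (0 : l.edges × Fin n → ℤ) = 0 := by
  have := charOf_add l (0 : _ × Fin n → ℤ) 0
  rw [add_zero] at this
  exact left_eq_add.mp this

theorem charOf_refineCoeff {l m : Lattice D} (h : l ≤ m) (a : l.edges × Fin n → ℤ) :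
    charOf m (refineCoeff l m a) = charOf l a := Subtype.ext (edgePair_refineCoeff h a)

theorem exists_charOf (χ : CharGroup n D) : ∃ (l : Lattice D) (a : l.edges × Fin n → ℤ),
    χ = charOf l a := by
  obtain ⟨l, a, h⟩ := χ.2
  exact ⟨l, a, Subtype.ext h⟩

/-- Any two characters come from a lattice that refines a given one. -/
theorem exists_charOf₂ (k : Lattice D) (χ χ' : CharGroup n D) :
    ∃ (l : Lattice D) (a a' : l.edges × Fin n → ℤ), k ≤ l ∧ χ = charOf l a ∧ χ' = charOf l a' := by
  obtain ⟨l, a, rfl⟩ := exists_charOf χ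
  obtain ⟨l', a', rfl⟩ := exists_charOf χ'
  obtain ⟨m, hm, -⟩ := exists_subdivides
    (E := (k.edges ∪ l.edges ∪ l'.edges : Set (Edge D)))
    ((k.edges.finite_toSet.union l.edges.finite_toSet).union l'.edges.finite_toSet)
    (fun e he => he.elim (fun he => he.elim (k.lex_lt e) (l.lex_lt e)) (l'.lex_lt e))
    Set.finite_empty
  have h1 : k ≤ m := fun e he => hm e (Or.inl (Or.inl he))
  have h2 : l ≤ m := fun e he => hm e (Or.inl (Or.inr he))
  have h3 : l' ≤ m := fun e he => hm e (Or.inr he)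
  exact ⟨m, refineCoeff l m a, refineCoeff l' m a', h1, (charOf_refineCoeff h2 a).symm,
    (charOf_refineCoeff h3 a').symm⟩

/-- The momentum of a character on a lattice. -/
def charMom (l : Lattice D) : CharGroup n D →+ Mom n l where
  toFun χ := χ.1.2 l
  map_zero' := rfl
  map_add' _ _ := rfl

theorem charMom_charOf_self (l : Lattice D) (a : l.edges × Fin n → ℤ) (j : l.edges × Fin n) :
    charMom l (charOf l a) j = a j :=
  extendMom_self l (fun j => (a j : ℝ)) j

theorem momMap_charMom {l m : Lattice D} (h : l ≤ m) (χ : CharGroup n D) :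
    momMap n l m (charMom m χ) = charMom l χ := by
  obtain ⟨k, a, rfl⟩ := exists_charOf χ
  exact momMap_extendMom h k fun j => (a j : ℝ)

theorem momMap_smul (l m : Lattice D) (t : ℝ) (v : Mom n m) :
    momMap n l m (t • v) = t • momMap n l m v := by
  ext j
  simp only [momMap_apply, PiLp.smul_apply, smul_eq_mul, Finset.mul_sum]
  exact Finset.sum_congr rfl fun e _ => by ring

theorem momMap_add (l m : Lattice D) (v w : Mom n m) :
    momMap n l m (v + w) = momMap n l m v + momMap n l m w := by
  ext j
  simp only [momMap_apply, PiLp.add_apply, mul_add, Finset.sum_add_distrib]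

/-- The connecting map of the momenta as a continuous linear map. -/
def momMapL (n : ℕ) (l m : Lattice D) : Mom n m →L[ℝ] Mom n l where
  toFun := momMap n l m
  map_add' := momMap_add l m
  map_smul' t v := momMap_smul l m t v
  cont := continuous_momMap n l m

/-- The point of the continuum phase space with configuration `q` and momentum `t` times that of
the character `χ`. -/
def phasePoint (q : ConfInf n D) (t : ℝ) (χ : CharGroup n D) : PhaseInf n D :=
  ⟨fun l => (confProj n l q, t • charMom l χ), fun l m h => Prod.ext (confProj_eq l m h q) (by
    change momMap n l m (t • charMom m χ) = t • charMom l χ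
    rw [momMap_smul, momMap_charMom h])⟩

theorem phaseProj_phasePoint (l : Lattice D) (q : ConfInf n D) (t : ℝ) (χ : CharGroup n D) :
    phaseProj n l (phasePoint q t χ) = (confProj n l q, t • charMom l χ) := rfl

theorem continuous_phasePoint (t : ℝ) (χ : CharGroup n D) :
    Continuous fun q : ConfInf n D => phasePoint q t χ :=
  Continuous.subtype_mk (continuous_pi fun l => (continuous_confProj n l).prodMk continuous_const) _

/-- Every point of the phase space of a lattice extends to the continuum. -/
theorem phaseProj_surjective (n : ℕ) (l : Lattice D) : Function.Surjective (phaseProj n l) := by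
  rintro ⟨q, p⟩
  obtain ⟨q', rfl⟩ := confProj_surjective n l q
  refine ⟨⟨fun m => (confProj n m q', extendMom l p m), fun k m h =>
    Prod.ext (confProj_eq k m h q') (momMap_extendMom h l _)⟩, ?_⟩
  refine Prod.ext rfl ?_
  ext j
  exact extendMom_self l _ j

theorem phaseMap_phaseProj {l m : Lattice D} (h : l ≤ m) (x : PhaseInf n D) :
    phaseMap n l m (phaseProj n m x) = phaseProj n l x := x.2 l m h

/-- Refine until each piece has at most the fraction 1/N of its edge, and select one piece of each
edge, of weight w. The integer round(p/w) on it and 0 on the other pieces average to w · round(p/w),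
which differs from p by at most w/2. -/
theorem exists_charMom_sub_le (l : Lattice D) (p : Mom n l) (N : ℕ) (hN : 0 < N) :
    ∃ χ : CharGroup n D, ∀ j, |charMom l χ j - p j| ≤ 1 / N := by
  classical
  obtain ⟨m, h, hm⟩ := exists_fine_refinement l N hN
  have hne : ∀ e : l.edges, (pieces m e.1).Nonempty := by
    intro e
    by_contra hcon
    have h1 := sum_length_pieces h e.2
    rw [Finset.not_nonempty_iff_eq_empty.mp hcon, Finset.sum_empty] at h1
    exact (l.length_pos e.2).ne h1
  choose c hc using hne
  set w : l.edges → ℝ := fun e => Edge.length (c e).1 / Edge.length e.1 with hw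
  have hw0 : ∀ e, 0 < w e := fun e => div_pos (m.length_pos (c e).2) (l.length_pos e.2)
  have hwN : ∀ e, w e ≤ 1 / N := fun e => by
    rw [hw]
    have h1 := hm e.1 e.2 (c e) (hc e)
    have h2 := l.length_pos e.2
    rw [div_le_iff₀ h2]
    calc _ ≤ _ := h1
      _ = _ := by ring
  set a : m.edges × Fin n → ℤ := fun j =>
    ∑ e : l.edges, if c e = j.1 then round (p (e, j.2) / w e) else 0 with ha
  refine ⟨charOf m a, fun j => ?_⟩
  rw [← momMap_charMom h, momMap_apply]
  have h1 : ∑ e' ∈ pieces m j.1.1, (Edge.length e'.1 / Edge.length j.1.1) *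
      charMom m (charOf m a) (e', j.2) = w j.1 * round (p j / w j.1) := by
    rw [Finset.sum_eq_single (c j.1)]
    · rw [charMom_charOf_self, ha]
      congr 2
      refine (Finset.sum_eq_single j.1 (fun e _ he => if_neg fun hce => he ?_) (by simp)).trans
        (if_pos rfl)
      exact Subtype.ext (eq_of_mem_pieces e.2 j.1.2 ((show c e = c j.1 from hce) ▸ hc e) (hc j.1))
    · intro e' he' hne
      rw [charMom_charOf_self, ha]
      have : ∑ e : l.edges, (if c e = e' then round (p (e, j.2) / w e) else 0) = 0 := by
        refine Finset.sum_eq_zero fun e _ => if_neg fun hce => hne ?_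
        have : e = j.1 := Subtype.ext (eq_of_mem_pieces e.2 j.1.2 (hc e) (hce ▸ he'))
        rw [← hce, this]
      beta_reduce
      rw [this, Int.cast_zero, mul_zero]
    · exact fun h' => absurd (hc j.1) h'
  rw [h1]
  have h2 := abs_sub_round (p j / w j.1)
  have h3 : w j.1 * round (p j / w j.1) - p j = -(w j.1 * (p j / w j.1 - round (p j / w j.1))) := by
    have := (hw0 j.1).ne'
    field_simp
    ring
  rw [h3, abs_neg, abs_mul, abs_of_pos (hw0 j.1)]
  have := hwN j.1
  have := hw0 j.1
  nlinarith [abs_nonneg (p j / w j.1 - round (p j / w j.1))]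

/-- On a single lattice the integral momenta form a discrete grid. Density holds because characters
may live on arbitrarily fine lattices, and it is what makes the continuum quantization faithful and
its norms computable. -/
theorem denseRange_charMom (n : ℕ) (l : Lattice D) :
    DenseRange (charMom l : CharGroup n D → Mom n l) := by
  intro p
  choose χ hχ using fun N : ℕ => exists_charMom_sub_le l p (N + 1) N.succ_pos
  refine mem_closure_of_tendsto (f := fun N : ℕ => charMom l (χ N)) (b := atTop) ?_
    (Eventually.of_forall fun N => Set.mem_range_self _)
  have h1 : Tendsto (fun N : ℕ => (charMom l (χ N)).ofLp) atTop (𝓝 p.ofLp) := by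
    refine tendsto_pi_nhds.mpr fun j => ?_
    rw [tendsto_iff_norm_sub_tendsto_zero]
    refine squeeze_zero (fun _ => norm_nonneg _) (fun N => hχ N j) ?_
    have h2 := tendsto_one_div_add_atTop_nhds_zero_nat (𝕜 := ℝ)
    simpa using h2
  exact ((PiLp.continuous_toLp 2 _).tendsto _).comp h1

end Characters

/-! ### The basis of characters -/

section Basis

variable {n D : ℕ}

theorem toCircle_zsmul_coe (k : ℤ) (x : UnitAddCircle) :
    ((AddCircle.toCircle (k • x) : Circle) : ℂ) = fourier k x := (fourier_apply).symm

theorem toCircle_sum {ι : Type*} (s : Finset ι) (f : ι → UnitAddCircle) :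
    ((AddCircle.toCircle (∑ j ∈ s, f j) : Circle) : ℂ) =
      ∏ j ∈ s, ((AddCircle.toCircle (f j) : Circle) : ℂ) := by
  classical
  induction s using Finset.induction_on with
  | empty => simp
  | insert i s hi ih =>
    rw [Finset.sum_insert hi, Finset.prod_insert hi, AddCircle.toCircle_add, Circle.coe_mul, ih]

theorem toCircle_edgeChar (l : Lattice D) (a : l.edges × Fin n → ℤ) (q : ConfInf n D) :
    ((AddCircle.toCircle (edgeChar l a q) : Circle) : ℂ) =
      UnitAddTorus.mFourier a (confProj n l q) := by
  rw [edgeChar_apply, toCircle_sum]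
  simp only [toCircle_zsmul_coe]
  rfl

/-- The character `χ` as a complex-valued function on `G^∞`. -/
def charFun (χ : CharGroup n D) : C(ConfInf n D, ℂ) where
  toFun q := (AddCircle.toCircle (χ.1.1 q) : Circle)
  continuous_toFun := by
    obtain ⟨l, a, rfl⟩ := exists_charOf χ
    have : (fun q : ConfInf n D => ((AddCircle.toCircle ((charOf l a).1.1 q) : Circle) : ℂ)) =
        fun q => UnitAddTorus.mFourier a (confProj n l q) := funext fun q => toCircle_edgeChar l a q
    rw [this]
    exact (UnitAddTorus.mFourier a).continuous.comp (continuous_confProj n l)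

theorem charFun_charOf (l : Lattice D) (a : l.edges × Fin n → ℤ) (q : ConfInf n D) :
    charFun (charOf l a) q = UnitAddTorus.mFourier a (confProj n l q) := toCircle_edgeChar l a q

theorem charFun_add (χ χ' : CharGroup n D) (q : ConfInf n D) :
    charFun (χ + χ') q = charFun χ q * charFun χ' q := by
  change ((AddCircle.toCircle (χ.1.1 q + χ'.1.1 q) : Circle) : ℂ) = _
  rw [AddCircle.toCircle_add, Circle.coe_mul]
  rfl

theorem charFun_neg (χ : CharGroup n D) (q : ConfInf n D) :
    charFun (-χ) q = (starRingEnd ℂ) (charFun χ q) := by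
  change ((AddCircle.toCircle (-χ.1.1 q) : Circle) : ℂ) = _
  rw [AddCircle.toCircle_neg]
  exact Circle.coe_inv_eq_conj _

instance : IsProbabilityMeasure (confInfHaar n D) :=
  ⟨Measure.addHaarMeasure_self (K₀ := ⊤)⟩

instance (l : Lattice D) : IsProbabilityMeasure (confHaar n l) := by
  unfold confHaar; infer_instance

/-- The Fourier basis of `ℋ^l`. -/
def latticeBasis (n : ℕ) (l : Lattice D) :
    HilbertBasis (l.edges × Fin n → ℤ) ℂ (LatticeHilbert n l) := UnitAddTorus.mFourierBasis

theorem latticeBasis_apply (l : Lattice D) (a : l.edges × Fin n → ℤ) :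
    latticeBasis n l a = ContinuousMap.toLp 2 (confHaar n l) ℂ (UnitAddTorus.mFourier a) :=
  congrFun UnitAddTorus.coe_mFourierBasis a

theorem coeFn_latticeBasis (l : Lattice D) (a : l.edges × Fin n → ℤ) :
    (latticeBasis n l a : Conf n l → ℂ) =ᵐ[confHaar n l] UnitAddTorus.mFourier a := by
  rw [latticeBasis_apply]
  exact ContinuousMap.coeFn_toLp _ _

theorem coeFn_pullback (l : Lattice D) (ψ : LatticeHilbert n l) :
    (pullback n l ψ : ConfInf n D → ℂ) =ᵐ[confInfHaar n D] fun q => ψ (confProj n l q) :=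
  Lp.coeFn_compMeasurePreserving ψ (measurePreserving_confProj n l)

theorem pullback_latticeBasis (l : Lattice D) (a : l.edges × Fin n → ℤ) :
    pullback n l (latticeBasis n l a) =
      ContinuousMap.toLp 2 (confInfHaar n D) ℂ (charFun (charOf l a)) := by
  refine Lp.ext ((coeFn_pullback l _).trans ?_)
  refine EventuallyEq.trans ?_ (ContinuousMap.coeFn_toLp (𝕜 := ℂ) (confInfHaar n D) _).symm
  have h1 := (measurePreserving_confProj (D := D) n l).quasiMeasurePreserving.ae_eq_comp
    (coeFn_latticeBasis l a)
  filter_upwards [h1] with q hq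
  rw [charFun_charOf]
  exact hq

/-- The character `χ` as an element of `ℋ^∞`. -/
def charVec (χ : CharGroup n D) : HilbertInf n D :=
  ⟨ContinuousMap.toLp 2 (confInfHaar n D) ℂ (charFun χ), by
    obtain ⟨l, a, rfl⟩ := exists_charOf χ
    rw [← pullback_latticeBasis]
    exact (hilbertEmb n l (latticeBasis n l a)).2⟩

theorem hilbertEmb_latticeBasis (l : Lattice D) (a : l.edges × Fin n → ℤ) :
    hilbertEmb n l (latticeBasis n l a) = charVec (charOf l a) :=
  Subtype.ext (pullback_latticeBasis l a)

/-- Two characters live on a common lattice, where they are Fourier modes, and the embedding is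
isometric. The momentum on that lattice recovers the coefficients, so distinct coefficients give
distinct characters. -/
theorem orthonormal_charVec : Orthonormal ℂ (charVec : CharGroup n D → HilbertInf n D) := by
  classical
  rw [orthonormal_iff_ite]
  intro χ χ'
  obtain ⟨l, a, a', -, rfl, rfl⟩ := exists_charOf₂ (emptyLattice D) χ χ'
  rw [← hilbertEmb_latticeBasis, ← hilbertEmb_latticeBasis, LinearIsometry.inner_map_map,
    orthonormal_iff_ite.mp (latticeBasis n l).orthonormal]
  refine if_congr ⟨fun h => by rw [h], fun h => ?_⟩ rfl rfl
  ext j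
  have := congrArg (fun χ => charMom l χ j) h
  simp only [charMom_charOf_self] at this
  exact_mod_cast this

theorem dense_iSup_range_hilbertEmb (v : HilbertInf n D)
    (h : ∀ (l : Lattice D) (ψ : LatticeHilbert n l), inner ℂ v (hilbertEmb n l ψ) = 0) :
    v = 0 := by
  have h1 : (v.1 : Lp ℂ 2 (confInfHaar n D)) ∈ (hilbertSubspace n D)ᗮ := by
    unfold hilbertSubspace
    rw [Submodule.orthogonal_closure, Submodule.mem_orthogonal']
    intro u hu
    have h2 : (⨆ l : Lattice D, LinearMap.range (pullback n l).toLinearMap) ≤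
        LinearMap.ker (innerSL ℂ v.1).toLinearMap := by
      refine iSup_le fun l => ?_
      rintro _ ⟨ψ, rfl⟩
      exact h l ψ
    exact h2 hu
  have h2 := Submodule.inner_right_of_mem_orthogonal v.2 h1
  exact Subtype.ext (inner_self_eq_zero.mp h2)

theorem eq_zero_of_inner_charVec (v : HilbertInf n D)
    (h : ∀ χ : CharGroup n D, inner ℂ v (charVec χ) = 0) : v = 0 := by
  refine dense_iSup_range_hilbertEmb v fun l ψ => ?_
  have h1 : (innerSL ℂ v) ∘L (hilbertEmb n l).toContinuousLinearMap = 0 := by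
    refine HilbertBasis.ext_clm (latticeBasis n l) fun a => ?_
    simp only [ContinuousLinearMap.comp_apply, LinearIsometry.coe_toContinuousLinearMap,
      innerSL_apply_apply, zero_apply]
    rw [hilbertEmb_latticeBasis, h]
  exact congrArg (fun T => T ψ) h1

/-- The basis of `ℋ^∞` that consists of the characters of `G^∞`. -/
def charBasis (n D : ℕ) : HilbertBasis (CharGroup n D) ℂ (HilbertInf n D) :=
  HilbertBasis.mkOfOrthogonalEqBot orthonormal_charVec (by
    rw [Submodule.eq_bot_iff]
    intro v hv
    refine eq_zero_of_inner_charVec v fun χ => ?_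
    exact Submodule.inner_left_of_mem_orthogonal (Submodule.subset_span (Set.mem_range_self χ)) hv)

theorem charBasis_apply (χ : CharGroup n D) : charBasis n D χ = charVec χ :=
  congrFun (HilbertBasis.coe_mkOfOrthogonalEqBot _ _) χ

theorem hilbertEmb_latticeBasis' (l : Lattice D) (a : l.edges × Fin n → ℤ) :
    hilbertEmb n l (latticeBasis n l a) = charBasis n D (charOf l a) := by
  rw [charBasis_apply, hilbertEmb_latticeBasis]

theorem integral_charFun (χ : CharGroup n D) [Decidable (χ = 0)] :
    ∫ q, charFun χ q ∂(confInfHaar n D) = if χ = 0 then 1 else 0 := by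
  classical
  have h := orthonormal_iff_ite.mp orthonormal_charVec (0 : CharGroup n D) χ
  have h1 : inner ℂ (charVec (0 : CharGroup n D)) (charVec χ) =
      inner ℂ (ContinuousMap.toLp 2 (confInfHaar n D) ℂ (charFun 0))
        (ContinuousMap.toLp 2 (confInfHaar n D) ℂ (charFun χ)) := rfl
  rw [h1, ContinuousMap.inner_toLp] at h
  have h2 : ∀ q : ConfInf n D, charFun χ q * (starRingEnd ℂ) (charFun 0 q) = charFun χ q := by
    intro q
    rw [← charFun_neg, ← charFun_add, neg_zero, add_zero]
  simp_rw [h2] at h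
  rw [h]
  exact if_congr eq_comm rfl rfl

end Basis

/-! ### Trigonometric sums and cylinder functions -/

section TrigSum

variable {n D : ℕ} {l : Lattice D}

/-- The function `∑ᵢ e_{bᵢ} ⊗ hᵢ` on the phase space of a lattice. -/
def trigSum {ι : Type} [Fintype ι] (b : ι → l.edges × Fin n → ℤ) (h : ι → Mom n l → ℂ)
    (x : Phase n l) : ℂ := ∑ i, UnitAddTorus.mFourier (b i) x.1 * h i x.2

theorem norm_mFourier_apply {d : Type*} [Fintype d] (b : d → ℤ) (q : UnitAddTorus d) :
    ‖UnitAddTorus.mFourier b q‖ = 1 := by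
  simp only [UnitAddTorus.mFourier, ContinuousMap.coe_mk, fourier_apply, norm_prod,
    Circle.norm_coe, Finset.prod_const_one]

theorem exists_eq_mFourier_mul (b : l.edges × Fin n → ℤ) {h : Mom n l → ℂ} (H : IsWave h) :
    ∃ f ∈ latticeAlgebra n l, ∀ x : Phase n l, f x = UnitAddTorus.mFourier b x.1 * h x.2 := by
  obtain ⟨C, hC⟩ := H.exists_bound
  let f : BoundedContinuousFunction (Phase n l) ℂ := BoundedContinuousFunction.ofNormedAddCommGroup
    (fun x => UnitAddTorus.mFourier b x.1 * h x.2)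
    (((UnitAddTorus.mFourier b).continuous.comp continuous_fst).mul
      (H.continuous.comp continuous_snd)) C (fun x => by
      rw [norm_mul, norm_mFourier_apply, one_mul]
      exact hC _)
  refine ⟨f, Submodule.subset_span ?_, fun x => rfl⟩
  obtain ⟨U, g, ξ, hg, hh⟩ := H
  exact ⟨b, U, g, ξ, hg, fun q p => by rw [← hh p]; rfl⟩

theorem exists_eq_trigSum_mem {ι : Type} [Fintype ι] (b : ι → l.edges × Fin n → ℤ)
    {h : ι → Mom n l → ℂ} (H : ∀ i, IsWave (h i)) :
    ∃ f ∈ latticeAlgebra n l, ∀ x, f x = trigSum b h x := by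
  choose f hf hfx using fun i => exists_eq_mFourier_mul (b i) (H i)
  refine ⟨∑ i, f i, Submodule.sum_mem _ fun i _ => hf i, fun x => ?_⟩
  rw [BoundedContinuousFunction.sum_apply, trigSum]
  exact Finset.sum_congr rfl fun i _ => hfx i x

theorem mem_latticeAlgebra_of_trigSum {ι : Type} [Fintype ι] (b : ι → l.edges × Fin n → ℤ)
    {h : ι → Mom n l → ℂ} (H : ∀ i, IsWave (h i)) {f : BoundedContinuousFunction (Phase n l) ℂ}
    (hf : ∀ x, f x = trigSum b h x) : f ∈ latticeAlgebra n l := by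
  obtain ⟨g, hg, hgx⟩ := exists_eq_trigSum_mem b H
  rwa [show f = g from BoundedContinuousFunction.ext fun x => (hf x).trans (hgx x).symm]

theorem exists_trigSum_of_mem {f : BoundedContinuousFunction (Phase n l) ℂ}
    (hf : f ∈ latticeAlgebra n l) : ∃ (ι : Type) (_ : Fintype ι) (b : ι → l.edges × Fin n → ℤ)
      (h : ι → Mom n l → ℂ), (∀ i, IsWave (h i)) ∧ ∀ x, f x = trigSum b h x := by
  obtain ⟨K, c, g, rfl⟩ := Submodule.mem_span_set'.mp hf
  choose b U s ξ hs hg using fun i => (g i).2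
  refine ⟨Fin K, inferInstance, b, fun i p => c i * (Complex.exp (Complex.I * (inner ℝ (ξ i) p : ℝ)) *
    s i ((U i).orthogonalProjectionOnto p)), fun i => ?_, fun x => ?_⟩
  · exact IsWave.const_mul ⟨U i, s i, ξ i, hs i, fun p => rfl⟩ (c i)
  · rw [BoundedContinuousFunction.sum_apply, trigSum]
    refine Finset.sum_congr rfl fun i _ => ?_
    rw [BoundedContinuousFunction.smul_apply, hg i x.1 x.2, smul_eq_mul]
    ring

theorem trigSum_mul {ι ι' : Type} [Fintype ι] [Fintype ι'] (b : ι → l.edges × Fin n → ℤ)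
    (h : ι → Mom n l → ℂ) (b' : ι' → l.edges × Fin n → ℤ) (h' : ι' → Mom n l → ℂ) (x : Phase n l) :
    trigSum b h x * trigSum b' h' x =
      trigSum (fun i : ι × ι' => b i.1 + b' i.2) (fun i p => h i.1 p * h' i.2 p) x := by
  simp only [trigSum]
  rw [Finset.sum_mul_sum, Fintype.sum_prod_type]
  refine Finset.sum_congr rfl fun i _ => Finset.sum_congr rfl fun j _ => ?_
  rw [UnitAddTorus.mFourier_add]
  ring

theorem conj_trigSum {ι : Type} [Fintype ι] (b : ι → l.edges × Fin n → ℤ)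
    (h : ι → Mom n l → ℂ) (x : Phase n l) :
    (starRingEnd ℂ) (trigSum b h x) =
      trigSum (fun i => -b i) (fun i p => (starRingEnd ℂ) (h i p)) x := by
  simp only [trigSum, map_sum, map_mul, UnitAddTorus.mFourier_neg]

/-- Every configuration on m extends to the continuum, where both sides are values of the same
character. -/
theorem mFourier_confMap {l m : Lattice D} (hlm : l ≤ m) (b : l.edges × Fin n → ℤ)
    (q : Conf n m) : UnitAddTorus.mFourier b (confMap n l m q) =
      UnitAddTorus.mFourier (refineCoeff l m b) q := by
  obtain ⟨q, rfl⟩ := confProj_surjective n m q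
  rw [confProj_eq l m hlm, ← charFun_charOf, ← charFun_charOf, charOf_refineCoeff hlm]

theorem trigSum_phaseMap {l m : Lattice D} (hlm : l ≤ m) {ι : Type} [Fintype ι]
    (b : ι → l.edges × Fin n → ℤ) (h : ι → Mom n l → ℂ) (x : Phase n m) :
    trigSum b h (phaseMap n l m x) =
      trigSum (fun i => refineCoeff l m (b i)) (fun i p => h i (momMapL n l m p)) x := by
  simp only [trigSum]
  refine Finset.sum_congr rfl fun i _ => ?_
  rw [← mFourier_confMap hlm]
  rfl

theorem compContinuous_phaseMap_mem {l m : Lattice D} (hlm : l ≤ m)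
    {f : BoundedContinuousFunction (Phase n l) ℂ} (hf : f ∈ latticeAlgebra n l) :
    f.compContinuous (phaseMap n l m) ∈ latticeAlgebra n m := by
  obtain ⟨ι, _, b, h, H, hfx⟩ := exists_trigSum_of_mem hf
  exact mem_latticeAlgebra_of_trigSum _ (fun i => (H i).comp_linear (momMapL n l m)) fun x =>
    (hfx _).trans (trigSum_phaseMap hlm b h x)

theorem compContinuous_phaseProj_eq {l m : Lattice D} (hlm : l ≤ m)
    (f : BoundedContinuousFunction (Phase n l) ℂ) :
    (f.compContinuous (phaseMap n l m)).compContinuous (phaseProj n m) =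
      f.compContinuous (phaseProj n l) :=
  BoundedContinuousFunction.ext fun x => congrArg f (phaseMap_phaseProj hlm x)

theorem mul_mem_latticeAlgebra {f g : BoundedContinuousFunction (Phase n l) ℂ}
    (hf : f ∈ latticeAlgebra n l) (hg : g ∈ latticeAlgebra n l) : f * g ∈ latticeAlgebra n l := by
  obtain ⟨ι, _, b, h, H, hfx⟩ := exists_trigSum_of_mem hf
  obtain ⟨ι', _, b', h', H', hgx⟩ := exists_trigSum_of_mem hg
  exact mem_latticeAlgebra_of_trigSum _ (fun i : ι × ι' => (H i.1).mul (H' i.2)) fun x => by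
    rw [BoundedContinuousFunction.mul_apply, hfx, hgx, trigSum_mul]

theorem star_mem_latticeAlgebra {f : BoundedContinuousFunction (Phase n l) ℂ}
    (hf : f ∈ latticeAlgebra n l) : star f ∈ latticeAlgebra n l := by
  obtain ⟨ι, _, b, h, H, hfx⟩ := exists_trigSum_of_mem hf
  exact mem_latticeAlgebra_of_trigSum _ (fun i => (H i).conj) fun x => by
    rw [BoundedContinuousFunction.star_apply, hfx, ← starRingEnd_apply, conj_trigSum]

theorem algebraMap_mem_latticeAlgebra (c : ℂ) :
    algebraMap ℂ (BoundedContinuousFunction (Phase n l) ℂ) c ∈ latticeAlgebra n l :=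
  mem_latticeAlgebra_of_trigSum (fun _ : Unit => 0) (h := fun _ _ => c * 1)
    (fun _ => isWave_one.const_mul c) fun x => by
    simp [trigSum, UnitAddTorus.mFourier_zero]

/-- The functions on the continuum that factor through some lattice form a *-algebra. -/
def cylinderAlgebra (n D : ℕ) :
    StarSubalgebra ℂ (BoundedContinuousFunction (PhaseInf n D) ℂ) where
  carrier := {F | ∃ l : Lattice D, ∃ f ∈ latticeAlgebra n l,
    F = f.compContinuous (phaseProj n l)}
  mul_mem' := by
    rintro _ _ ⟨l, f, hf, rfl⟩ ⟨m, g, hg, rfl⟩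
    obtain ⟨k, hl, hm⟩ := exists_common_refinement l m
    refine ⟨k, _, mul_mem_latticeAlgebra (compContinuous_phaseMap_mem hl hf)
      (compContinuous_phaseMap_mem hm hg), ?_⟩
    rw [← compContinuous_phaseProj_eq hl, ← compContinuous_phaseProj_eq hm]
    rfl
  add_mem' := by
    rintro _ _ ⟨l, f, hf, rfl⟩ ⟨m, g, hg, rfl⟩
    obtain ⟨k, hl, hm⟩ := exists_common_refinement l m
    refine ⟨k, _, Submodule.add_mem _ (compContinuous_phaseMap_mem hl hf)
      (compContinuous_phaseMap_mem hm hg), ?_⟩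
    rw [← compContinuous_phaseProj_eq hl, ← compContinuous_phaseProj_eq hm]
    rfl
  algebraMap_mem' c := ⟨emptyLattice D, _, algebraMap_mem_latticeAlgebra c, rfl⟩
  star_mem' := by
    rintro _ ⟨l, f, hf, rfl⟩
    exact ⟨l, _, star_mem_latticeAlgebra hf, rfl⟩

/-- The generating functions are already closed under all operations, since two of them can be
pulled back to a common refinement. -/
theorem classicalAlgebra_eq (n D : ℕ) : classicalAlgebra n D = cylinderAlgebra n D :=
  le_antisymm (StarAlgebra.adjoin_le fun _ hF => hF) fun _ hF => StarAlgebra.subset_adjoin ℂ _ hF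

theorem exists_rep (F : classicalAlgebra n D) : ∃ l : Lattice D, ∃ f ∈ latticeAlgebra n l,
    F.1 = f.compContinuous (phaseProj n l) := (classicalAlgebra_eq n D).le F.2

theorem exists_rep_of_le (F : classicalAlgebra n D) {l m : Lattice D} (hlm : l ≤ m)
    (h : ∃ f ∈ latticeAlgebra n l, F.1 = f.compContinuous (phaseProj n l)) :
    ∃ f ∈ latticeAlgebra n m, F.1 = f.compContinuous (phaseProj n m) := by
  obtain ⟨f, hf, h⟩ := h
  exact ⟨_, compContinuous_phaseMap_mem hlm hf, h.trans (compContinuous_phaseProj_eq hlm f).symm⟩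

theorem exists_rep₂ (F G : classicalAlgebra n D) : ∃ l : Lattice D,
    (∃ f ∈ latticeAlgebra n l, F.1 = f.compContinuous (phaseProj n l)) ∧
    ∃ g ∈ latticeAlgebra n l, G.1 = g.compContinuous (phaseProj n l) := by
  obtain ⟨l, hf⟩ := exists_rep F
  obtain ⟨m, hg⟩ := exists_rep G
  obtain ⟨k, hl, hm⟩ := exists_common_refinement l m
  exact ⟨k, exists_rep_of_le F hl hf, exists_rep_of_le G hm hg⟩

theorem exists_rep₃ (F G H : classicalAlgebra n D) : ∃ l : Lattice D,
    (∃ f ∈ latticeAlgebra n l, F.1 = f.compContinuous (phaseProj n l)) ∧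
    (∃ g ∈ latticeAlgebra n l, G.1 = g.compContinuous (phaseProj n l)) ∧
    ∃ g ∈ latticeAlgebra n l, H.1 = g.compContinuous (phaseProj n l) := by
  obtain ⟨l, hf, hg⟩ := exists_rep₂ F G
  obtain ⟨m, hh⟩ := exists_rep H
  obtain ⟨k, hl, hm⟩ := exists_common_refinement l m
  exact ⟨k, exists_rep_of_le F hl hf, exists_rep_of_le G hl hg, exists_rep_of_le H hm hh⟩

theorem compContinuous_phaseProj_injective (l : Lattice D)
    {f g : BoundedContinuousFunction (Phase n l) ℂ}
    (h : f.compContinuous (phaseProj n l) = g.compContinuous (phaseProj n l)) : f = g := by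
  refine BoundedContinuousFunction.ext fun y => ?_
  obtain ⟨x, rfl⟩ := phaseProj_surjective n l y
  exact congrArg (fun F : BoundedContinuousFunction (PhaseInf n D) ℂ => F x) h

end TrigSum

/-! ### The Poisson bracket on lattices and on the continuum -/

section Bracket

variable {n D : ℕ} {l : Lattice D}

/-- The derivative of `h` in the direction `v`. -/
def waveDeriv {E : Type} [NormedAddCommGroup E] [NormedSpace ℝ E] (v : E) (h : E → ℂ) (p : E) : ℂ :=
  fderiv ℝ h p v

section

variable {E F : Type} [NormedAddCommGroup E] [InnerProductSpace ℝ E] [FiniteDimensional ℝ E]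
  [NormedAddCommGroup F] [InnerProductSpace ℝ F] [FiniteDimensional ℝ F]
  [MeasurableSpace E] [BorelSpace E] [MeasurableSpace F] [BorelSpace F]

theorem IsWave.differentiable {h : E → ℂ} (H : IsWave h) : Differentiable ℝ h :=
  H.contDiff.differentiable (by simp)

theorem IsWave.hasDerivAt {h : E → ℂ} (H : IsWave h) (v p : E) :
    HasDerivAt (fun t : ℝ => h (p + t • v)) (waveDeriv v h p) 0 :=
  (H.differentiable p).hasFDerivAt.hasLineDerivAt v

theorem IsWave.waveDeriv {h : E → ℂ} (H : IsWave h) (v : E) : IsWave (waveDeriv v h) := by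
  obtain ⟨h', H', hh⟩ := H.exists_hasDerivAt v
  rwa [show LatticeGauge.waveDeriv v h = h' from
    funext fun p => (H.hasDerivAt v p).unique (hh p)]

omit [FiniteDimensional ℝ E] [MeasurableSpace E] [BorelSpace E] in
theorem waveDeriv_add (v w : E) (h : E → ℂ) (p : E) :
    waveDeriv (v + w) h p = waveDeriv v h p + waveDeriv w h p := map_add _ _ _

omit [FiniteDimensional ℝ E] [MeasurableSpace E] [BorelSpace E] in
theorem waveDeriv_mul {h h' : E → ℂ} (H : Differentiable ℝ h) (H' : Differentiable ℝ h') (v p : E) :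
    waveDeriv v (fun p => h p * h' p) p = waveDeriv v h p * h' p + h p * waveDeriv v h' p := by
  rw [waveDeriv, fderiv_fun_mul (H p) (H' p)]
  simp only [add_apply, smul_apply, smul_eq_mul, waveDeriv]
  ring

omit [FiniteDimensional ℝ E] [MeasurableSpace E] [BorelSpace E] in
theorem waveDeriv_sub {h h' : E → ℂ} (H : Differentiable ℝ h) (H' : Differentiable ℝ h') (v p : E) :
    waveDeriv v (fun p => h p - h' p) p = waveDeriv v h p - waveDeriv v h' p := by
  rw [waveDeriv, fderiv_fun_sub (H p) (H' p)]
  rfl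

omit [FiniteDimensional ℝ E] [MeasurableSpace E] [BorelSpace E] in
theorem waveDeriv_const_mul {h : E → ℂ} (H : Differentiable ℝ h) (c : ℂ) (v p : E) :
    waveDeriv v (fun p => c * h p) p = c * waveDeriv v h p := by
  rw [waveDeriv, fderiv_const_mul (H p)]
  rfl

omit [FiniteDimensional ℝ E] [MeasurableSpace E] [BorelSpace E] in
theorem waveDeriv_conj {h : E → ℂ} (H : Differentiable ℝ h) (v p : E) :
    waveDeriv v (fun p => (starRingEnd ℂ) (h p)) p = (starRingEnd ℂ) (waveDeriv v h p) := by
  have h1 := Complex.conjCLE.toContinuousLinearMap.hasFDerivAt.comp p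
    (H p).hasFDerivAt
  rw [waveDeriv]
  exact congrArg (fun T : E →L[ℝ] ℂ => T v) h1.fderiv

omit [FiniteDimensional ℝ E] [MeasurableSpace E] [BorelSpace E] in
theorem ContDiff.waveDeriv {h : E → ℂ} (H : ContDiff ℝ ∞ h) (v : E) :
    ContDiff ℝ ∞ (LatticeGauge.waveDeriv v h) :=
  (H.fderiv_right (m := ∞) (by simp)).clm_apply contDiff_const

omit [FiniteDimensional ℝ E] [MeasurableSpace E] [BorelSpace E] in
theorem waveDeriv_comm {h : E → ℂ} (H : ContDiff ℝ ∞ h) (v w p : E) :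
    waveDeriv v (waveDeriv w h) p = waveDeriv w (waveDeriv v h) p := by
  have h1 : Differentiable ℝ (fderiv ℝ h) :=
    (H.fderiv_right (m := ∞) (by simp)).differentiable (by simp)
  have key : ∀ v w : E, waveDeriv v (waveDeriv w h) p = fderiv ℝ (fderiv ℝ h) p v w := by
    intro v w
    have h2 := (h1 p).hasFDerivAt.clm_apply (hasFDerivAt_const w p)
    have h3 := congrArg (fun T : E →L[ℝ] ℂ => T v) h2.fderiv
    have h4 : waveDeriv v (waveDeriv w h) p = fderiv ℝ (fun y => fderiv ℝ h y w) p v := rfl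
    rw [h4]
    simpa using h3
  rw [key, key]
  exact (H.contDiffAt.isSymmSndFDerivAt (by simpa using ENat.LEInfty.out)) v w

omit [FiniteDimensional ℝ E] [MeasurableSpace E] [BorelSpace E] [FiniteDimensional ℝ F]
  [MeasurableSpace F] [BorelSpace F] in
theorem waveDeriv_comp_linear {h : F → ℂ} (H : Differentiable ℝ h) (A : E →L[ℝ] F) (v p : E) :
    waveDeriv v (fun p => h (A p)) p = waveDeriv (A v) h (A p) := by
  have h1 := (H (A p)).hasFDerivAt.comp p A.hasFDerivAt
  exact congrArg (fun T : E →L[ℝ] ℂ => T v) h1.fderiv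

end

/-- Integer coefficients as a momentum. -/
def intMom (b : l.edges × Fin n → ℤ) : Mom n l := WithLp.toLp 2 fun j => (b j : ℝ)

theorem intMom_eq (b : l.edges × Fin n → ℤ) : intMom b = charMom l (charOf l b) := by
  ext j
  exact (charMom_charOf_self l b j).symm

theorem intMom_add (b b' : l.edges × Fin n → ℤ) : intMom (b + b') = intMom b + intMom b' := by
  ext j
  exact Int.cast_add _ _

theorem intMom_neg (b : l.edges × Fin n → ℤ) : intMom (-b) = -intMom b := by
  ext j
  exact Int.cast_neg _

theorem momMapL_intMom {l m : Lattice D} (hlm : l ≤ m) (b : l.edges × Fin n → ℤ) :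
    momMapL n l m (intMom (refineCoeff l m b)) = intMom b := by
  rw [intMom_eq, intMom_eq, charOf_refineCoeff hlm]
  exact momMap_charMom hlm _

/-- The momentum factor of the Poisson bracket of `e_b ⊗ h` and `e_{b'} ⊗ h'`. -/
def bracketWave (b : l.edges × Fin n → ℤ) (h : Mom n l → ℂ) (b' : l.edges × Fin n → ℤ)
    (h' : Mom n l → ℂ) (p : Mom n l) : ℂ :=
  2 * Real.pi * Complex.I * (waveDeriv (intMom b') h p * h' p - h p * waveDeriv (intMom b) h' p)

theorem mFourier_add_toConf (b : l.edges × Fin n → ℤ) (q : Conf n l) (v : Mom n l) :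
    UnitAddTorus.mFourier b (q + toConf v) = UnitAddTorus.mFourier b q *
      Complex.exp (2 * Real.pi * Complex.I * (inner ℝ (intMom b) v : ℝ)) := by
  have h2 : ∀ j, fourier (b j) ((q + toConf v) j) = fourier (b j) (q j) *
      Complex.exp (2 * Real.pi * Complex.I * (b j * v j)) := by
    intro j
    rw [Pi.add_apply, fourier_apply, smul_add, AddCircle.toCircle_add, Circle.coe_mul,
      ← fourier_apply, ← fourier_apply]
    congr 1
    change fourier (b j) ((v j : ℝ) : UnitAddCircle) = _
    rw [fourier_coe_apply]
    congr 1
    push_cast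
    ring
  simp only [UnitAddTorus.mFourier, ContinuousMap.coe_mk, h2]
  rw [Finset.prod_mul_distrib, ← Complex.exp_sum, ← Finset.mul_sum]
  congr 4
  rw [PiLp.inner_apply]
  push_cast
  refine Finset.sum_congr rfl fun j _ => ?_
  simp [intMom, mul_comm]

theorem hasDerivAt_mFourier (b : l.edges × Fin n → ℤ) (q : Conf n l) (v : Mom n l) :
    HasDerivAt (fun t : ℝ => UnitAddTorus.mFourier b (q + toConf (t • v)))
      (2 * Real.pi * Complex.I * (inner ℝ (intMom b) v : ℝ) * UnitAddTorus.mFourier b q) 0 := by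
  have h1 : ∀ t : ℝ, UnitAddTorus.mFourier b (q + toConf (t • v)) =
      UnitAddTorus.mFourier b q *
        Complex.exp (2 * Real.pi * Complex.I * (inner ℝ (intMom b) v : ℝ) * t) := by
    intro t
    rw [mFourier_add_toConf, inner_smul_right]
    push_cast
    congr 2
    ring
  simp_rw [h1]
  have h2 : HasDerivAt (fun t : ℝ => 2 * Real.pi * Complex.I * (inner ℝ (intMom b) v : ℝ) * (t : ℂ))
      (2 * Real.pi * Complex.I * (inner ℝ (intMom b) v : ℝ)) 0 := by
    simpa using (Complex.ofRealCLM.hasDerivAt (x := (0 : ℝ))).const_mul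
      (2 * Real.pi * Complex.I * (inner ℝ (intMom b) v : ℝ) : ℂ)
  have h3 := (h2.cexp).const_mul (UnitAddTorus.mFourier b q)
  refine h3.congr_deriv ?_
  simp
  ring

theorem momDeriv_trigSum {ι : Type} [Fintype ι] [DecidableEq (l.edges × Fin n)]
    (b : ι → l.edges × Fin n → ℤ) {h : ι → Mom n l → ℂ} (H : ∀ i, Differentiable ℝ (h i))
    (j : l.edges × Fin n) (x : Phase n l) :
    momDeriv j (trigSum b h) x =
      ∑ i, UnitAddTorus.mFourier (b i) x.1 * waveDeriv (EuclideanSpace.single j 1) (h i) x.2 := by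
  have h1 : HasDerivAt (fun t : ℝ => ∑ i, UnitAddTorus.mFourier (b i) x.1 *
      h i (x.2 + t • EuclideanSpace.single j 1))
      (∑ i, UnitAddTorus.mFourier (b i) x.1 *
        waveDeriv (EuclideanSpace.single j 1) (h i) x.2) 0 :=
    HasDerivAt.fun_sum fun i _ => ((H i x.2).hasFDerivAt.hasLineDerivAt _).const_mul _
  rw [momDeriv, ← h1.deriv]
  congr 1
  ext t
  simp only [trigSum]
  refine Finset.sum_congr rfl fun i _ => ?_
  congr 3
  ext k
  simp

theorem confDeriv_trigSum {ι : Type} [Fintype ι] (b : ι → l.edges × Fin n → ℤ)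
    (h : ι → Mom n l → ℂ) (j : l.edges × Fin n) (x : Phase n l) :
    confDeriv j (trigSum b h) x =
      ∑ i, 2 * Real.pi * Complex.I * (b i j) * UnitAddTorus.mFourier (b i) x.1 * h i x.2 := by
  classical
  have h1 : HasDerivAt (fun t : ℝ => ∑ i, UnitAddTorus.mFourier (b i)
      (x.1 + toConf (t • EuclideanSpace.single j 1)) * h i x.2)
      (∑ i, 2 * Real.pi * Complex.I * (b i j) * UnitAddTorus.mFourier (b i) x.1 * h i x.2) 0 := by
    refine HasDerivAt.fun_sum fun i _ => HasDerivAt.mul_const ?_ _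
    refine (hasDerivAt_mFourier (b i) x.1 (EuclideanSpace.single j 1)).congr_deriv ?_
    rw [EuclideanSpace.inner_single_right]
    simp [intMom]
  rw [confDeriv, ← h1.deriv]
  congr 1
  ext t
  simp only [trigSum]
  refine Finset.sum_congr rfl fun i _ => ?_
  congr 4
  ext k
  simp

theorem waveDeriv_intMom [DecidableEq (l.edges × Fin n)] (b : l.edges × Fin n → ℤ)
    (h : Mom n l → ℂ) (p : Mom n l) :
    waveDeriv (intMom b) h p = ∑ j, (b j : ℂ) * waveDeriv (EuclideanSpace.single j 1) h p := by
  have h1 : intMom b = ∑ j, (b j : ℝ) • EuclideanSpace.single j (1 : ℝ) := by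
    ext k
    simp [intMom, Pi.single_apply]
  rw [waveDeriv, h1, map_sum]
  refine Finset.sum_congr rfl fun j _ => ?_
  rw [map_smul, Complex.real_smul]
  rfl

/-- ∂/∂q_j acts on e_b as multiplication by 2πi b_j. The sum over j then assembles the momentum
derivatives into derivatives in the directions b' and b. -/
theorem latticeBracket_trigSum {ι ι' : Type} [Fintype ι] [Fintype ι']
    (b : ι → l.edges × Fin n → ℤ) {h : ι → Mom n l → ℂ} (H : ∀ i, Differentiable ℝ (h i))
    (b' : ι' → l.edges × Fin n → ℤ) {h' : ι' → Mom n l → ℂ} (H' : ∀ i, Differentiable ℝ (h' i))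
    (x : Phase n l) :
    latticeBracket (trigSum b h) (trigSum b' h') x =
      trigSum (fun i : ι × ι' => b i.1 + b' i.2)
        (fun i => bracketWave (b i.1) (h i.1) (b' i.2) (h' i.2)) x := by
  classical
  simp only [latticeBracket, momDeriv_trigSum b H, momDeriv_trigSum b' H', confDeriv_trigSum]
  have h1 : ∀ j : l.edges × Fin n,
      (∑ i, UnitAddTorus.mFourier (b i) x.1 * waveDeriv (EuclideanSpace.single j 1) (h i) x.2) *
        (∑ i, 2 * Real.pi * Complex.I * (b' i j) * UnitAddTorus.mFourier (b' i) x.1 * h' i x.2) -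
      (∑ i, 2 * Real.pi * Complex.I * (b i j) * UnitAddTorus.mFourier (b i) x.1 * h i x.2) *
        (∑ i, UnitAddTorus.mFourier (b' i) x.1 *
          waveDeriv (EuclideanSpace.single j 1) (h' i) x.2) =
      ∑ i, ∑ i', UnitAddTorus.mFourier (b i) x.1 * UnitAddTorus.mFourier (b' i') x.1 *
        (2 * Real.pi * Complex.I *
          ((b' i' j) * waveDeriv (EuclideanSpace.single j 1) (h i) x.2 * h' i' x.2 -
            h i x.2 * ((b i j) * waveDeriv (EuclideanSpace.single j 1) (h' i') x.2))) := by
    intro j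
    rw [Finset.sum_mul_sum, Finset.sum_mul_sum, ← Finset.sum_sub_distrib]
    refine Finset.sum_congr rfl fun i _ => ?_
    rw [← Finset.sum_sub_distrib]
    refine Finset.sum_congr rfl fun i' _ => ?_
    ring
  rw [Finset.sum_congr rfl fun j _ => h1 j, Finset.sum_comm]
  simp only [trigSum]
  rw [Fintype.sum_prod_type]
  refine Finset.sum_congr rfl fun i _ => ?_
  rw [Finset.sum_comm]
  refine Finset.sum_congr rfl fun i' _ => ?_
  rw [UnitAddTorus.mFourier_add, bracketWave, waveDeriv_intMom, waveDeriv_intMom, ← Finset.mul_sum,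
    ← Finset.mul_sum, Finset.sum_sub_distrib, ← Finset.sum_mul, ← Finset.mul_sum]

theorem bracketWave_comp {l m : Lattice D} (hlm : l ≤ m) (b b' : l.edges × Fin n → ℤ)
    {h h' : Mom n l → ℂ} (H : Differentiable ℝ h) (H' : Differentiable ℝ h') (p : Mom n m) :
    bracketWave (refineCoeff l m b) (fun p => h (momMapL n l m p)) (refineCoeff l m b')
      (fun p => h' (momMapL n l m p)) p = bracketWave b h b' h' (momMapL n l m p) := by
  rw [bracketWave, waveDeriv_comp_linear H, waveDeriv_comp_linear H', momMapL_intMom hlm,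
    momMapL_intMom hlm]
  rfl

/-- The connecting map is Poisson: γ^mom sends the refined coefficients of b back to b
(`momMapL_intMom`), so by the chain rule the directional derivatives agree on both lattices. -/
theorem latticeBracket_phaseMap {l m : Lattice D} (hlm : l ≤ m)
    {f g : BoundedContinuousFunction (Phase n l) ℂ} (hf : f ∈ latticeAlgebra n l)
    (hg : g ∈ latticeAlgebra n l) (x : Phase n m) :
    latticeBracket (f.compContinuous (phaseMap n l m)) (g.compContinuous (phaseMap n l m)) x =
      latticeBracket f g (phaseMap n l m x) := by
  obtain ⟨ι, _, b, h, H, hfx⟩ := exists_trigSum_of_mem hf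
  obtain ⟨ι', _, b', h', H', hgx⟩ := exists_trigSum_of_mem hg
  have h1 : ⇑(f.compContinuous (phaseMap n l m)) = _ :=
    funext fun x => (hfx _).trans (trigSum_phaseMap hlm b h x)
  have h2 : ⇑(g.compContinuous (phaseMap n l m)) = _ :=
    funext fun x => (hgx _).trans (trigSum_phaseMap hlm b' h' x)
  rw [h1, h2, funext hfx, funext hgx,
    latticeBracket_trigSum _ (fun i => ((H i).comp_linear (momMapL n l m)).differentiable) _
      fun i => ((H' i).comp_linear (momMapL n l m)).differentiable,
    latticeBracket_trigSum _ (fun i => (H i).differentiable) _ fun i => (H' i).differentiable,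
    trigSum, trigSum]
  refine Finset.sum_congr rfl fun i _ => ?_
  rw [bracketWave_comp hlm _ _ (H i.1).differentiable (H' i.2).differentiable,
    UnitAddTorus.mFourier_add, UnitAddTorus.mFourier_add, ← mFourier_confMap hlm,
    ← mFourier_confMap hlm]
  rfl

theorem exists_eq_latticeBracket {f g : BoundedContinuousFunction (Phase n l) ℂ}
    (hf : f ∈ latticeAlgebra n l) (hg : g ∈ latticeAlgebra n l) :
    ∃ k ∈ latticeAlgebra n l, ∀ x, k x = latticeBracket f g x := by
  obtain ⟨ι, _, b, h, H, hfx⟩ := exists_trigSum_of_mem hf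
  obtain ⟨ι', _, b', h', H', hgx⟩ := exists_trigSum_of_mem hg
  obtain ⟨k₁, hk₁, e₁⟩ := exists_eq_trigSum_mem (fun i : ι × ι' => b i.1 + b' i.2)
    (h := fun i p => 2 * Real.pi * Complex.I * (waveDeriv (intMom (b' i.2)) (h i.1) p * h' i.2 p))
    fun i => (((H i.1).waveDeriv _).mul (H' i.2)).const_mul _
  obtain ⟨k₂, hk₂, e₂⟩ := exists_eq_trigSum_mem (fun i : ι × ι' => b i.1 + b' i.2)
    (h := fun i p => 2 * Real.pi * Complex.I * (h i.1 p * waveDeriv (intMom (b i.1)) (h' i.2) p))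
    fun i => ((H i.1).mul ((H' i.2).waveDeriv _)).const_mul _
  refine ⟨k₁ - k₂, Submodule.sub_mem _ hk₁ hk₂, fun x => ?_⟩
  rw [funext hfx, funext hgx, latticeBracket_trigSum _ (fun i => (H i).differentiable) _
    fun i => (H' i).differentiable, BoundedContinuousFunction.sub_apply, e₁, e₂, trigSum, trigSum,
    trigSum, ← Finset.sum_sub_distrib]
  refine Finset.sum_congr rfl fun i _ => ?_
  rw [bracketWave]
  ring

/-- Two representations of F agree after pullback to a common refinement, since γ_m is onto, and the
bracket commutes with that pullback. -/
theorem isContinuumBracket_of_rep {F G H : classicalAlgebra n D}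
    {f g : BoundedContinuousFunction (Phase n l) ℂ} (hf : f ∈ latticeAlgebra n l)
    (hg : g ∈ latticeAlgebra n l) (hF : F.1 = f.compContinuous (phaseProj n l))
    (hG : G.1 = g.compContinuous (phaseProj n l))
    (hH : ∀ x, H.1 x = latticeBracket f g (phaseProj n l x)) : IsContinuumBracket F G H := by
  intro l' f' hf' g' hg' hF' hG' x
  obtain ⟨m, hl, hl'⟩ := exists_common_refinement l l'
  have h1 : f.compContinuous (phaseMap n l m) = f'.compContinuous (phaseMap n l' m) := by
    refine compContinuous_phaseProj_injective m ?_
    rw [compContinuous_phaseProj_eq hl, compContinuous_phaseProj_eq hl', ← hF, ← hF']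
  have h2 : g.compContinuous (phaseMap n l m) = g'.compContinuous (phaseMap n l' m) := by
    refine compContinuous_phaseProj_injective m ?_
    rw [compContinuous_phaseProj_eq hl, compContinuous_phaseProj_eq hl', ← hG, ← hG']
  rw [hH, ← phaseMap_phaseProj hl, ← phaseMap_phaseProj hl', ← latticeBracket_phaseMap hl hf hg,
    ← latticeBracket_phaseMap hl' hf' hg', h1, h2]

theorem isContinuumBracket_continuumBracket (F G : classicalAlgebra n D) :
    IsContinuumBracket F G (continuumBracket F G) := by
  obtain ⟨l, ⟨f, hf, hF⟩, g, hg, hG⟩ := exists_rep₂ F G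
  obtain ⟨k, hk, hkx⟩ := exists_eq_latticeBracket hf hg
  refine Classical.epsilon_spec (p := fun H => IsContinuumBracket F G H)
    ⟨⟨k.compContinuous (phaseProj n l), (classicalAlgebra_eq n D).ge ⟨l, k, hk, rfl⟩⟩, ?_⟩
  exact isContinuumBracket_of_rep hf hg hF hG fun x => hkx _

end Bracket

/-! ### The axioms of a Poisson *-algebra -/

section Poisson

variable {n D : ℕ} {l : Lattice D}

theorem exists_trigSum_rep (F : classicalAlgebra n D) (hl : ∃ f ∈ latticeAlgebra n l,
    F.1 = f.compContinuous (phaseProj n l)) :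
    ∃ (ι : Type) (_ : Fintype ι) (b : ι → l.edges × Fin n → ℤ) (h : ι → Mom n l → ℂ),
      (∀ i, IsWave (h i)) ∧ ∀ x, F.1 x = trigSum b h (phaseProj n l x) := by
  obtain ⟨f, hf, hF⟩ := hl
  obtain ⟨ι, _, b, h, H, hfx⟩ := exists_trigSum_of_mem hf
  exact ⟨ι, _, b, h, H, fun x => by rw [hF]; exact hfx _⟩

theorem ContDiff.bracketWave (b b' : l.edges × Fin n → ℤ) {h h' : Mom n l → ℂ}
    (H : ContDiff ℝ ∞ h) (H' : ContDiff ℝ ∞ h') :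
    ContDiff ℝ ∞ (LatticeGauge.bracketWave b h b' h') :=
  contDiff_const.mul (((ContDiff.waveDeriv H _).mul H').sub (H.mul (ContDiff.waveDeriv H' _)))

/-- The bracket may be computed from any smooth expansions on a lattice. -/
theorem continuumBracket_apply {ι ι' : Type} [Fintype ι] [Fintype ι'] {F G : classicalAlgebra n D}
    (b : ι → l.edges × Fin n → ℤ) {h : ι → Mom n l → ℂ} (H : ∀ i, ContDiff ℝ ∞ (h i))
    (b' : ι' → l.edges × Fin n → ℤ) {h' : ι' → Mom n l → ℂ} (H' : ∀ i, ContDiff ℝ ∞ (h' i))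
    (hFl : ∃ f ∈ latticeAlgebra n l, F.1 = f.compContinuous (phaseProj n l))
    (hGl : ∃ g ∈ latticeAlgebra n l, G.1 = g.compContinuous (phaseProj n l))
    (hF : ∀ x, F.1 x = trigSum b h (phaseProj n l x))
    (hG : ∀ x, G.1 x = trigSum b' h' (phaseProj n l x)) (x : PhaseInf n D) :
    (continuumBracket F G).1 x = trigSum (fun i : ι × ι' => b i.1 + b' i.2)
        (fun i => bracketWave (b i.1) (h i.1) (b' i.2) (h' i.2)) (phaseProj n l x) := by
  obtain ⟨f, hf, hf'⟩ := hFl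
  obtain ⟨g, hg, hg'⟩ := hGl
  rw [isContinuumBracket_continuumBracket F G l f hf g hg hf' hg' x,
    ← latticeBracket_trigSum _ (fun i => (H i).differentiable (by simp)) _
      fun i => (H' i).differentiable (by simp)]
  have h1 : ⇑f = trigSum b h := by
    ext y
    obtain ⟨x, rfl⟩ := phaseProj_surjective n l y
    rw [← hF, hf']
    rfl
  have h2 : ⇑g = trigSum b' h' := by
    ext y
    obtain ⟨x, rfl⟩ := phaseProj_surjective n l y
    rw [← hG, hg']
    rfl
  rw [h1, h2]

theorem continuumBracket_rep {F G : classicalAlgebra n D}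
    (hFl : ∃ f ∈ latticeAlgebra n l, F.1 = f.compContinuous (phaseProj n l))
    (hGl : ∃ g ∈ latticeAlgebra n l, G.1 = g.compContinuous (phaseProj n l)) :
    ∃ k ∈ latticeAlgebra n l, (continuumBracket F G).1 = k.compContinuous (phaseProj n l) := by
  obtain ⟨f, hf, hf'⟩ := hFl
  obtain ⟨g, hg, hg'⟩ := hGl
  obtain ⟨k, hk, hkx⟩ := exists_eq_latticeBracket hf hg
  refine ⟨k, hk, BoundedContinuousFunction.ext fun x => ?_⟩
  rw [isContinuumBracket_continuumBracket F G l f hf g hg hf' hg' x, ← hkx]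
  rfl

theorem sum_rotate {α β γ M : Type*} [Fintype α] [Fintype β] [Fintype γ] [AddCommMonoid M]
    (f : α → β → γ → M) : ∑ i, ∑ j, ∑ k, f i j k = ∑ k, ∑ i, ∑ j, f i j k := by
  rw [Finset.sum_comm (s := (Finset.univ : Finset γ))]
  exact Finset.sum_congr rfl fun i _ => Finset.sum_comm

/-- After expansion the first-order terms cancel in pairs, and the second-order terms cancel because
directional derivatives commute. -/
theorem jacobi_bracketWave {b₁ b₂ b₃ : l.edges × Fin n → ℤ} {h₁ h₂ h₃ : Mom n l → ℂ}
    (H₁ : ContDiff ℝ ∞ h₁) (H₂ : ContDiff ℝ ∞ h₂) (H₃ : ContDiff ℝ ∞ h₃) (p : Mom n l) :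
    bracketWave b₁ h₁ (b₂ + b₃) (bracketWave b₂ h₂ b₃ h₃) p +
      bracketWave b₂ h₂ (b₃ + b₁) (bracketWave b₃ h₃ b₁ h₁) p +
      bracketWave b₃ h₃ (b₁ + b₂) (bracketWave b₁ h₁ b₂ h₂) p = 0 := by
  have hd : ∀ {h : Mom n l → ℂ}, ContDiff ℝ ∞ h → Differentiable ℝ h :=
    fun H => H.differentiable (by simp)
  have key : ∀ {b b' : l.edges × Fin n → ℤ} {h h' : Mom n l → ℂ} (v : Mom n l),
      ContDiff ℝ ∞ h → ContDiff ℝ ∞ h' → waveDeriv v (bracketWave b h b' h') p =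
        2 * Real.pi * Complex.I * (waveDeriv v (waveDeriv (intMom b') h) p * h' p +
          waveDeriv (intMom b') h p * waveDeriv v h' p - waveDeriv v h p * waveDeriv (intMom b) h' p
          - h p * waveDeriv v (waveDeriv (intMom b) h') p) := by
    intro b b' h h' v H H'
    have h1 := hd (ContDiff.waveDeriv H (intMom b'))
    have h2 := hd (ContDiff.waveDeriv H' (intMom b))
    have h3 : bracketWave b h b' h' = fun p => 2 * Real.pi * Complex.I *
      ((fun p => waveDeriv (intMom b') h p * h' p) p -
        (fun p => h p * waveDeriv (intMom b) h' p) p) := rfl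
    rw [h3]
    refine (waveDeriv_const_mul ((h1.mul (hd H')).sub ((hd H).mul h2)) _ v p).trans ?_
    congr 1
    refine (waveDeriv_sub (h1.mul (hd H')) ((hd H).mul h2) v p).trans ?_
    refine (congrArg₂ _ (waveDeriv_mul h1 (hd H') v p) (waveDeriv_mul (hd H) h2 v p)).trans ?_
    ring
  have e : ∀ (b b' : l.edges × Fin n → ℤ) (h k : Mom n l → ℂ), bracketWave b h b' k p =
      2 * Real.pi * Complex.I * (waveDeriv (intMom b') h p * k p - h p * waveDeriv (intMom b) k p) :=
    fun _ _ _ _ => rfl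
  rw [e b₁ (b₂ + b₃), e b₂ (b₃ + b₁), e b₃ (b₁ + b₂), key _ H₂ H₃, key _ H₃ H₁, key _ H₁ H₂]
  simp only [intMom_add, waveDeriv_add, bracketWave]
  rw [waveDeriv_comm H₁ (intMom b₃) (intMom b₂), waveDeriv_comm H₂ (intMom b₁) (intMom b₃),
    waveDeriv_comm H₃ (intMom b₂) (intMom b₁)]
  ring

theorem isPoissonStarBracket (n D : ℕ) :
    IsPoissonStarBracket (classicalAlgebra n D) continuumBracket where
  mul_comm f g := Subtype.ext (mul_comm f.1 g.1)
  add_left f g h := by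
    obtain ⟨l, hf, hg, hh⟩ := exists_rep₃ f g h
    obtain ⟨ι₁, _, b₁, h₁, H₁, e₁⟩ := exists_trigSum_rep f hf
    obtain ⟨ι₂, _, b₂, h₂, H₂, e₂⟩ := exists_trigSum_rep g hg
    obtain ⟨ι₃, _, b₃, h₃, H₃, e₃⟩ := exists_trigSum_rep h hh
    have hfg : ∃ k ∈ latticeAlgebra n l, (f + g).1 = k.compContinuous (phaseProj n l) := by
      obtain ⟨f', hf, hf'⟩ := hf
      obtain ⟨g', hg, hg'⟩ := hg
      exact ⟨f' + g', Submodule.add_mem _ hf hg, by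
        change f.1 + g.1 = _
        rw [hf', hg']
        rfl⟩
    refine Subtype.ext (BoundedContinuousFunction.ext fun x => ?_)
    change _ = (continuumBracket f h).1 x + (continuumBracket g h).1 x
    rw [continuumBracket_apply b₁ (fun i => (H₁ i).contDiff) b₃ (fun i => (H₃ i).contDiff) hf hh e₁ e₃,
      continuumBracket_apply b₂ (fun i => (H₂ i).contDiff) b₃ (fun i => (H₃ i).contDiff) hg hh e₂ e₃,
      continuumBracket_apply (F := f + g) (Sum.elim b₁ b₂) (h := Sum.elim h₁ h₂) (fun i => by
        cases i
        · exact (H₁ _).contDiff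
        · exact (H₂ _).contDiff) b₃ (fun i => (H₃ i).contDiff) hfg hh (fun x => by
        change f.1 x + g.1 x = _
        rw [e₁, e₂, trigSum, trigSum, trigSum, Fintype.sum_sum_type]
        rfl) e₃]
    simp only [trigSum, Fintype.sum_prod_type, Fintype.sum_sum_type]
    rfl
  smul_left c f g := by
    obtain ⟨l, hf, hg⟩ := exists_rep₂ f g
    obtain ⟨ι₁, _, b₁, h₁, H₁, e₁⟩ := exists_trigSum_rep f hf
    obtain ⟨ι₂, _, b₂, h₂, H₂, e₂⟩ := exists_trigSum_rep g hg
    have hcf : ∃ k ∈ latticeAlgebra n l, (c • f).1 = k.compContinuous (phaseProj n l) := by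
      obtain ⟨f', hf, hf'⟩ := hf
      exact ⟨c • f', Submodule.smul_mem _ c hf, by
        change c • f.1 = _
        rw [hf']
        rfl⟩
    refine Subtype.ext (BoundedContinuousFunction.ext fun x => ?_)
    change _ = c * (continuumBracket f g).1 x
    rw [continuumBracket_apply b₁ (fun i => (H₁ i).contDiff) b₂ (fun i => (H₂ i).contDiff) hf hg e₁ e₂,
      continuumBracket_apply (F := c • f) b₁ (h := fun i p => c * h₁ i p)
        (fun i => ((H₁ i).const_mul c).contDiff) b₂ (fun i => (H₂ i).contDiff) hcf hg (fun x => by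
        change c * f.1 x = _
        rw [e₁, trigSum, trigSum, Finset.mul_sum]
        exact Finset.sum_congr rfl fun i _ => by ring) e₂]
    rw [trigSum, trigSum, Finset.mul_sum]
    refine Finset.sum_congr rfl fun i _ => ?_
    rw [bracketWave, bracketWave, waveDeriv_const_mul (H₁ i.1).differentiable]
    ring
  skew f g := by
    obtain ⟨l, hf, hg⟩ := exists_rep₂ f g
    obtain ⟨ι₁, _, b₁, h₁, H₁, e₁⟩ := exists_trigSum_rep f hf
    obtain ⟨ι₂, _, b₂, h₂, H₂, e₂⟩ := exists_trigSum_rep g hg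
    refine Subtype.ext (BoundedContinuousFunction.ext fun x => ?_)
    change _ = -(continuumBracket g f).1 x
    rw [continuumBracket_apply b₁ (fun i => (H₁ i).contDiff) b₂ (fun i => (H₂ i).contDiff) hf hg e₁ e₂,
      continuumBracket_apply b₂ (fun i => (H₂ i).contDiff) b₁ (fun i => (H₁ i).contDiff) hg hf e₂ e₁,
      trigSum, trigSum, Fintype.sum_prod_type, Fintype.sum_prod_type, Finset.sum_comm,
      ← Finset.sum_neg_distrib]
    refine Finset.sum_congr rfl fun i _ => ?_
    rw [← Finset.sum_neg_distrib]
    refine Finset.sum_congr rfl fun j _ => ?_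
    rw [bracketWave, bracketWave, add_comm (b₁ j)]
    ring
  jacobi f g h := by
    obtain ⟨l, hf, hg, hh⟩ := exists_rep₃ f g h
    obtain ⟨ι₁, _, b₁, h₁, H₁, e₁⟩ := exists_trigSum_rep f hf
    obtain ⟨ι₂, _, b₂, h₂, H₂, e₂⟩ := exists_trigSum_rep g hg
    obtain ⟨ι₃, _, b₃, h₃, H₃, e₃⟩ := exists_trigSum_rep h hh
    have C₁ := fun i => (H₁ i).contDiff
    have C₂ := fun i => (H₂ i).contDiff
    have C₃ := fun i => (H₃ i).contDiff
    -- The inner bracket enters only as a smooth expansion; there is no need to exhibit its factors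
    -- as waves.
    have a₁ := continuumBracket_apply b₁ C₁ _ (fun i : ι₂ × ι₃ => ContDiff.bracketWave _ _
      (C₂ i.1) (C₃ i.2)) hf (continuumBracket_rep hg hh) e₁
      (continuumBracket_apply b₂ C₂ b₃ C₃ hg hh e₂ e₃)
    have a₂ := continuumBracket_apply b₂ C₂ _ (fun i : ι₃ × ι₁ => ContDiff.bracketWave _ _
      (C₃ i.1) (C₁ i.2)) hg (continuumBracket_rep hh hf) e₂
      (continuumBracket_apply b₃ C₃ b₁ C₁ hh hf e₃ e₁)
    have a₃ := continuumBracket_apply b₃ C₃ _ (fun i : ι₁ × ι₂ => ContDiff.bracketWave _ _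
      (C₁ i.1) (C₂ i.2)) hh (continuumBracket_rep hf hg) e₃
      (continuumBracket_apply b₁ C₁ b₂ C₂ hf hg e₁ e₂)
    refine Subtype.ext (BoundedContinuousFunction.ext fun x => ?_)
    change (continuumBracket f (continuumBracket g h)).1 x +
      (continuumBracket g (continuumBracket h f)).1 x +
      (continuumBracket h (continuumBracket f g)).1 x = 0
    rw [a₁, a₂, a₃]
    simp only [trigSum, Fintype.sum_prod_type]
    -- The cyclic permutations of the three sums are brought to the order ι₁, ι₂, ι₃, so that Jacobi
    -- can be checked term by term.
    rw [sum_rotate (α := ι₂), ← sum_rotate (γ := ι₃), ← Finset.sum_add_distrib,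
      ← Finset.sum_add_distrib]
    refine Finset.sum_eq_zero fun i _ => ?_
    rw [← Finset.sum_add_distrib, ← Finset.sum_add_distrib]
    refine Finset.sum_eq_zero fun j _ => ?_
    rw [← Finset.sum_add_distrib, ← Finset.sum_add_distrib]
    refine Finset.sum_eq_zero fun k _ => ?_
    simp only [UnitAddTorus.mFourier_add]
    have := jacobi_bracketWave (b₁ := b₁ i) (b₂ := b₂ j) (b₃ := b₃ k) (C₁ i) (C₂ j) (C₃ k)
      (phaseProj n l x).2
    linear_combination (UnitAddTorus.mFourier (b₁ i) (phaseProj n l x).1 *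
      UnitAddTorus.mFourier (b₂ j) (phaseProj n l x).1 *
      UnitAddTorus.mFourier (b₃ k) (phaseProj n l x).1) * this
  leibniz f g h := by
    obtain ⟨l, hf, hg, hh⟩ := exists_rep₃ f g h
    obtain ⟨ι₁, _, b₁, h₁, H₁, e₁⟩ := exists_trigSum_rep f hf
    obtain ⟨ι₂, _, b₂, h₂, H₂, e₂⟩ := exists_trigSum_rep g hg
    obtain ⟨ι₃, _, b₃, h₃, H₃, e₃⟩ := exists_trigSum_rep h hh
    have C₁ := fun i => (H₁ i).contDiff
    have C₂ := fun i => (H₂ i).contDiff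
    have C₃ := fun i => (H₃ i).contDiff
    have hgh : ∃ k ∈ latticeAlgebra n l, (g * h).1 = k.compContinuous (phaseProj n l) := by
      obtain ⟨g', hg, hg'⟩ := hg
      obtain ⟨h', hh, hh'⟩ := hh
      exact ⟨g' * h', mul_mem_latticeAlgebra hg hh, by
        change g.1 * h.1 = _
        rw [hg', hh']
        rfl⟩
    refine Subtype.ext (BoundedContinuousFunction.ext fun x => ?_)
    change _ = (continuumBracket f g).1 x * h.1 x + g.1 x * (continuumBracket f h).1 x
    rw [continuumBracket_apply b₁ C₁ b₂ C₂ hf hg e₁ e₂,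
      continuumBracket_apply b₁ C₁ b₃ C₃ hf hh e₁ e₃,
      continuumBracket_apply (G := g * h) b₁ C₁ (fun i : ι₂ × ι₃ => b₂ i.1 + b₃ i.2)
        (h' := fun i p => h₂ i.1 p * h₃ i.2 p) (fun i => ((H₂ i.1).mul (H₃ i.2)).contDiff) hf hgh e₁
        (fun x => by
          change g.1 x * h.1 x = _
          rw [e₂, e₃, trigSum_mul]), e₂, e₃, trigSum_mul, trigSum_mul]
    simp only [trigSum, Fintype.sum_prod_type]
    conv_rhs => arg 2; rw [Finset.sum_comm]
    rw [← Finset.sum_add_distrib]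
    refine Finset.sum_congr rfl fun i _ => ?_
    rw [← Finset.sum_add_distrib]
    refine Finset.sum_congr rfl fun j _ => ?_
    rw [← Finset.sum_add_distrib]
    refine Finset.sum_congr rfl fun k _ => ?_
    simp only [UnitAddTorus.mFourier_add, bracketWave, intMom_add, waveDeriv_add]
    rw [waveDeriv_mul (H₂ j).differentiable (H₃ k).differentiable]
    ring
  star_bracket f g := by
    obtain ⟨l, hf, hg⟩ := exists_rep₂ f g
    obtain ⟨ι₁, _, b₁, h₁, H₁, e₁⟩ := exists_trigSum_rep f hf
    obtain ⟨ι₂, _, b₂, h₂, H₂, e₂⟩ := exists_trigSum_rep g hg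
    have hstar : ∀ f : classicalAlgebra n D,
        (∃ k ∈ latticeAlgebra n l, f.1 = k.compContinuous (phaseProj n l)) →
        ∃ k ∈ latticeAlgebra n l, (star f).1 = k.compContinuous (phaseProj n l) := by
      rintro f ⟨f', hf, hf'⟩
      exact ⟨star f', star_mem_latticeAlgebra hf, by
        change star f.1 = _
        rw [hf']
        rfl⟩
    refine Subtype.ext (BoundedContinuousFunction.ext fun x => ?_)
    change (starRingEnd ℂ) ((continuumBracket f g).1 x) = _
    rw [continuumBracket_apply b₁ (fun i => (H₁ i).contDiff) b₂ (fun i => (H₂ i).contDiff) hf hg e₁ e₂,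
      continuumBracket_apply (F := star f) (G := star g) (fun i => -b₁ i)
        (fun i => (H₁ i).conj.contDiff) (fun i => -b₂ i) (fun i => (H₂ i).conj.contDiff)
        (hstar f hf) (hstar g hg) (fun x => by
          change (starRingEnd ℂ) (f.1 x) = _
          rw [e₁, conj_trigSum]) (fun x => by
          change (starRingEnd ℂ) (g.1 x) = _
          rw [e₂, conj_trigSum]), conj_trigSum, trigSum, trigSum]
    refine Finset.sum_congr rfl fun i _ => ?_
    rw [neg_add]
    congr 1
    simp only [bracketWave, map_mul, map_sub, Complex.conj_I, Complex.conj_ofReal, intMom_neg]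
    rw [waveDeriv_conj (H₁ i.1).differentiable, waveDeriv_conj (H₂ i.2).differentiable]
    simp only [waveDeriv, map_neg]
    have : (starRingEnd ℂ) 2 = 2 := Complex.conj_ofNat 2
    rw [this]
    ring

end Poisson

/-! ### Moving frequencies into the ball by refinement -/

section OperatorSystem

variable {n D : ℕ}

theorem vectorMeasure_integrable_of_bounded {X : Type*} [MeasurableSpace X] (μ : ComplexMeasure X)
    {φ : X → ℂ} (hφ : StronglyMeasurable φ) {C : ℝ} (hC : ∀ x, ‖φ x‖ ≤ C) : μ.Integrable φ := by
  obtain ⟨ν, d, _, hd, -, rfl⟩ := exists_eq_withDensityᵥ μ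
  exact vectorMeasure_integrable_withDensityᵥ hd hφ.aestronglyMeasurable
    (hd.bdd_mul hφ.aestronglyMeasurable (ae_of_all _ hC))

/-- The transpose of the connecting map of the momenta. -/
def momMapT (n : ℕ) (l m : Lattice D) (ξ : Mom n l) : Mom n m :=
  WithLp.toLp 2 fun j => Edge.length j.1.1 *
    refineCoeff l m (fun k => ξ k / Edge.length k.1.1) j

theorem inner_momMapT (l m : Lattice D) (ξ : Mom n l) (p : Mom n m) :
    inner ℝ (momMapT n l m ξ) p = inner ℝ ξ (momMap n l m p) := by
  have h1 : inner ℝ (momMapT n l m ξ) p = ∑ i, ∑ e', p (e', i) * (Edge.length e'.1 *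
      refineCoeff l m (fun k => ξ k / Edge.length k.1.1) (e', i)) := by
    rw [PiLp.inner_apply, Fintype.sum_prod_type_right]
    rfl
  rw [h1, PiLp.inner_apply, Fintype.sum_prod_type_right]
  refine Finset.sum_congr rfl fun i _ => ?_
  rw [sum_refineCoeff (fun k => ξ k / Edge.length k.1.1) i
    (fun x e' => p (e', i) * (Edge.length e'.1 * x)) (by simp)]
  refine Finset.sum_congr rfl fun e _ => ?_
  change _ = momMap n l m p (e, i) * ξ (e, i)
  rw [momMap_apply, Finset.sum_mul]
  refine Finset.sum_congr rfl fun e' _ => ?_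
  ring

theorem continuous_momMapT (l m : Lattice D) : Continuous (momMapT n l m) := by
  classical
  refine (PiLp.continuous_toLp 2 _).comp (continuous_pi fun j => continuous_const.mul ?_)
  refine continuous_finsetSum _ fun e _ => ?_
  split_ifs
  · fun_prop
  · exact continuous_const

/-- The transpose multiplies the block of ξ at e by d_{e'}/d_e on each piece e', and is 0 on edges
that are not pieces. So short pieces give small frequencies. -/
theorem momMapT_mem_ballB {l m : Lattice D} {ξ : Mom n l} {c r : ℝ} (hc : 0 ≤ c)
    (hcr : c * r < 1 / (2 * Real.pi))
    (hξ : ∀ e : l.edges, ‖(WithLp.toLp 2 fun i => ξ (e, i) : EuclideanSpace ℝ (Fin n))‖ ≤ r)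
    (hm : ∀ e ∈ l.edges, ∀ e' ∈ pieces m e, Edge.length e'.1 ≤ c * Edge.length e) :
    momMapT n l m ξ ∈ ballB n m := by
  classical
  intro e'
  by_cases h : ∃ e : l.edges, e' ∈ pieces m e.1
  · obtain ⟨e, he⟩ := h
    have h1 : (WithLp.toLp 2 fun i => momMapT n l m ξ (e', i) : EuclideanSpace ℝ (Fin n)) =
        (Edge.length e'.1 / Edge.length e.1) •
          (WithLp.toLp 2 fun i => ξ (e, i) : EuclideanSpace ℝ (Fin n)) := by
      ext i
      change Edge.length e'.1 * refineCoeff l m (fun k => ξ k / Edge.length k.1.1) (e', i) =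
        Edge.length e'.1 / Edge.length e.1 * ξ (e, i)
      rw [refineCoeff_of_mem _ he]
      ring
    have h2 := l.length_pos e.2
    have h3 : Edge.length e'.1 / Edge.length e.1 ≤ c := (div_le_iff₀ h2).mpr (hm e.1 e.2 e' he)
    have h4 : 0 ≤ Edge.length e'.1 / Edge.length e.1 :=
      div_nonneg (m.length_pos e'.2).le h2.le
    rw [h1, norm_smul, Real.norm_of_nonneg h4]
    exact (mul_le_mul h3 (hξ e) (norm_nonneg _) hc).trans_lt hcr
  · push Not at h
    have h1 : (WithLp.toLp 2 fun i => momMapT n l m ξ (e', i) : EuclideanSpace ℝ (Fin n)) = 0 := by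
      ext i
      change Edge.length e'.1 * refineCoeff l m (fun k => ξ k / Edge.length k.1.1) (e', i) = 0
      have h0 : refineCoeff l m (fun k => ξ k / Edge.length k.1.1) (e', i) = 0 :=
        Finset.sum_eq_zero fun e _ => if_neg (h e)
      rw [h0, mul_zero]
    rw [h1, norm_zero]
    positivity

theorem norm_block_le {l : Lattice D} (ξ : Mom n l) (e : l.edges) :
    ‖(WithLp.toLp 2 fun i => ξ (e, i) : EuclideanSpace ℝ (Fin n))‖ ≤ ‖ξ‖ := by
  rw [EuclideanSpace.norm_eq, EuclideanSpace.norm_eq, Fintype.sum_prod_type]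
  exact Real.sqrt_le_sqrt (Finset.single_le_sum (f := fun e => ∑ i, ‖ξ (e, i)‖ ^ 2)
    (fun _ _ => Finset.sum_nonneg fun _ _ => by positivity) (Finset.mem_univ e))

theorem operatorSystem_le (n : ℕ) (l : Lattice D) : operatorSystem n l ≤ latticeAlgebra n l :=
  Submodule.span_le.mpr fun _ hf => hf.1

theorem compContinuous_phaseMap_mem_operatorSystem {l m : Lattice D} (hlm : l ≤ m)
    {f : BoundedContinuousFunction (Phase n l) ℂ} (hf : f ∈ operatorSystem n l) :
    f.compContinuous (phaseMap n l m) ∈ operatorSystem n m := by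
  induction hf using Submodule.span_induction with
  | zero => exact Submodule.zero_mem _
  | add f g _ _ ihf ihg => exact Submodule.add_mem _ ihf ihg
  | smul c f _ ih => exact Submodule.smul_mem _ c ih
  | mem f hf =>
    obtain ⟨hf, g, μ, ⟨K, hK, hKB, hKμ⟩, hfx⟩ := hf
    refine Submodule.subset_span ⟨compContinuous_phaseMap_mem hlm hf,
      g.comp ⟨confMap n l m, continuous_confMap n l m⟩, μ.map (momMapT n l m),
      ⟨momMapT n l m '' K, hK.image (continuous_momMapT l m), ?_, fun s hs hdis => ?_⟩,
      fun q p => ?_⟩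
    · rintro _ ⟨ξ, hξ, rfl⟩
      -- A single bound r, strictly below the radius, is needed for all blocks. The largest block
      -- norm serves, and 0 if there are no edges.
      rcases isEmpty_or_nonempty l.edges with hl | hl
      · exact momMapT_mem_ballB (c := 1) (r := 0) zero_le_one (by rw [mul_zero]; positivity)
          (fun e => hl.elim e) fun e he e' he' => by
            rw [one_mul]; exact length_le_of_mem_pieces hlm he he'
      · obtain ⟨e₀, he₀⟩ := Finite.exists_max fun e : l.edges =>
          ‖(WithLp.toLp 2 fun i => ξ (e, i) : EuclideanSpace ℝ (Fin n))‖
        exact momMapT_mem_ballB (c := 1) zero_le_one (by rw [one_mul]; exact hKB hξ e₀) he₀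
          fun e he e' he' => by rw [one_mul]; exact length_le_of_mem_pieces hlm he he'
    · rw [VectorMeasure.map_apply _ (continuous_momMapT l m).measurable hs]
      refine hKμ _ ((continuous_momMapT l m).measurable hs) ?_
      rw [Set.disjoint_left]
      exact fun ξ hξ hξK => Set.disjoint_left.mp hdis hξ ⟨ξ, hξK, rfl⟩
    · change f (confMap n l m q, momMap n l m p) = g (confMap n l m q) * _
      rw [hfx]
      congr 1
      have hc : Continuous fun ξ : Mom n m => Complex.exp (Complex.I * (inner ℝ ξ p : ℝ)) := by
        fun_prop
      have h1 : μ.Integrable ((fun ξ : Mom n m => Complex.exp (Complex.I * (inner ℝ ξ p : ℝ))) ∘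
          momMapT n l m) := vectorMeasure_integrable_of_bounded μ
        (hc.comp (continuous_momMapT l m)).stronglyMeasurable (C := 1) fun ξ =>
          (Complex.norm_exp_I_mul_ofReal _).le
      rw [invFourier, invFourier, cintegral, cintegral,
        VectorMeasure.integral_map (continuous_momMapT l m).measurable hc.aestronglyMeasurable h1]
      simp_rw [inner_momMapT]

/-- The momentum factors of F are superpositions of frequencies of norm at most some r. On a
refinement whose pieces have at most the fraction 1/N of each edge, with N > 2πr, the transposed
frequencies have blocks of norm below 1/(2π). Thus the restriction to B^l disappears in the limit.
-/
theorem exists_operatorSystem_rep (F : classicalAlgebra n D) : ∃ l : Lattice D,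
    ∃ f ∈ operatorSystem n l, F.1 = f.compContinuous (phaseProj n l) := by
  obtain ⟨l, f, hf, hF⟩ := exists_rep F
  obtain ⟨ι, _, b, h, H, hfx⟩ := exists_trigSum_of_mem hf
  choose X _ ν _ d s R hd hs hR hh using fun i => (H i).bandLimited
  obtain ⟨r, hr⟩ : ∃ r : ℝ, ∀ i, R i ≤ r := by
    obtain ⟨r, hr⟩ := (Set.finite_range R).bddAbove
    exact ⟨r, fun i => hr ⟨i, rfl⟩⟩
  -- The maximum with 1 only ensures N > 0.
  obtain ⟨N, hN⟩ := exists_nat_gt (max r 1 * (2 * Real.pi))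
  have hπ := Real.pi_pos
  have hN0 : (0 : ℝ) < N := lt_of_le_of_lt (by positivity) hN
  obtain ⟨m, hlm, hm⟩ := exists_fine_refinement l N (Nat.cast_pos.mp hN0)
  have hball : ∀ ξ : Mom n l, ‖ξ‖ ≤ r → momMapT n l m ξ ∈ ballB n m := by
    intro ξ hξ
    refine momMapT_mem_ballB (c := 1 / N) (r := max r 1) (by positivity) ?_
      (fun e => (norm_block_le ξ e).trans (hξ.trans (le_max_left _ _))) fun e he e' he' => ?_
    · rw [one_div_mul_eq_div, div_lt_div_iff₀ hN0 (by positivity)]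
      linarith
    · rw [one_div_mul_eq_div]
      exact hm e he e' he'
  have hμ : ∀ i, ∃ μ : ComplexMeasure (Mom n m), SupportedInBall μ ∧ ∀ p, invFourier μ p =
      h i (momMapL n l m p) := by
    intro i
    obtain ⟨μ, hμ, hμp⟩ := exists_invFourier_eq (hd i)
      ((continuous_momMapT l m).measurable.comp (hs i))
      ((isCompact_closedBall (0 : Mom n l) r).image (continuous_momMapT (n := n) l m))
      (by
        rintro _ ⟨ξ, hξ, rfl⟩
        exact hball ξ (mem_closedBall_zero_iff.mp hξ))
      fun x => ⟨s i x, mem_closedBall_zero_iff.mpr ((hR i x).trans (hr i)), rfl⟩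
    refine ⟨μ, hμ, fun p => ?_⟩
    rw [hμp, hh i]
    simp only [Function.comp, inner_momMapT]
    rfl
  choose μ hμ hμp using hμ
  choose k hk hkx using fun i => exists_eq_mFourier_mul (refineCoeff l m (b i))
    ((H i).comp_linear (momMapL n l m))
  refine ⟨m, ∑ i, k i, Submodule.sum_mem _ fun i _ => Submodule.subset_span ⟨hk i,
    UnitAddTorus.mFourier _, μ i, hμ i, fun q p => by rw [hkx, hμp]⟩, ?_⟩
  refine BoundedContinuousFunction.ext fun x => ?_
  rw [hF]
  change f (phaseProj n l x) = (∑ i, k i) (phaseProj n m x)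
  rw [hfx, ← phaseMap_phaseProj hlm, trigSum_phaseMap hlm, BoundedContinuousFunction.sum_apply,
    trigSum]
  exact Finset.sum_congr rfl fun i _ => (hkx i _).symm

theorem nonempty_expansion {l : Lattice D} {f : BoundedContinuousFunction (Phase n l) ℂ}
    (hf : f ∈ operatorSystem n l) : Nonempty (Expansion f) := by
  obtain ⟨K, c, F, rfl⟩ := Submodule.mem_span_set'.mp hf
  choose h1 g μ hμ hF using fun i => (F i).2
  refine ⟨K, fun i => c i • g i, μ, hμ, fun q p => ?_⟩
  rw [BoundedContinuousFunction.sum_apply]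
  refine Finset.sum_congr rfl fun i _ => ?_
  rw [BoundedContinuousFunction.smul_apply, hF i, ContinuousMap.smul_apply, smul_eq_mul,
    smul_eq_mul, mul_assoc]

end OperatorSystem

/-! ### The integral formula on all of ℋ^l -/

section LatticeFormula

variable {n D : ℕ} {l : Lattice D}

instance isFiniteMeasure_variation {X : Type*} [MeasurableSpace X] (μ : ComplexMeasure X) :
    IsFiniteMeasure μ.variation := by
  obtain ⟨ν, d, _, hd, -, rfl⟩ := exists_eq_withDensityᵥ μ
  rw [Measure.variation_withDensityᵥ hd]
  exact ⟨by simpa using! hd.2⟩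

theorem enorm_cintegral_le {X : Type*} [MeasurableSpace X] (μ : ComplexMeasure X) (φ : X → ℂ) :
    ‖cintegral μ φ‖ₑ ≤ ∫⁻ x, ‖φ x‖ₑ ∂μ.variation := by
  refine (VectorMeasure.enorm_integral_le_lintegral_enorm).trans ?_
  have h1 : ‖ContinuousLinearMap.mul ℝ ℂ‖ₑ = 1 := by
    rw [enorm_eq_nnnorm, ENNReal.coe_eq_one, ← NNReal.coe_inj, coe_nnnorm,
      ContinuousLinearMap.opNorm_mul, NNReal.coe_one]
  rw [h1, one_mul]

theorem continuous_toConf : Continuous (toConf : Mom n l → Conf n l) :=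
  continuous_pi fun j => (AddCircle.continuous_mk' 1).comp
    ((continuous_apply j).comp (PiLp.continuous_ofLp 2 _))

theorem measurable_comp_shift {u : Conf n l → ℂ} (hu : Measurable u) (t : ℝ) :
    Measurable fun z : Conf n l × Mom n l => u (z.1 + toConf (t • z.2)) :=
  hu.comp (measurable_fst.add
    ((continuous_toConf.comp (continuous_const_smul t)).measurable.comp measurable_snd))

/-- The right-hand side of the quantization formula, for an arbitrary function `u`. -/
def shiftIntegral {K : ℕ} (ℏ : ℝ) (g : Fin K → C(Conf n l, ℂ)) (μ : Fin K → ComplexMeasure (Mom n l))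
    (u : Conf n l → ℂ) (y : Conf n l) : ℂ :=
  ∑ k, cintegral (μ k) fun ξ => g k (y + toConf ((ℏ / 2) • ξ)) * u (y + toConf (ℏ • ξ))

variable {K : ℕ} (ℏ : ℝ) (g : Fin K → C(Conf n l, ℂ)) (μ : Fin K → ComplexMeasure (Mom n l))

/-- Tonelli's theorem and translation invariance of Haar measure. The bound is in L¹, where it needs
no Minkowski inequality and still suffices to identify functions almost everywhere. -/
theorem lintegral_lintegral_shift_le {u : Conf n l → ℂ} (hu : StronglyMeasurable u) (k : Fin K) :
    ∫⁻ y, ∫⁻ ξ, ‖g k (y + toConf ((ℏ / 2) • ξ)) * u (y + toConf (ℏ • ξ))‖ₑ ∂(μ k).variation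
      ∂(confHaar n l) ≤ ‖g k‖ₑ * (μ k).variation Set.univ * ∫⁻ y, ‖u y‖ₑ ∂(confHaar n l) := by
  have hm := (measurable_comp_shift hu.measurable ℏ).enorm
  calc _ ≤ ∫⁻ y, ∫⁻ ξ, ‖g k‖ₑ * ‖u (y + toConf (ℏ • ξ))‖ₑ ∂(μ k).variation ∂(confHaar n l) := by
        refine lintegral_mono fun y => lintegral_mono fun ξ => ?_
        simp only [enorm_mul]
        gcongr
        exact enorm_le_iff_norm_le.mpr ((g k).norm_coe_le_norm _)
    _ = ∫⁻ ξ, ∫⁻ y, ‖g k‖ₑ * ‖u (y + toConf (ℏ • ξ))‖ₑ ∂(confHaar n l) ∂(μ k).variation :=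
        lintegral_lintegral_swap (hm.const_mul _).aemeasurable
    _ = ∫⁻ _, ‖g k‖ₑ * ∫⁻ y, ‖u y‖ₑ ∂(confHaar n l) ∂(μ k).variation := by
        refine lintegral_congr fun ξ => ?_
        have h1 : Measurable fun y => ‖u (y + toConf (ℏ • ξ))‖ₑ :=
          (hu.measurable.comp (measurable_id.add_const _)).enorm
        rw [lintegral_const_mul _ h1, lintegral_add_right_eq_self (fun y => ‖u y‖ₑ)]
    _ = _ := by
        rw [lintegral_const]
        ring
    _ ≤ _ := le_rfl

theorem lintegral_shiftIntegral_le {u : Conf n l → ℂ} (hu : StronglyMeasurable u) :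
    ∫⁻ y, ‖shiftIntegral ℏ g μ u y‖ₑ ∂(confHaar n l) ≤
      (∑ k, ‖g k‖ₑ * (μ k).variation Set.univ) * ∫⁻ y, ‖u y‖ₑ ∂(confHaar n l) := by
  have hm : ∀ k, Measurable fun z : Conf n l × Mom n l =>
      ‖g k (z.1 + toConf ((ℏ / 2) • z.2)) * u (z.1 + toConf (ℏ • z.2))‖ₑ := fun k => by
    exact ((measurable_comp_shift (g k).continuous.measurable (ℏ / 2)).mul
      (measurable_comp_shift hu.measurable ℏ)).enorm
  calc _ ≤ ∫⁻ y, ∑ k, ∫⁻ ξ, ‖g k (y + toConf ((ℏ / 2) • ξ)) * u (y + toConf (ℏ • ξ))‖ₑ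
          ∂(μ k).variation ∂(confHaar n l) := by
        refine lintegral_mono fun y => (enorm_sum_le _ _).trans ?_
        exact Finset.sum_le_sum fun k _ => enorm_cintegral_le _ _
    _ = ∑ k, ∫⁻ y, ∫⁻ ξ, ‖g k (y + toConf ((ℏ / 2) • ξ)) * u (y + toConf (ℏ • ξ))‖ₑ
          ∂(μ k).variation ∂(confHaar n l) :=
        lintegral_finsetSum _ fun k _ => (hm k).lintegral_prod_right'
    _ ≤ _ := by
        rw [Finset.sum_mul]
        exact Finset.sum_le_sum fun k _ => lintegral_lintegral_shift_le ℏ g μ hu k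

theorem ae_integrable_shift {u : Conf n l → ℂ} (hu : StronglyMeasurable u)
    (hui : Integrable u (confHaar n l)) : ∀ᵐ y ∂(confHaar n l), ∀ k, (μ k).Integrable fun ξ =>
      g k (y + toConf ((ℏ / 2) • ξ)) * u (y + toConf (ℏ • ξ)) := by
  rw [ae_all_iff]
  intro k
  have hm : Measurable fun z : Conf n l × Mom n l =>
      g k (z.1 + toConf ((ℏ / 2) • z.2)) * u (z.1 + toConf (ℏ • z.2)) :=
    (measurable_comp_shift (g k).continuous.measurable (ℏ / 2)).mul
      (measurable_comp_shift hu.measurable ℏ)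
  have hlt : ∫⁻ y, ∫⁻ ξ, ‖g k (y + toConf ((ℏ / 2) • ξ)) * u (y + toConf (ℏ • ξ))‖ₑ
      ∂(μ k).variation ∂(confHaar n l) ≠ ⊤ :=
    ((lintegral_lintegral_shift_le ℏ g μ hu k).trans_lt (ENNReal.mul_lt_top
      (ENNReal.mul_lt_top enorm_lt_top (measure_lt_top _ _)) hui.2)).ne
  filter_upwards [ae_lt_top hm.enorm.lintegral_prod_right' hlt] with y hy
  exact ⟨(hm.comp measurable_prodMk_left).aestronglyMeasurable, hy⟩

/-- Measurability in y is inherited from a parametric Bochner integral: with densities the two agree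
for every y at which the integrals exist, hence almost everywhere. -/
theorem aestronglyMeasurable_shiftIntegral {u : Conf n l → ℂ} (hu : StronglyMeasurable u)
    (hui : Integrable u (confHaar n l)) :
    AEStronglyMeasurable (shiftIntegral ℏ g μ u) (confHaar n l) := by
  choose ν d _ hd hdm hμ using fun k => exists_eq_withDensityᵥ (μ k)
  refine ⟨fun y => ∑ k, ∫ ξ, g k (y + toConf ((ℏ / 2) • ξ)) * u (y + toConf (ℏ • ξ)) * d k ξ ∂(ν k),
    ?_, ?_⟩
  · refine Finset.stronglyMeasurable_fun_sum _ fun k _ => ?_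
    exact (((measurable_comp_shift (g k).continuous.measurable (ℏ / 2)).mul
      (measurable_comp_shift hu.measurable ℏ)).mul
        ((hdm k).comp measurable_snd)).stronglyMeasurable.integral_prod_right'
  · filter_upwards [ae_integrable_shift ℏ g μ hu hui] with y hy
    rw [shiftIntegral]
    refine Finset.sum_congr rfl fun k _ => ?_
    have h1 := hy k
    rw [hμ k] at h1 ⊢
    exact cintegral_withDensityᵥ (hd k) (hdm k) h1

theorem shiftIntegral_add_ae {u v : Conf n l → ℂ} (hu : StronglyMeasurable u)
    (hui : Integrable u (confHaar n l)) (hv : StronglyMeasurable v)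
    (hvi : Integrable v (confHaar n l)) : ∀ᵐ y ∂(confHaar n l),
      shiftIntegral ℏ g μ (fun y => u y + v y) y =
        shiftIntegral ℏ g μ u y + shiftIntegral ℏ g μ v y := by
  filter_upwards [ae_integrable_shift ℏ g μ hu hui, ae_integrable_shift ℏ g μ hv hvi] with y h1 h2
  simp only [shiftIntegral]
  rw [← Finset.sum_add_distrib]
  refine Finset.sum_congr rfl fun k _ => ?_
  simp only [mul_add]
  exact VectorMeasure.integral_fun_add (h1 k) (h2 k)

theorem cintegral_const_mul {X : Type*} [MeasurableSpace X] (μ : ComplexMeasure X) {φ : X → ℂ}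
    (hφ : StronglyMeasurable φ) {C : ℝ} (hC : ∀ x, ‖φ x‖ ≤ C) (c : ℂ) :
    cintegral μ (fun x => c * φ x) = c * cintegral μ φ := by
  have h1 := vectorMeasure_integrable_of_bounded μ hφ hC
  have h2 := vectorMeasure_integrable_of_bounded μ (hφ.const_mul c) (C := ‖c‖ * C) fun x => by
    rw [norm_mul]
    exact mul_le_mul_of_nonneg_left (hC x) (norm_nonneg _)
  obtain ⟨ν, d, _, hd, hdm, rfl⟩ := exists_eq_withDensityᵥ μ
  rw [cintegral_withDensityᵥ hd hdm h1, cintegral_withDensityᵥ hd hdm h2, ← integral_const_mul]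
  simp only [mul_assoc]

theorem stronglyMeasurable_shift (u : C(Conf n l, ℂ)) (k : Fin K) (y : Conf n l) :
    StronglyMeasurable fun ξ => g k (y + toConf ((ℏ / 2) • ξ)) * u (y + toConf (ℏ • ξ)) := by
  have := continuous_toConf (n := n) (l := l)
  exact (Continuous.mul (by fun_prop) (by fun_prop)).stronglyMeasurable

theorem norm_shift_le (u : C(Conf n l, ℂ)) (k : Fin K) (y : Conf n l) (ξ : Mom n l) :
    ‖g k (y + toConf ((ℏ / 2) • ξ)) * u (y + toConf (ℏ • ξ))‖ ≤ ‖g k‖ * ‖u‖ := by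
  rw [norm_mul]
  exact mul_le_mul ((g k).norm_coe_le_norm _) (u.norm_coe_le_norm _) (norm_nonneg _) (norm_nonneg _)

theorem shiftIntegral_sum {ι : Type*} (s : Finset ι) (c : ι → ℂ) (u : ι → C(Conf n l, ℂ))
    (y : Conf n l) : shiftIntegral ℏ g μ (fun y => ∑ a ∈ s, c a * u a y) y =
      ∑ a ∈ s, c a * shiftIntegral ℏ g μ (u a) y := by
  simp only [shiftIntegral, Finset.mul_sum]
  rw [Finset.sum_comm]
  refine Finset.sum_congr rfl fun k _ => ?_
  have h1 : ∀ a, cintegral (μ k) (fun ξ => g k (y + toConf ((ℏ / 2) • ξ)) *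
      (c a * u a (y + toConf (ℏ • ξ)))) = c a * cintegral (μ k) fun ξ =>
        g k (y + toConf ((ℏ / 2) • ξ)) * u a (y + toConf (ℏ • ξ)) := fun a => by
    rw [← cintegral_const_mul (μ k) (stronglyMeasurable_shift ℏ g (u a) k y)
      (norm_shift_le ℏ g (u a) k y)]
    congr 1
    ext ξ
    ring
  simp only [← h1]
  refine VectorMeasure.integral_finsetSum s fun a _ => ?_
  refine vectorMeasure_integrable_of_bounded (μ k)
    (stronglyMeasurable_shift ℏ g (c a • u a) k y) (norm_shift_le ℏ g (c a • u a) k y)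

/-- An operator that satisfies the quantization formula on the Fourier modes satisfies it on all
of `ℋ^l`. -/
theorem ae_eq_shiftIntegral (T : LatticeHilbert n l →L[ℂ] LatticeHilbert n l)
    (hT : ∀ a, (T (latticeBasis n l a) : Conf n l → ℂ) =ᵐ[confHaar n l]
      shiftIntegral ℏ g μ (UnitAddTorus.mFourier a)) (ψ : LatticeHilbert n l) :
    (T ψ : Conf n l → ℂ) =ᵐ[confHaar n l] shiftIntegral ℏ g μ ψ := by
  -- The Haar measure is a probability measure, so the L¹ norm is at most the L² norm.
  have hL1 : ∀ φ : LatticeHilbert n l, ∫⁻ y, ‖φ y‖ₑ ∂(confHaar n l) ≤ ‖φ‖ₑ := by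
    intro φ
    rw [← eLpNorm_one_eq_lintegral_enorm, Lp.enorm_def]
    exact eLpNorm_le_eLpNorm_of_exponent_le (by norm_num) (Lp.aestronglyMeasurable φ)
  set C := ∑ k, ‖g k‖ₑ * (μ k).variation Set.univ with hC
  have hCt : C ≠ ⊤ := by
    refine (ENNReal.sum_lt_top.mpr fun k _ => ?_).ne
    exact ENNReal.mul_lt_top enorm_lt_top (measure_lt_top _ _)
  -- ψ is approximated in L² by a trigonometric polynomial p, for which the formula holds. What
  -- remains is the formula's defect on ψ - p, bounded in L¹ by the norm of T and by the total
  -- variations.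
  have key : ∀ ε : ℝ≥0∞, ε ≠ 0 → ∫⁻ y, ‖(T ψ : Conf n l → ℂ) y - shiftIntegral ℏ g μ ψ y‖ₑ
      ∂(confHaar n l) ≤ ‖T‖ₑ * ε + C * ε := by
    intro ε hε
    have hdense : ψ ∈ closure (Submodule.span ℂ (Set.range (latticeBasis n l)) : Set _) := by
      have := (latticeBasis n l).dense_span
      rw [← Submodule.topologicalClosure_coe, this]
      trivial
    obtain ⟨p, hp, hpε⟩ := EMetric.mem_closure_iff.mp hdense ε (pos_iff_ne_zero.mpr hε)
    obtain ⟨s, c, rfl⟩ := exists_eq_sum_of_mem_span (latticeBasis n l) hp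
    set p : LatticeHilbert n l := ∑ a ∈ s, c a • latticeBasis n l a with hpdef
    set P : Conf n l → ℂ := fun y => ∑ a ∈ s, c a * UnitAddTorus.mFourier a y with hPdef
    have hPc : Continuous P := by fun_prop
    have hpP : (p : Conf n l → ℂ) =ᵐ[confHaar n l] P := by
      have h1 : ∀ a ∈ s, (c a • latticeBasis n l a : LatticeHilbert n l) =ᵐ[confHaar n l]
          fun y => c a * UnitAddTorus.mFourier a y := fun a _ => by
        filter_upwards [Lp.coeFn_smul (c a) (latticeBasis n l a), coeFn_latticeBasis l a]
          with y h1 h2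
        rw [h1, Pi.smul_apply, h2, smul_eq_mul]
      filter_upwards [Lp.coeFn_finsetSum s fun a => c a • latticeBasis n l a,
        (Finset.eventually_all s).mpr h1] with y h2 h3
      rw [hpdef, h2, Finset.sum_apply]
      exact Finset.sum_congr rfl h3
    have hTp : (T p : Conf n l → ℂ) =ᵐ[confHaar n l] shiftIntegral ℏ g μ P := by
      have h1 : ∀ a ∈ s, (c a • T (latticeBasis n l a) : LatticeHilbert n l) =ᵐ[confHaar n l]
          fun y => c a * shiftIntegral ℏ g μ (UnitAddTorus.mFourier a) y := fun a _ => by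
        filter_upwards [Lp.coeFn_smul (c a) (T (latticeBasis n l a)), hT a] with y h1 h2
        rw [h1, Pi.smul_apply, h2, smul_eq_mul]
      rw [hpdef, map_sum]
      simp only [map_smul]
      filter_upwards [Lp.coeFn_finsetSum s fun a => c a • T (latticeBasis n l a),
        (Finset.eventually_all s).mpr h1] with y h2 h3
      rw [h2, Finset.sum_apply, hPdef, shiftIntegral_sum]
      exact Finset.sum_congr rfl h3
    have hψm := Lp.stronglyMeasurable ψ
    have hψi : Integrable ψ (confHaar n l) := (Lp.memLp ψ).integrable (by norm_num)
    have hPi : Integrable P (confHaar n l) :=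
      (hPc.integrable_of_hasCompactSupport (HasCompactSupport.of_compactSpace P))
    set u : Conf n l → ℂ := fun y => ψ y - P y with hu
    have hum : StronglyMeasurable u := hψm.sub hPc.stronglyMeasurable
    have hui : Integrable u (confHaar n l) := hψi.sub hPi
    have hsplit : ∀ᵐ y ∂(confHaar n l), (T ψ : Conf n l → ℂ) y - shiftIntegral ℏ g μ ψ y =
        (T (ψ - p) : Conf n l → ℂ) y - shiftIntegral ℏ g μ u y := by
      have h1 : (⇑ψ : Conf n l → ℂ) = fun y => u y + P y := by ext y; simp [hu]
      rw [map_sub]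
      filter_upwards [shiftIntegral_add_ae ℏ g μ hum hui hPc.stronglyMeasurable hPi, hTp,
        Lp.coeFn_sub (T ψ) (T p)] with y h2 h3 h4
      rw [h4, Pi.sub_apply, h3]
      conv_lhs => rw [h1, h2]
      ring
    have hψp : ‖ψ - p‖ₑ ≤ ε := by rw [← edist_eq_enorm_sub]; exact hpε.le
    have hu1 : ∫⁻ y, ‖u y‖ₑ ∂(confHaar n l) ≤ ε := by
      refine le_trans (le_of_eq (lintegral_congr_ae ?_)) ((hL1 (ψ - p)).trans hψp)
      filter_upwards [Lp.coeFn_sub ψ p, hpP] with y h1 h2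
      rw [h1, Pi.sub_apply, h2]
    calc _ = ∫⁻ y, ‖(T (ψ - p) : Conf n l → ℂ) y - shiftIntegral ℏ g μ u y‖ₑ ∂(confHaar n l) :=
          lintegral_congr_ae (hsplit.mono fun y hy => by rw [hy])
      _ ≤ ∫⁻ y, ‖(T (ψ - p) : Conf n l → ℂ) y‖ₑ + ‖shiftIntegral ℏ g μ u y‖ₑ ∂(confHaar n l) :=
          lintegral_mono fun y => enorm_sub_le
      _ = _ := lintegral_add_left (Lp.stronglyMeasurable _).measurable.enorm _
      _ ≤ ‖T‖ₑ * ε + C * ε := by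
          refine add_le_add ((hL1 _).trans ((T.le_opENorm _).trans ?_))
            ((lintegral_shiftIntegral_le ℏ g μ hum).trans ?_)
          · gcongr
          · gcongr
  have h0 : ∫⁻ y, ‖(T ψ : Conf n l → ℂ) y - shiftIntegral ℏ g μ ψ y‖ₑ ∂(confHaar n l) = 0 := by
    have hlim : Tendsto (fun ε : ℝ≥0∞ => ‖T‖ₑ * ε + C * ε) (𝓝[>] 0) (𝓝 (‖T‖ₑ * 0 + C * 0)) :=
      ((ENNReal.Tendsto.const_mul tendsto_id (Or.inr enorm_ne_top)).add
        (ENNReal.Tendsto.const_mul tendsto_id (Or.inr hCt))).mono_left nhdsWithin_le_nhds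
    rw [mul_zero, mul_zero, add_zero] at hlim
    refine le_antisymm (ge_of_tendsto hlim ?_) zero_le
    filter_upwards [self_mem_nhdsWithin] with ε hε
    exact key ε (ne_of_gt hε)
  have hm : AEMeasurable (fun y => ‖(T ψ : Conf n l → ℂ) y - shiftIntegral ℏ g μ ψ y‖ₑ)
      (confHaar n l) :=
    ((Lp.aestronglyMeasurable (T ψ)).sub (aestronglyMeasurable_shiftIntegral ℏ g μ
      (Lp.stronglyMeasurable ψ) ((Lp.memLp ψ).integrable (by norm_num)))).enorm
  filter_upwards [(lintegral_eq_zero_iff' hm).mp h0] with y hy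
  exact sub_eq_zero.mp (enorm_eq_zero.mp hy)

end LatticeFormula

/-! ### Matrix elements between Fourier modes -/

section Modes

variable {n D : ℕ} {l : Lattice D}

/-- The inclusion of the integral vectors, as a homomorphism. -/
def intMomHom (n : ℕ) (l : Lattice D) : (l.edges × Fin n → ℤ) →+ Mom n l where
  toFun := intMom
  map_zero' := by ext j; exact Int.cast_zero
  map_add' := intMom_add

theorem intMomHom_eq (b : l.edges × Fin n → ℤ) : intMomHom n l b = charMom l (charOf l b) :=
  intMom_eq b

/-- Substituting y - ℏξ/2 for y removes the shift from g. The phases left over combine symmetrically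
in a and c, thanks to the midpoint ℏξ/2. -/
theorem integral_shift_mode (g : C(Conf n l, ℂ)) (ℏ : ℝ) (a c : l.edges × Fin n → ℤ)
    (ξ : Mom n l) :
    ∫ y, UnitAddTorus.mFourier (-c) y * (g (y + toConf ((ℏ / 2) • ξ)) *
        UnitAddTorus.mFourier a (y + toConf (ℏ • ξ))) ∂(confHaar n l) =
      (∫ y, UnitAddTorus.mFourier (a - c) y * g y ∂(confHaar n l)) *
        Complex.exp (Complex.I * (inner ℝ ξ ((Real.pi * ℏ) • intMom (a + c)) : ℝ)) := by
  rw [← integral_mul_const]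
  conv_rhs => rw [← integral_add_right_eq_self _ (toConf ((ℏ / 2) • ξ))]
  refine integral_congr_ae (ae_of_all _ fun y => ?_)
  beta_reduce
  rw [mFourier_add_toConf, mFourier_add_toConf, sub_eq_add_neg, UnitAddTorus.mFourier_add,
    intMom_add, intMom_add, intMom_neg]
  have h1 : Complex.exp (2 * Real.pi * Complex.I * (inner ℝ (intMom a) (ℏ • ξ) : ℝ)) =
      Complex.exp (2 * Real.pi * Complex.I *
        (inner ℝ (intMom a + -intMom c) ((ℏ / 2) • ξ) : ℝ)) *
      Complex.exp (Complex.I * (inner ℝ ξ ((Real.pi * ℏ) • (intMom a + intMom c)) : ℝ)) := by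
    rw [← Complex.exp_add]
    congr 1
    simp only [inner_smul_right, inner_add_right, inner_neg_right,
      real_inner_comm ξ]
    push_cast
    ring
  rw [h1]
  ring

/-- Fubini's theorem turns the phases exp(iξ · πℏ(a + c)) into the inverse Fourier transform of μ at
πℏ(a + c). The measure thus enters only through values of g ⊗ μ̌. -/
theorem integral_mode_mul_cintegral (g : C(Conf n l, ℂ)) (μ : ComplexMeasure (Mom n l)) (ℏ : ℝ)
    (a c : l.edges × Fin n → ℤ) :
    ∫ y, UnitAddTorus.mFourier (-c) y * cintegral μ (fun ξ => g (y + toConf ((ℏ / 2) • ξ)) *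
        UnitAddTorus.mFourier a (y + toConf (ℏ • ξ))) ∂(confHaar n l) =
      (∫ y, UnitAddTorus.mFourier (a - c) y * g y ∂(confHaar n l)) *
        invFourier μ ((Real.pi * ℏ) • intMom (a + c)) := by
  have h1 : ∀ y, μ.Integrable fun ξ => g (y + toConf ((ℏ / 2) • ξ)) *
      UnitAddTorus.mFourier a (y + toConf (ℏ • ξ)) := fun y =>
    vectorMeasure_integrable_of_bounded μ
      (stronglyMeasurable_shift (K := 1) ℏ (fun _ => g) (UnitAddTorus.mFourier a) 0 y)
      (norm_shift_le (K := 1) ℏ (fun _ => g) (UnitAddTorus.mFourier a) 0 y)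
  have h2 : μ.Integrable fun ξ =>
      Complex.exp (Complex.I * (inner ℝ ξ ((Real.pi * ℏ) • intMom (a + c)) : ℝ)) :=
    vectorMeasure_integrable_of_bounded μ (C := 1)
      (Continuous.stronglyMeasurable (by fun_prop)) fun ξ => by
        rw [mul_comm, Complex.norm_exp_ofReal_mul_I]
  obtain ⟨ν, d, _, hd, hdm, rfl⟩ := exists_eq_withDensityᵥ μ
  rw [invFourier, cintegral_withDensityᵥ hd hdm h2, ← integral_const_mul]
  simp only [cintegral_withDensityᵥ hd hdm (h1 _), ← integral_const_mul]
  rw [integral_integral_swap]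
  · refine integral_congr_ae (ae_of_all _ fun ξ => ?_)
    beta_reduce
    rw [← mul_assoc, ← integral_shift_mode, ← integral_mul_const]
    refine integral_congr_ae (ae_of_all _ fun y => ?_)
    beta_reduce
    ring
  · have hk : Integrable (fun z : Conf n l × Mom n l => (1 : ℂ) * d z.2)
        ((confHaar n l).prod ν) := (integrable_const (1 : ℂ)).mul_prod hd
    have hm : Measurable fun z : Conf n l × Mom n l => UnitAddTorus.mFourier (-c) z.1 *
        (g (z.1 + toConf ((ℏ / 2) • z.2)) * UnitAddTorus.mFourier a (z.1 + toConf (ℏ • z.2))) :=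
      ((UnitAddTorus.mFourier (-c)).continuous.measurable.comp measurable_fst).mul
        ((measurable_comp_shift g.continuous.measurable (ℏ / 2)).mul
          (measurable_comp_shift (UnitAddTorus.mFourier a).continuous.measurable ℏ))
    refine (hk.bdd_mul hm.aestronglyMeasurable (c := ‖g‖) (ae_of_all _ fun z => ?_)).congr
      (ae_of_all _ fun z => ?_)
    · rw [norm_mul, norm_mul, norm_mFourier_apply, norm_mFourier_apply, one_mul, mul_one]
      exact g.norm_coe_le_norm _
    · simp only [Function.uncurry]
      ring

theorem integral_mFourier (c : l.edges × Fin n → ℤ) [Decidable (c = 0)] :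
    ∫ y, UnitAddTorus.mFourier c y ∂(confHaar n l) = if c = 0 then 1 else 0 := by
  classical
  have h := orthonormal_iff_ite.mp (latticeBasis n l).orthonormal (0 : l.edges × Fin n → ℤ) c
  rw [latticeBasis_apply, latticeBasis_apply, ContinuousMap.inner_toLp] at h
  simp only [UnitAddTorus.mFourier_zero, ContinuousMap.one_apply, map_one, mul_one] at h
  rw [h]
  simp only [eq_comm]

theorem memLp_cintegral_shift (g u : C(Conf n l, ℂ)) (μ : ComplexMeasure (Mom n l)) (ℏ : ℝ)
    (p : ℝ≥0∞) : MemLp (fun y => cintegral μ fun ξ => g (y + toConf ((ℏ / 2) • ξ)) *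
      u (y + toConf (ℏ • ξ))) p (confHaar n l) := by
  have hb : ∀ y, ‖cintegral μ fun ξ => g (y + toConf ((ℏ / 2) • ξ)) * u (y + toConf (ℏ • ξ))‖ₑ ≤
      ‖g‖ₑ * ‖u‖ₑ * μ.variation Set.univ := fun y => by
    refine (enorm_cintegral_le _ _).trans ?_
    rw [← lintegral_const]
    refine lintegral_mono fun ξ => ?_
    rw [enorm_mul]
    exact mul_le_mul' (enorm_le_iff_norm_le.mpr (g.norm_coe_le_norm _))
      (enorm_le_iff_norm_le.mpr (u.norm_coe_le_norm _))
  have hm : AEStronglyMeasurable (fun y => cintegral μ fun ξ => g (y + toConf ((ℏ / 2) • ξ)) *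
      u (y + toConf (ℏ • ξ))) (confHaar n l) :=
    (aestronglyMeasurable_shiftIntegral (K := 1) ℏ (fun _ => g) (fun _ => μ)
      u.continuous.stronglyMeasurable (u.continuous.integrable_of_hasCompactSupport
        (HasCompactSupport.of_compactSpace _))).congr (ae_of_all _ fun y => by simp [shiftIntegral])
  refine MemLp.of_bound hm (‖g‖ₑ * ‖u‖ₑ * μ.variation Set.univ).toReal (ae_of_all _ fun y => ?_)
  rw [← toReal_enorm]
  exact ENNReal.toReal_mono (ENNReal.mul_lt_top (ENNReal.mul_lt_top enorm_lt_top enorm_lt_top)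
    (measure_lt_top _ _)).ne (hb y)

/-- The operators `Q_ℏ^l(f)` on Fourier modes. -/
theorem fibreOp_latticeBasis_ae_eq {f : BoundedContinuousFunction (Phase n l) ℂ} {ι : Type}
    [Fintype ι] {b : ι → l.edges × Fin n → ℤ} {h : ι → Mom n l → ℂ} (hh : ∀ i, IsWave (h i))
    (hf : ∀ x, f x = trigSum b h x) (r : Expansion f) (ℏ : ℝ) (a : l.edges × Fin n → ℤ) :
    (fibreOp (latticeBasis n l) (intMomHom n l) b h ℏ 0 (latticeBasis n l a) : Conf n l → ℂ)
      =ᵐ[confHaar n l] shiftIntegral ℏ r.g r.μ (UnitAddTorus.mFourier a) := by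
  classical
  set S := shiftIntegral ℏ r.g r.μ (UnitAddTorus.mFourier a) with hS
  have hSL : MemLp S 2 (confHaar n l) := by
    rw [hS]
    exact memLp_finsetSum _ fun k _ => memLp_cintegral_shift _ _ _ _ _
  suffices H : fibreOp (latticeBasis n l) (intMomHom n l) b h ℏ 0 (latticeBasis n l a) =
      hSL.toLp S by
    rw [H]; exact hSL.coeFn_toLp
  refine (latticeBasis n l).repr.injective (lp.ext (funext fun c => ?_))
  rw [HilbertBasis.repr_apply_apply, HilbertBasis.repr_apply_apply]
  have hinner : ∀ φ : LatticeHilbert n l, inner ℂ (latticeBasis n l c) φ =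
      ∫ y, UnitAddTorus.mFourier (-c) y * φ y ∂(confHaar n l) := fun φ => by
    rw [L2.inner_def]
    refine integral_congr_ae ?_
    filter_upwards [coeFn_latticeBasis l c] with y hy
    rw [RCLike.inner_apply, hy, UnitAddTorus.mFourier_neg, mul_comm]
  have h1 : inner ℂ (latticeBasis n l c) (hSL.toLp S) =
      ∑ i, (if a + b i = c then 1 else 0) * h i ((Real.pi * ℏ) • intMom (a + c)) := by
    rw [hinner]
    have h2 : ∫ y, UnitAddTorus.mFourier (-c) y * (hSL.toLp S) y ∂(confHaar n l) =
        ∫ y, UnitAddTorus.mFourier (-c) y * S y ∂(confHaar n l) := integral_congr_ae <| by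
      filter_upwards [hSL.coeFn_toLp] with y hy
      rw [hy]
    rw [h2]
    have h3 : ∀ k, Integrable (fun y => UnitAddTorus.mFourier (-c) y * cintegral (r.μ k) fun ξ =>
        r.g k (y + toConf ((ℏ / 2) • ξ)) * UnitAddTorus.mFourier a (y + toConf (ℏ • ξ)))
        (confHaar n l) := by
      intro k
      refine ((memLp_cintegral_shift (r.g k) (UnitAddTorus.mFourier a) (r.μ k) ℏ 1).integrable
        le_rfl).bdd_mul (c := 1) (UnitAddTorus.mFourier (-c)).continuous.aestronglyMeasurable
        (ae_of_all _ fun y => (norm_mFourier_apply _ _).le)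
    simp only [hS, shiftIntegral, Finset.mul_sum]
    rw [integral_finsetSum _ fun k _ => h3 k]
    simp only [integral_mode_mul_cintegral]
    have h4 : ∀ u : C(Conf n l, ℂ), Integrable u (confHaar n l) := fun u =>
      u.continuous.integrable_of_hasCompactSupport (HasCompactSupport.of_compactSpace _)
    set p := (Real.pi * ℏ) • intMom (n := n) (l := l) (a + c)
    -- Here the sum over the expansion collapses to f(·, πℏ(a + c)), so the matrix element does not
    -- depend on the expansion.
    calc _ = ∫ y, UnitAddTorus.mFourier (a - c) y * f (y, p) ∂(confHaar n l) := by
          simp only [r.eq_sum, Finset.mul_sum, ← mul_assoc]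
          refine Eq.trans (Finset.sum_congr rfl fun k _ => ?_) (integral_finsetSum _ fun k _ =>
            (h4 (UnitAddTorus.mFourier (a - c) * r.g k)).mul_const (invFourier (r.μ k) p)).symm
          exact (integral_mul_const _ _).symm
      _ = _ := by
          simp only [hf, trigSum, Finset.mul_sum, ← mul_assoc, ← UnitAddTorus.mFourier_add]
          rw [integral_finsetSum _ fun i _ =>
            (h4 (UnitAddTorus.mFourier (a - c + b i))).mul_const _]
          simp only [integral_mul_const, integral_mFourier]
          refine Finset.sum_congr rfl fun i _ => ?_
          have h5 : a - c + b i = 0 ↔ a + b i = c := by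
            rw [sub_add_eq_add_sub, sub_eq_zero]
          simp only [h5]
  rw [h1, fibreOp, sum_apply, inner_sum]
  refine Finset.sum_congr rfl fun i _ => ?_
  obtain ⟨C, hC⟩ := (hh i).exists_bound
  rw [weightedShift_apply _ _ ⟨C, fun χ => hC _⟩, inner_smul_right,
    orthonormal_iff_ite.mp (latticeBasis n l).orthonormal, zero_add]
  by_cases hc : a + b i = c
  · rw [if_pos hc, if_pos hc.symm, mul_one, one_mul, hc]
    rfl
  · rw [if_neg hc, if_neg (Ne.symm hc), mul_zero, zero_mul]

end Modes

/-! ### The quantization maps on lattices and on the continuum -/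

section Quantization

variable {n D : ℕ} {l : Lattice D} {ι : Type} [Fintype ι] {b : ι → l.edges × Fin n → ℤ}
  {h : ι → Mom n l → ℂ}

theorem isLatticeQuantization_fibreOp {f : BoundedContinuousFunction (Phase n l) ℂ}
    (hh : ∀ i, IsWave (h i)) (hf : ∀ x, f x = trigSum b h x) (ℏ : ℝ) :
    IsLatticeQuantization ℏ f (fibreOp (latticeBasis n l) (intMomHom n l) b h ℏ 0) :=
  fun r ψ => ae_eq_shiftIntegral ℏ r.g r.μ _ (fibreOp_latticeBasis_ae_eq hh hf r ℏ) ψ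

/-- An expansion exists, and it determines the operator almost everywhere. Without one, every
operator would satisfy `IsLatticeQuantization` and the choice would be arbitrary. -/
theorem latticeQuantization_eq {f : BoundedContinuousFunction (Phase n l) ℂ}
    (hf : f ∈ operatorSystem n l) (hh : ∀ i, IsWave (h i)) (hfx : ∀ x, f x = trigSum b h x)
    (ℏ : ℝ) : latticeQuantization ℏ f = fibreOp (latticeBasis n l) (intMomHom n l) b h ℏ 0 := by
  obtain ⟨r⟩ := nonempty_expansion hf
  have h1 := isLatticeQuantization_fibreOp hh hfx ℏ
  have h2 : IsLatticeQuantization ℏ f (latticeQuantization ℏ f) :=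
    Classical.epsilon_spec (p := fun T => IsLatticeQuantization ℏ f T) ⟨_, h1⟩
  exact ContinuousLinearMap.ext fun ψ => Lp.ext ((h2 r ψ).trans (h1 r ψ).symm)

theorem isLatticeQuantization_latticeQuantization {f : BoundedContinuousFunction (Phase n l) ℂ}
    (hf : f ∈ operatorSystem n l) (ℏ : ℝ) :
    IsLatticeQuantization ℏ f (latticeQuantization ℏ f) := by
  obtain ⟨ι, _, b, h, hh, hfx⟩ := exists_trigSum_of_mem (operatorSystem_le n l hf)
  rw [latticeQuantization_eq hf hh hfx]
  exact isLatticeQuantization_fibreOp hh hfx ℏ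

/-- The operators on `ℋ^∞` that quantize `∑ᵢ e_{bᵢ} ⊗ hᵢ(y + ·)`. -/
def continuumOp (l : Lattice D) (b : ι → l.edges × Fin n → ℤ) (h : ι → Mom n l → ℂ) (ℏ : ℝ)
    (y : Mom n l) : HilbertInf n D →L[ℂ] HilbertInf n D :=
  fibreOp (charBasis n D) (charMom l) (fun i => charOf l (b i)) h ℏ y

theorem continuumOp_charBasis (hh : ∀ i, ∃ C, ∀ p, ‖h i p‖ ≤ C) (ℏ : ℝ) (y : Mom n l)
    (χ : CharGroup n D) : continuumOp l b h ℏ y (charBasis n D χ) =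
      ∑ i, h i (y + (Real.pi * ℏ) • charMom l (χ + (χ + charOf l (b i)))) •
        charBasis n D (χ + charOf l (b i)) := by
  rw [continuumOp, fibreOp, sum_apply]
  refine Finset.sum_congr rfl fun i _ => ?_
  obtain ⟨C, hC⟩ := hh i
  rw [weightedShift_apply _ _ ⟨C, fun χ => hC _⟩]

theorem continuumOp_hilbertEmb (hh : ∀ i, IsWave (h i)) (ℏ : ℝ) (ψ : LatticeHilbert n l) :
    continuumOp l b h ℏ 0 (hilbertEmb n l ψ) =
      hilbertEmb n l (fibreOp (latticeBasis n l) (intMomHom n l) b h ℏ 0 ψ) := by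
  suffices H : continuumOp l b h ℏ 0 ∘L (hilbertEmb n l).toContinuousLinearMap =
      (hilbertEmb n l).toContinuousLinearMap ∘L
        fibreOp (latticeBasis n l) (intMomHom n l) b h ℏ 0 from congrArg (fun S => S ψ) H
  refine HilbertBasis.ext_clm (latticeBasis n l) fun a => ?_
  simp only [ContinuousLinearMap.comp_apply, LinearIsometry.coe_toContinuousLinearMap]
  rw [hilbertEmb_latticeBasis', continuumOp_charBasis fun i => (hh i).exists_bound,
    fibreOp, sum_apply, map_sum]
  refine Finset.sum_congr rfl fun i _ => ?_
  obtain ⟨C, hC⟩ := (hh i).exists_bound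
  rw [weightedShift_apply _ _ ⟨C, fun χ => hC _⟩, map_smul, hilbertEmb_latticeBasis', intMomHom_eq,
    charOf_add, charOf_add]

/-- Orthogonality of characters selects the terms with χ' = χ + bᵢ, for which 2χ + bᵢ = χ + χ'. The
right side mentions neither the lattice nor the expansion. -/
theorem inner_continuumOp (hh : ∀ i, ∃ C, ∀ p, ‖h i p‖ ≤ C) {F : BoundedContinuousFunction (PhaseInf n D) ℂ}
    (hF : ∀ x, F x = trigSum b h (phaseProj n l x)) (ℏ : ℝ) (χ χ' : CharGroup n D) :
    inner ℂ (charBasis n D χ') (continuumOp l b h ℏ 0 (charBasis n D χ)) =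
      ∫ q, charFun (χ - χ') q * F (phasePoint q (Real.pi * ℏ) (χ + χ')) ∂(confInfHaar n D) := by
  classical
  rw [continuumOp_charBasis hh, inner_sum]
  simp only [hF, phaseProj_phasePoint, trigSum, ← charFun_charOf, Finset.mul_sum, ← mul_assoc,
    ← charFun_add]
  rw [integral_finsetSum _ fun i _ => ((charFun _).continuous.integrable_of_hasCompactSupport
    (HasCompactSupport.of_compactSpace _)).mul_const _]
  refine Finset.sum_congr rfl fun i _ => ?_
  rw [integral_mul_const, integral_charFun, inner_smul_right,
    orthonormal_iff_ite.mp (charBasis n D).orthonormal, zero_add]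
  have h5 : χ - χ' + charOf l (b i) = 0 ↔ χ' = χ + charOf l (b i) := by
    rw [sub_add_eq_add_sub, sub_eq_zero, eq_comm]
  simp only [h5]
  by_cases hc : χ' = χ + charOf l (b i)
  · rw [if_pos hc, hc, mul_one, one_mul]
  · rw [if_neg hc, mul_zero, zero_mul]

theorem continuumOp_congr {l' : Lattice D} {ι' : Type} [Fintype ι']
    {b' : ι' → l'.edges × Fin n → ℤ} {h' : ι' → Mom n l' → ℂ}
    (hh : ∀ i, ∃ C, ∀ p, ‖h i p‖ ≤ C) (hh' : ∀ i, ∃ C, ∀ p, ‖h' i p‖ ≤ C)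
    {F : BoundedContinuousFunction (PhaseInf n D) ℂ}
    (hF : ∀ x, F x = trigSum b h (phaseProj n l x))
    (hF' : ∀ x, F x = trigSum b' h' (phaseProj n l' x)) (ℏ : ℝ) :
    continuumOp l b h ℏ 0 = continuumOp l' b' h' ℏ 0 := by
  refine HilbertBasis.ext_clm (charBasis n D) fun χ => ?_
  refine (charBasis n D).repr.injective (lp.ext (funext fun χ' => ?_))
  rw [HilbertBasis.repr_apply_apply, HilbertBasis.repr_apply_apply, inner_continuumOp hh hF,
    inner_continuumOp hh' hF']

theorem isContinuumQuantization_continuumOp (hh : ∀ i, IsWave (h i)) {F : classicalAlgebra n D}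
    (hF : ∀ x, F.1 x = trigSum b h (phaseProj n l x)) (ℏ : ℝ) :
    IsContinuumQuantization ℏ F (continuumOp l b h ℏ 0) := by
  intro l' f hf hFf m hlm ψ
  have hfm := compContinuous_phaseMap_mem_operatorSystem hlm hf
  obtain ⟨ι', _, b', h', hh', hfx⟩ := exists_trigSum_of_mem (operatorSystem_le n m hfm)
  rw [latticeQuantization_eq hfm hh' hfx, ← continuumOp_hilbertEmb hh']
  congr 1
  refine continuumOp_congr (fun i => (hh i).exists_bound) (fun i => (hh' i).exists_bound) hF
    (fun x => ?_) ℏ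
  rw [← hfx, hFf, ← compContinuous_phaseProj_eq hlm]
  rfl

/-- Every character lives on some lattice that refines the one carrying F, so the defining property
fixes the operator on the basis. -/
theorem IsContinuumQuantization.unique {ℏ : ℝ} {F : classicalAlgebra n D}
    {S T : HilbertInf n D →L[ℂ] HilbertInf n D} (hS : IsContinuumQuantization ℏ F S)
    (hT : IsContinuumQuantization ℏ F T) : S = T := by
  obtain ⟨k, f, hf, hF⟩ := exists_operatorSystem_rep F
  refine HilbertBasis.ext_clm (charBasis n D) fun χ => ?_
  obtain ⟨m, a, -, hkm, rfl, -⟩ := exists_charOf₂ k χ χ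
  rw [← hilbertEmb_latticeBasis', hS k f hf hF m hkm, hT k f hf hF m hkm]

theorem exists_continuumOp_rep (F : classicalAlgebra n D) :
    ∃ (l : Lattice D) (ι : Type) (_ : Fintype ι) (b : ι → l.edges × Fin n → ℤ)
      (h : ι → Mom n l → ℂ), (∀ i, IsWave (h i)) ∧ ∀ x, F.1 x = trigSum b h (phaseProj n l x) := by
  obtain ⟨l, hl⟩ := exists_rep F
  exact ⟨l, exists_trigSum_rep F hl⟩

theorem isContinuumQuantization_continuumQuantization (ℏ : ℝ) (F : classicalAlgebra n D) :
    IsContinuumQuantization ℏ F (continuumQuantization ℏ F) := by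
  obtain ⟨l, ι, _, b, h, hh, hF⟩ := exists_continuumOp_rep F
  exact Classical.epsilon_spec (p := fun T => IsContinuumQuantization ℏ F T)
    ⟨_, isContinuumQuantization_continuumOp hh hF ℏ⟩

theorem continuumQuantization_eq (hh : ∀ i, ∃ C, ∀ p, ‖h i p‖ ≤ C) {F : classicalAlgebra n D}
    (hF : ∀ x, F.1 x = trigSum b h (phaseProj n l x)) (ℏ : ℝ) :
    continuumQuantization ℏ F = continuumOp l b h ℏ 0 := by
  obtain ⟨l', ι', _, b', h', hh', hF'⟩ := exists_continuumOp_rep F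
  rw [(isContinuumQuantization_continuumQuantization ℏ F).unique
    (isContinuumQuantization_continuumOp hh' hF' ℏ)]
  exact continuumOp_congr (fun i => (hh' i).exists_bound) hh hF' hF ℏ

theorem inner_continuumQuantization (ℏ : ℝ) (F : classicalAlgebra n D) (χ χ' : CharGroup n D) :
    inner ℂ (charBasis n D χ') (continuumQuantization ℏ F (charBasis n D χ)) =
      ∫ q, charFun (χ - χ') q * F.1 (phasePoint q (Real.pi * ℏ) (χ + χ')) ∂(confInfHaar n D) := by
  obtain ⟨l, ι, _, b, h, hh, hF⟩ := exists_continuumOp_rep F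
  have hh := fun i => (hh i).exists_bound
  rw [continuumQuantization_eq hh hF]
  exact inner_continuumOp hh hF ℏ χ χ'

theorem continuousLinearMap_ext_inner {T S : HilbertInf n D →L[ℂ] HilbertInf n D}
    (H : ∀ χ χ', inner ℂ (charBasis n D χ') (T (charBasis n D χ)) =
      inner ℂ (charBasis n D χ') (S (charBasis n D χ))) : T = S := by
  refine HilbertBasis.ext_clm (charBasis n D) fun χ => ?_
  refine (charBasis n D).repr.injective (lp.ext (funext fun χ' => ?_))
  rw [HilbertBasis.repr_apply_apply, HilbertBasis.repr_apply_apply, H]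

theorem integrable_charFun_mul (F : classicalAlgebra n D) (t : ℝ) (χ χ' : CharGroup n D) :
    Integrable (fun q => charFun χ q * F.1 (phasePoint q t χ')) (confInfHaar n D) :=
  ((charFun χ).continuous.mul (F.1.continuous.comp
    (continuous_phasePoint t χ'))).integrable_of_hasCompactSupport
      (HasCompactSupport.of_compactSpace _)

theorem isLinearMap_continuumQuantization (ℏ : ℝ) :
    IsLinearMap ℂ (continuumQuantization (n := n) (D := D) ℏ) where
  map_add F G := continuousLinearMap_ext_inner fun χ χ' => by
    rw [add_apply, inner_add_right, inner_continuumQuantization,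
      inner_continuumQuantization, inner_continuumQuantization, ← integral_add
        (integrable_charFun_mul F _ _ _) (integrable_charFun_mul G _ _ _)]
    simp only [← mul_add]
    rfl
  map_smul c F := continuousLinearMap_ext_inner fun χ χ' => by
    rw [smul_apply, inner_smul_right, inner_continuumQuantization,
      inner_continuumQuantization, ← integral_const_mul]
    refine integral_congr_ae (ae_of_all _ fun q => ?_)
    change _ * (c * F.1 _) = _
    ring

/-- Exchanging χ and χ' conjugates the character χ - χ' and leaves the momentum χ + χ' unchanged. -/
theorem continuumQuantization_star (ℏ : ℝ) (F : classicalAlgebra n D) :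
    continuumQuantization ℏ (star F) = star (continuumQuantization ℏ F) :=
  continuousLinearMap_ext_inner fun χ χ' => by
    rw [ContinuousLinearMap.star_eq_adjoint, ContinuousLinearMap.adjoint_inner_right,
      ← inner_conj_symm (continuumQuantization ℏ F _), inner_continuumQuantization,
      inner_continuumQuantization, ← integral_conj]
    refine integral_congr_ae (ae_of_all _ fun q => ?_)
    change _ * (starRingEnd ℂ) (F.1 _) = _
    beta_reduce
    rw [map_mul, ← charFun_neg, neg_sub, add_comm χ χ']

end Quantization

/-! ### The exact composition law -/

section Product

variable {n D : ℕ} {l : Lattice D} {ι ι' : Type} [Fintype ι] [Fintype ι']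
  {b : ι → l.edges × Fin n → ℤ} {h h₁ : ι → Mom n l → ℂ}
  {b' : ι' → l.edges × Fin n → ℤ} {h' : ι' → Mom n l → ℂ}

theorem exists_bound_mul {E : Type*} [Add E] {h h' : E → ℂ} (hh : ∃ C, ∀ p, ‖h p‖ ≤ C)
    (hh' : ∃ C, ∀ p, ‖h' p‖ ≤ C) (v w : E) : ∃ C, ∀ p, ‖h (p + v) * h' (p + w)‖ ≤ C := by
  obtain ⟨C, hC⟩ := hh
  obtain ⟨C', hC'⟩ := hh'
  refine ⟨C * C', fun p => ?_⟩
  rw [norm_mul]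
  exact mul_le_mul (hC _) (hC' _) (norm_nonneg _) ((norm_nonneg _).trans (hC p))

/-- Take p = πℏ(2χ + b + b'). The right factor evaluates h' at πℏ(2χ + b') = p - πℏb, and the left
factor, acting on χ + b', evaluates h at πℏ(2χ + 2b' + b) = p + πℏb'. -/
theorem continuumOp_mul (hh : ∀ i, ∃ C, ∀ p, ‖h i p‖ ≤ C) (hh' : ∀ i, ∃ C, ∀ p, ‖h' i p‖ ≤ C) (ℏ : ℝ) :
    continuumOp l b h ℏ 0 * continuumOp l b' h' ℏ 0 =
      continuumOp l (fun i : ι × ι' => b i.1 + b' i.2) (fun i p =>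
        h i.1 (p + ℏ • Real.pi • intMom (b' i.2)) * h' i.2 (p + ℏ • -(Real.pi • intMom (b i.1))))
        ℏ 0 := by
  have hw : ∀ i : ι × ι', ∃ C, ∀ p, ‖h i.1 (p + ℏ • Real.pi • intMom (b' i.2)) *
      h' i.2 (p + ℏ • -(Real.pi • intMom (b i.1)))‖ ≤ C := fun i =>
    exists_bound_mul (hh i.1) (hh' i.2) _ _
  refine HilbertBasis.ext_clm (charBasis n D) fun χ => ?_
  rw [mul_apply_eq_comp, continuumOp_charBasis hh', map_sum, continuumOp_charBasis hw,
    Fintype.sum_prod_type_right]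
  refine Finset.sum_congr rfl fun j _ => ?_
  rw [map_smul, continuumOp_charBasis hh, Finset.smul_sum]
  refine Finset.sum_congr rfl fun i _ => ?_
  rw [smul_smul, mul_comm (h' j _), charOf_add]
  refine congrArg₂ (· • ·) (congrArg₂ (· * ·) (congrArg (h i) ?_) (congrArg (h' j) ?_))
    (congrArg _ ?_)
  · simp only [map_add, intMom_eq]
    module
  · simp only [map_add, intMom_eq]
    module
  · simp only []
    abel

theorem norm_continuumOp_le {C : ℝ} (hC : ∀ i p, ‖h i p‖ ≤ C) (ℏ : ℝ) :
    ‖continuumOp l b h ℏ 0‖ ≤ Fintype.card ι * C :=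
  norm_fibreOp_le _ _ _ hC ℏ 0

theorem continuumOp_sub (hh : ∀ i, ∃ C, ∀ p, ‖h i p‖ ≤ C) (hh₁ : ∀ i, ∃ C, ∀ p, ‖h₁ i p‖ ≤ C) (ℏ : ℝ) :
    continuumOp l b h ℏ 0 - continuumOp l b h₁ ℏ 0 =
      continuumOp l b (fun i p => h i p - h₁ i p) ℏ 0 := by
  rw [continuumOp, continuumOp, continuumOp, fibreOp, fibreOp, fibreOp, ← Finset.sum_sub_distrib]
  refine Finset.sum_congr rfl fun i _ => ?_
  obtain ⟨C, hC⟩ := hh i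
  obtain ⟨C₁, hC₁⟩ := hh₁ i
  exact weightedShift_sub _ _ ⟨C, fun χ => hC _⟩ ⟨C₁, fun χ => hC₁ _⟩

theorem continuumOp_swap (h : ι × ι' → Mom n l → ℂ) (ℏ : ℝ) :
    continuumOp l (fun i : ι' × ι => b' i.1 + b i.2) (fun i => h (i.2, i.1)) ℏ 0 =
      continuumOp l (fun i : ι × ι' => b i.1 + b' i.2) h ℏ 0 := by
  rw [continuumOp, continuumOp, fibreOp, fibreOp]
  refine Fintype.sum_equiv (Equiv.prodComm ι' ι) _ _ fun i => ?_
  simp only [Equiv.prodComm_apply, Prod.swap, add_comm (b i.2)]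

end Product

/-! ### Uniform Taylor estimates -/

section Taylor

variable {E : Type} [NormedAddCommGroup E] [InnerProductSpace ℝ E] [FiniteDimensional ℝ E]
  [MeasurableSpace E] [BorelSpace E]

theorem IsWave.exists_norm_mul_sub_le {h h' : E → ℂ} (H : IsWave h) (H' : IsWave h') (u v : E) :
    ∃ K, 0 ≤ K ∧ ∀ p (t : ℝ), ‖h (p + t • u) * h' (p + t • v) - h p * h' p‖ ≤ K * |t| := by
  obtain ⟨C, hC⟩ := H.exists_bound
  obtain ⟨C', hC'⟩ := H'.exists_bound
  obtain ⟨L, hL0, hL⟩ := H.bandLimited.exists_lipschitz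
  obtain ⟨L', hL0', hL'⟩ := H'.bandLimited.exists_lipschitz
  have hC0 : 0 ≤ C := (norm_nonneg _).trans (hC 0)
  have hC0' : 0 ≤ C' := (norm_nonneg _).trans (hC' 0)
  refine ⟨L * ‖u‖ * C' + C * (L' * ‖v‖), by positivity, fun p t => ?_⟩
  have h1 : h (p + t • u) * h' (p + t • v) - h p * h' p =
      (h (p + t • u) - h p) * h' (p + t • v) + h p * (h' (p + t • v) - h' p) := by ring
  have h2 := hL (p + t • u) p
  have h3 := hL' (p + t • v) p
  rw [add_sub_cancel_left, norm_smul, Real.norm_eq_abs] at h2 h3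
  rw [h1]
  refine (norm_add_le _ _).trans ?_
  rw [norm_mul, norm_mul]
  calc _ ≤ L * (|t| * ‖u‖) * C' + C * (L' * (|t| * ‖v‖)) :=
        add_le_add (mul_le_mul h2 (hC' _) (norm_nonneg _) (by positivity))
          (mul_le_mul (hC _) h3 (norm_nonneg _) hC0)
    _ = _ := by ring

/-- The mean value inequality for φ(t) - t φ'(0) between -s and s; a Lipschitz bound for φ' at 0
replaces a second derivative. -/
theorem norm_sub_sub_le_of_hasDerivAt {φ φ' : ℝ → ℂ} (hφ : ∀ t, HasDerivAt φ (φ' t) t) {K : ℝ}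
    (hK0 : 0 ≤ K) (hK : ∀ t, ‖φ' t - φ' 0‖ ≤ K * |t|) (s : ℝ) :
    ‖φ s - φ (-s) - 2 * s * φ' 0‖ ≤ 2 * K * |s| * |s| := by
  have h1 : ∀ t, HasDerivAt (fun t : ℝ => φ t - t * φ' 0) (φ' t - φ' 0) t := fun t => by
    have := (hφ t).sub ((Complex.ofRealCLM.hasDerivAt (x := t)).mul_const (φ' 0))
    refine this.congr_deriv ?_
    simp
  have h2 := (convex_Icc (-|s|) |s|).norm_image_sub_le_of_norm_hasDerivWithin_le
    (f := fun t : ℝ => φ t - t * φ' 0) (f' := fun t => φ' t - φ' 0) (C := K * |s|)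
    (fun t _ => (h1 t).hasDerivWithinAt)
    (fun t ht => (hK t).trans (mul_le_mul_of_nonneg_left (abs_le.mpr ht) hK0))
    (x := -s) (y := s) ⟨neg_le_neg (le_abs_self s), neg_le_abs s⟩ ⟨neg_abs_le s, le_abs_self s⟩
  have h3 : φ s - φ (-s) - 2 * s * φ' 0 = (φ s - s * φ' 0) - (φ (-s) - ((-s : ℝ) : ℂ) * φ' 0) := by
    push_cast
    ring
  rw [h3]
  refine h2.trans_eq ?_
  rw [sub_neg_eq_add, ← two_mul, norm_mul, Real.norm_eq_abs, Real.norm_eq_abs,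
    abs_of_pos (zero_lt_two' ℝ)]
  ring

/-- The second-order estimate behind Dirac's condition. -/
theorem IsWave.exists_norm_commutator_le {h h' : E → ℂ} (H : IsWave h) (H' : IsWave h') (u v : E) :
    ∃ K, 0 ≤ K ∧ ∀ p (t : ℝ), ‖h (p + t • u) * h' (p + t • v) -
      h (p + t • -u) * h' (p + t • -v) -
        2 * t * (LatticeGauge.waveDeriv u h p * h' p + h p * LatticeGauge.waveDeriv v h' p)‖ ≤ K * |t| * |t| := by
  obtain ⟨K₁, hK₁, h₁⟩ := (H.waveDeriv u).exists_norm_mul_sub_le H' u v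
  obtain ⟨K₂, hK₂, h₂⟩ := H.exists_norm_mul_sub_le (H'.waveDeriv v) u v
  refine ⟨2 * (K₁ + K₂), by positivity, fun p t => ?_⟩
  have hd : ∀ {f : E → ℂ} (_ : IsWave f) (w : E) (s : ℝ),
      HasDerivAt (fun t : ℝ => f (p + t • w)) (LatticeGauge.waveDeriv w f (p + s • w)) s := by
    intro f Hf w s
    have h3 : HasDerivAt (fun t : ℝ => p + t • w) w s := by
      simpa using ((hasDerivAt_id s).smul_const w).const_add p
    exact (Hf.differentiable (p + s • w)).hasFDerivAt.comp_hasDerivAt s h3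
  have := norm_sub_sub_le_of_hasDerivAt (φ := fun t => h (p + t • u) * h' (p + t • v))
    (fun s => (hd H u s).mul (hd H' v s)) (K := K₁ + K₂) (by positivity) (fun s => ?_) t
  · simpa using this
  · simp only [zero_smul, add_zero]
    rw [add_sub_add_comm, add_mul]
    exact (norm_add_le _ _).trans (add_le_add (h₁ p s) (h₂ p s))

end Taylor

/-! ### The conditions of von Neumann and Dirac -/

section Semiclassical

variable {n D : ℕ}

theorem tendsto_norm_of_le_mul_abs {A : ℝ → HilbertInf n D →L[ℂ] HilbertInf n D} {K : ℝ} {s : Set ℝ}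
    (H : ∀ ℏ ∈ s, ‖A ℏ‖ ≤ K * |ℏ|) : Tendsto (fun ℏ => ‖A ℏ‖) (𝓝[s] 0) (𝓝 0) := by
  have h1 : Tendsto (fun ℏ : ℝ => K * |ℏ|) (𝓝[s] 0) (𝓝 0) := by
    have h2 : Continuous fun ℏ : ℝ => K * |ℏ| := by fun_prop
    simpa using (h2.tendsto 0).mono_left nhdsWithin_le_nhds
  refine squeeze_zero' (Eventually.of_forall fun _ => norm_nonneg _) ?_ h1
  filter_upwards [self_mem_nhdsWithin] with ℏ hℏ using H ℏ hℏ

/-- By `continuumOp_mul` the difference is quantized by momentum factors of size O(ℏ) uniformly in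
p, and an operator norm is at most the number of terms times the sup of its factors. -/
theorem tendsto_vonNeumann (F G : classicalAlgebra n D) (s : Set ℝ) :
    Tendsto (fun ℏ : ℝ => ‖continuumQuantization ℏ F * continuumQuantization ℏ G -
      continuumQuantization ℏ (F * G)‖) (𝓝[s] 0) (𝓝 0) := by
  obtain ⟨l, hF, hG⟩ := exists_rep₂ F G
  obtain ⟨ι, _, b, h, hh, hF⟩ := exists_trigSum_rep F hF
  obtain ⟨ι', _, b', h', hh', hG⟩ := exists_trigSum_rep G hG
  have hFG : ∀ x, (F * G).1 x = trigSum (fun i : ι × ι' => b i.1 + b' i.2)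
      (fun i p => h i.1 p * h' i.2 p) (phaseProj n l x) := fun x => by
    rw [← trigSum_mul, ← hF, ← hG]
    rfl
  choose K hK0 hK using fun i : ι × ι' => (hh i.1).exists_norm_mul_sub_le (hh' i.2)
    (Real.pi • intMom (b' i.2)) (-(Real.pi • intMom (b i.1)))
  refine tendsto_norm_of_le_mul_abs (K := Fintype.card (ι × ι') * ∑ i, K i) fun ℏ _ => ?_
  have B := fun i => (hh i).exists_bound
  have B' := fun i => (hh' i).exists_bound
  have B₀ := fun i : ι × ι' => ((hh i.1).mul (hh' i.2)).exists_bound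
  have B₁ := fun i : ι × ι' => exists_bound_mul (B i.1) (B' i.2)
    (ℏ • Real.pi • intMom (b' i.2)) (ℏ • -(Real.pi • intMom (b i.1)))
  rw [continuumQuantization_eq B hF, continuumQuantization_eq B' hG,
    continuumQuantization_eq B₀ hFG, continuumOp_mul B B', continuumOp_sub B₁ B₀]
  refine (norm_continuumOp_le (C := (∑ i, K i) * |ℏ|) (fun i p => (hK i p ℏ).trans ?_) ℏ).trans_eq
    (mul_assoc _ _ _).symm
  gcongr
  exact Finset.single_le_sum (fun i _ => hK0 i) (Finset.mem_univ i)

theorem continuumOp_smul {l : Lattice D} {ι : Type} [Fintype ι] {b : ι → l.edges × Fin n → ℤ}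
    {h : ι → Mom n l → ℂ} (hh : ∀ i, ∃ C, ∀ p, ‖h i p‖ ≤ C) (c : ℂ) (ℏ : ℝ) :
    c • continuumOp l b h ℏ 0 = continuumOp l b (fun i p => c * h i p) ℏ 0 := by
  have hc : ∀ i, ∃ C, ∀ p, ‖c * h i p‖ ≤ C := fun i => by
    obtain ⟨C, hC⟩ := hh i
    exact ⟨‖c‖ * C, fun p => by rw [norm_mul]; gcongr; exact hC p⟩
  refine HilbertBasis.ext_clm (charBasis n D) fun χ => ?_
  rw [smul_apply, continuumOp_charBasis hh, continuumOp_charBasis hc, Finset.smul_sum]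
  simp only [smul_smul]

theorem IsWave.exists_bound_bracketWave {l : Lattice D} {h h' : Mom n l → ℂ} (H : IsWave h)
    (H' : IsWave h') (b b' : l.edges × Fin n → ℤ) : ∃ C, ∀ p, ‖bracketWave b h b' h' p‖ ≤ C := by
  obtain ⟨C, hC⟩ := ((H.waveDeriv (intMom b')).mul H').exists_bound
  obtain ⟨C', hC'⟩ := (H.mul (H'.waveDeriv (intMom b))).exists_bound
  refine ⟨‖(2 * Real.pi * Complex.I : ℂ)‖ * (C + C'), fun p => ?_⟩
  rw [bracketWave, norm_mul]
  gcongr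
  exact (norm_sub_le _ _).trans (add_le_add (hC p) (hC' p))

/-- The factor of the commutator is h(p + πℏb') h'(p - πℏb) - h(p - πℏb') h'(p + πℏb). It is odd in
ℏ, with leading term 2πℏ(∂_{b'}h · h' - h · ∂_b h'), which -iℏ divides into the factor of the
bracket. The remainder is O(ℏ²), so O(ℏ) survives the division. -/
theorem tendsto_dirac (F G : classicalAlgebra n D) (s : Set ℝ) (hs : ∀ ℏ ∈ s, ℏ ≠ 0) :
    Tendsto (fun ℏ : ℝ => ‖(-(Complex.I * (ℏ : ℂ)))⁻¹ •
      (continuumQuantization ℏ F * continuumQuantization ℏ G -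
        continuumQuantization ℏ G * continuumQuantization ℏ F) -
      continuumQuantization ℏ (continuumBracket F G)‖) (𝓝[s] 0) (𝓝 0) := by
  obtain ⟨l, hFl, hGl⟩ := exists_rep₂ F G
  obtain ⟨ι, _, b, h, hh, hF⟩ := exists_trigSum_rep F hFl
  obtain ⟨ι', _, b', h', hh', hG⟩ := exists_trigSum_rep G hGl
  have hFG := continuumBracket_apply b (fun i => (hh i).contDiff) b' (fun i => (hh' i).contDiff)
    hFl hGl hF hG
  choose K hK0 hK using fun i : ι × ι' => (hh i.1).exists_norm_commutator_le (hh' i.2)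
    (Real.pi • intMom (b' i.2)) (-(Real.pi • intMom (b i.1)))
  refine tendsto_norm_of_le_mul_abs (K := Fintype.card (ι × ι') * ∑ i, K i) fun ℏ hℏ => ?_
  have hℏ0 : (ℏ : ℂ) ≠ 0 := Complex.ofReal_ne_zero.mpr (hs ℏ hℏ)
  have B := fun i => (hh i).exists_bound
  have B' := fun i => (hh' i).exists_bound
  have B₁ := fun i : ι × ι' => exists_bound_mul (B i.1) (B' i.2)
    (ℏ • Real.pi • intMom (b' i.2)) (ℏ • -(Real.pi • intMom (b i.1)))
  have B₂ := fun i : ι' × ι => exists_bound_mul (B' i.1) (B i.2)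
    (ℏ • Real.pi • intMom (b i.2)) (ℏ • -(Real.pi • intMom (b' i.1)))
  have B₃ := fun i : ι × ι' => (hh i.1).exists_bound_bracketWave (hh' i.2) (b i.1) (b' i.2)
  rw [continuumQuantization_eq B hF, continuumQuantization_eq B' hG,
    continuumQuantization_eq B₃ hFG, continuumOp_mul B B', continuumOp_mul B' B]
  set A : ι × ι' → Mom n l → ℂ := fun i p =>
    h i.1 (p + ℏ • Real.pi • intMom (b' i.2)) * h' i.2 (p + ℏ • -(Real.pi • intMom (b i.1)))
  set A' : ι × ι' → Mom n l → ℂ := fun i p =>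
    h' i.2 (p + ℏ • Real.pi • intMom (b i.1)) * h i.1 (p + ℏ • -(Real.pi • intMom (b' i.2)))
  have hA' : ∀ i, ∃ C, ∀ p, ‖A' i p‖ ≤ C := fun i => B₂ (i.2, i.1)
  have hAA' : ∀ i, ∃ C, ∀ p, ‖A i p - A' i p‖ ≤ C := fun i => by
    obtain ⟨C, hC⟩ := B₁ i
    obtain ⟨C', hC'⟩ := hA' i
    exact ⟨C + C', fun p => (norm_sub_le _ _).trans (add_le_add (hC p) (hC' p))⟩
  set c : ℂ := (-(Complex.I * (ℏ : ℂ)))⁻¹ with hc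
  have hcA : ∀ i, ∃ C, ∀ p, ‖c * (A i p - A' i p)‖ ≤ C := fun i => by
    obtain ⟨C, hC⟩ := hAA' i
    exact ⟨‖c‖ * C, fun p => by rw [norm_mul]; gcongr; exact hC p⟩
  -- The product in the opposite order is indexed by ι' × ι; reindexing allows the two sums to be
  -- subtracted term by term.
  have hswap := continuumOp_swap (b := b) (b' := b') A' ℏ
  rw [hswap, continuumOp_sub B₁ hA', continuumOp_smul hAA', continuumOp_sub hcA B₃]
  refine (norm_continuumOp_le (C := (∑ i, K i) * |ℏ|) (fun i p => ?_) ℏ).trans_eq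
    (mul_assoc _ _ _).symm
  have hcℏ : c * ℏ = Complex.I := by
    rw [hc, inv_neg, mul_inv, Complex.inv_I]
    field_simp
  have hcn : ‖c‖ * |ℏ| = 1 := by
    rw [← Real.norm_eq_abs, ← Complex.norm_real, ← norm_mul, hcℏ, Complex.norm_I]
  have hlin : ∀ (v : Mom n l) (f : Mom n l → ℂ),
      waveDeriv (Real.pi • v) f p = Real.pi * waveDeriv v f p := fun v f => by
    rw [waveDeriv, map_smul, Complex.real_smul]
    rfl
  have hneg : ∀ (v : Mom n l) (f : Mom n l → ℂ),
      waveDeriv (-v) f p = -waveDeriv v f p := fun v f => map_neg _ _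
  have key : c * (A i p - A' i p) - bracketWave (b i.1) (h i.1) (b' i.2) (h' i.2) p =
      c * (h i.1 (p + ℏ • Real.pi • intMom (b' i.2)) * h' i.2 (p + ℏ • -(Real.pi • intMom (b i.1))) -
        h i.1 (p + ℏ • -(Real.pi • intMom (b' i.2))) *
          h' i.2 (p + ℏ • -(-(Real.pi • intMom (b i.1)))) -
        2 * ℏ * (waveDeriv (Real.pi • intMom (b' i.2)) (h i.1) p * h' i.2 p +
          h i.1 p * waveDeriv (-(Real.pi • intMom (b i.1))) (h' i.2) p)) := by
    simp only [A, A', neg_neg, hneg, hlin, bracketWave]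
    linear_combination (2 * Real.pi * (waveDeriv (intMom (b' i.2)) (h i.1) p * h' i.2 p -
      h i.1 p * waveDeriv (intMom (b i.1)) (h' i.2) p)) * hcℏ
  rw [key, norm_mul]
  calc _ ≤ ‖c‖ * (K i * |ℏ| * |ℏ|) := by
        gcongr
        exact hK i p ℏ
    _ = ‖c‖ * |ℏ| * (K i * |ℏ|) := by ring
    _ ≤ _ := by
        rw [hcn, one_mul]
        gcongr
        exact Finset.single_le_sum (fun i _ => hK0 i) (Finset.mem_univ i)

end Semiclassical

/-! ### The classical norm, Rieffel's condition and injectivity -/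

section ClassicalNorm

variable {n D : ℕ} {l : Lattice D} {ι : Type} [Fintype ι] {b : ι → l.edges × Fin n → ℤ}
  {h : ι → Mom n l → ℂ}

/-- The inclusion of `ℋ^∞` into `L²(G^∞)`. -/
def hilbertIncl (n D : ℕ) : HilbertInf n D →ₗᵢ[ℂ] Lp ℂ 2 (confInfHaar n D) :=
  (hilbertSubspace n D).subtypeₗᵢ

theorem hilbertIncl_charBasis (χ : CharGroup n D) : hilbertIncl n D (charBasis n D χ) =
    ContinuousMap.toLp 2 (confInfHaar n D) ℂ (charFun χ) := by
  rw [charBasis_apply]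
  rfl

theorem hilbertIncl_hilbertEmb (ψ : LatticeHilbert n l) :
    hilbertIncl n D (hilbertEmb n l ψ) = pullback n l ψ := rfl

/-- At `ℏ = 0` the quantization acts by multiplication. -/
theorem hilbertIncl_continuumOp_zero (hh : ∀ i, IsWave (h i)) (y : Mom n l) (v : HilbertInf n D) :
    (hilbertIncl n D (continuumOp l b h 0 y v) : ConfInf n D → ℂ) =ᵐ[confInfHaar n D]
      fun q => trigSum b h (confProj n l q, y) * hilbertIncl n D v q := by
  set φ : C(ConfInf n D, ℂ) := ∑ i, h i y • charFun (charOf l (b i)) with hφ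
  have hφq : ∀ q, φ q = trigSum b h (confProj n l q, y) := fun q => by
    rw [hφ, trigSum, ContinuousMap.sum_apply]
    refine Finset.sum_congr rfl fun i _ => ?_
    rw [ContinuousMap.smul_apply, charFun_charOf, smul_eq_mul, mul_comm]
  -- Multiplication by φ as a bounded operator on L², by Hölder's inequality with φ in L^∞. It is
  -- compared with the quantization on the basis only.
  set M : Lp ℂ 2 (confInfHaar n D) →L[ℂ] Lp ℂ 2 (confInfHaar n D) :=
    (ContinuousLinearMap.mul ℂ ℂ).holderL (confInfHaar n D) ⊤ 2 2
      (ContinuousMap.toLp ⊤ (confInfHaar n D) ℂ φ) with hM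
  have hMv : ∀ u : Lp ℂ 2 (confInfHaar n D), (M u : ConfInf n D → ℂ) =ᵐ[confInfHaar n D]
      fun q => φ q * u q := fun u => by
    filter_upwards [(ContinuousLinearMap.mul ℂ ℂ).coeFn_holder
      (r := 2) (ContinuousMap.toLp ⊤ (confInfHaar n D) ℂ φ) u,
      ContinuousMap.coeFn_toLp (p := ⊤) (𝕜 := ℂ) (confInfHaar n D) φ] with q h1 h2
    rw [← h2]
    exact h1
  have key : (hilbertIncl n D).toContinuousLinearMap ∘L continuumOp l b h 0 y =
      M ∘L (hilbertIncl n D).toContinuousLinearMap := by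
    refine HilbertBasis.ext_clm (charBasis n D) fun χ => ?_
    simp only [ContinuousLinearMap.comp_apply, LinearIsometry.coe_toContinuousLinearMap]
    rw [continuumOp_charBasis fun i => (hh i).exists_bound, map_sum]
    simp only [map_smul, hilbertIncl_charBasis, mul_zero, zero_smul, add_zero]
    refine Lp.ext (EventuallyEq.trans ?_ (hMv _).symm)
    have h1 : ∑ i, h i y • ContinuousMap.toLp 2 (confInfHaar n D) ℂ
        (charFun (χ + charOf l (b i))) =
        ContinuousMap.toLp 2 (confInfHaar n D) ℂ (φ * charFun χ) := by
      simp only [← map_smul, ← map_sum]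
      congr 1
      ext q
      rw [hφ, ContinuousMap.mul_apply, ContinuousMap.sum_apply, ContinuousMap.sum_apply,
        Finset.sum_mul]
      refine Finset.sum_congr rfl fun i _ => ?_
      rw [ContinuousMap.smul_apply, ContinuousMap.smul_apply, charFun_add, smul_eq_mul,
        smul_eq_mul]
      ring
    rw [h1]
    filter_upwards [ContinuousMap.coeFn_toLp (p := 2) (𝕜 := ℂ) (confInfHaar n D) (φ * charFun χ),
      ContinuousMap.coeFn_toLp (p := 2) (𝕜 := ℂ) (confInfHaar n D) (charFun χ)] with q h2 h3
    rw [h2, h3]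
    rfl
  have h2 := hMv (hilbertIncl n D v)
  rw [show M (hilbertIncl n D v) = hilbertIncl n D (continuumOp l b h 0 y v) from
    (congrArg (fun S => S v) key).symm] at h2
  simpa only [hφq] using h2

theorem norm_continuumOp_zero_le (hh : ∀ i, IsWave (h i)) {y : Mom n l} {C : ℝ} (hC0 : 0 ≤ C)
    (hC : ∀ q, ‖trigSum b h (q, y)‖ ≤ C) : ‖continuumOp l b h 0 y‖ ≤ C := by
  refine ContinuousLinearMap.opNorm_le_bound _ hC0 fun v => ?_
  rw [← (hilbertIncl n D).norm_map, ← (hilbertIncl n D).norm_map v]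
  refine Lp.norm_le_mul_norm_of_ae_le_mul ?_
  filter_upwards [hilbertIncl_continuumOp_zero hh y v] with q hq
  rw [hq, norm_mul]
  exact mul_le_mul_of_nonneg_right (hC _) (norm_nonneg _)

theorem continuous_trigSum (hh : ∀ i, IsWave (h i)) : Continuous (trigSum b h) := by
  refine continuous_finsetSum _ fun i _ => ?_
  exact ((UnitAddTorus.mFourier (b i)).continuous.comp continuous_fst).mul
    ((hh i).continuous.comp continuous_snd)

/-- Test vectors localized near a configuration. Haar measure is positive on nonempty open sets, so
they do not vanish. -/
theorem exists_hilbertIncl_eq_indicator {S : Set (Conf n l)} (hSo : IsOpen S) (hS : S.Nonempty) :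
    ∃ v : HilbertInf n D, 0 < ‖v‖ ∧ (hilbertIncl n D v : ConfInf n D → ℂ) =ᵐ[confInfHaar n D]
      fun q => S.indicator (fun _ => (1 : ℂ)) (confProj n l q) := by
  have hSf : confHaar n l S ≠ ⊤ := measure_ne_top _ _
  refine ⟨hilbertEmb n l (indicatorConstLp 2 hSo.measurableSet hSf (1 : ℂ)), ?_, ?_⟩
  · rw [LinearIsometry.norm_map, norm_indicatorConstLp (by norm_num) (by norm_num), norm_one,
      one_mul]
    exact Real.rpow_pos_of_pos (ENNReal.toReal_pos (hSo.measure_pos _ hS).ne' hSf) _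
  · have h1 : ∀ᵐ q ∂(confHaar n l), indicatorConstLp 2 hSo.measurableSet hSf (1 : ℂ) q =
        S.indicator (fun _ => (1 : ℂ)) q := indicatorConstLp_coeFn
    generalize indicatorConstLp 2 hSo.measurableSet hSf (1 : ℂ) = ψ at h1 ⊢
    filter_upwards [coeFn_pullback (D := D) l ψ,
      (measurePreserving_confProj (D := D) n l).quasiMeasurePreserving.ae h1] with q h2 h3
    rw [hilbertIncl_hilbertEmb, h2, h3]

/-- If the value at q₀ exceeded the operator norm, it would exceed some c in between on an open set.
On the indicator of that set the multiplication operator stretches norms by at least c. -/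
theorem norm_trigSum_le (hh : ∀ i, IsWave (h i)) (q₀ : Conf n l) (y : Mom n l) :
    ‖trigSum b h (q₀, y)‖ ≤ ‖continuumOp l b h 0 y‖ := by
  by_contra! hlt
  obtain ⟨c, hcT, hc⟩ := exists_between hlt
  have hc0 : 0 < c := (norm_nonneg _).trans_lt hcT
  have hcont : Continuous fun q : Conf n l => ‖trigSum b h (q, y)‖ :=
    ((continuous_trigSum hh).comp (continuous_id.prodMk continuous_const)).norm
  obtain ⟨v, hv0, hv⟩ := exists_hilbertIncl_eq_indicator
    (S := {q : Conf n l | c < ‖trigSum b h (q, y)‖}) (isOpen_lt continuous_const hcont) ⟨q₀, hc⟩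
  have h1 : ‖hilbertIncl n D v‖ ≤ c⁻¹ * ‖hilbertIncl n D (continuumOp l b h 0 y v)‖ := by
    refine Lp.norm_le_mul_norm_of_ae_le_mul ?_
    filter_upwards [hilbertIncl_continuumOp_zero hh y v, hv] with q h1 h2
    rw [h1, norm_mul, ← div_eq_inv_mul, le_div_iff₀ hc0, mul_comm]
    by_cases hq : c < ‖trigSum b h (confProj n l q, y)‖
    · exact mul_le_mul_of_nonneg_right hq.le (norm_nonneg _)
    · have hq' : confProj n l q ∉ {q : Conf n l | c < ‖trigSum b h (q, y)‖} := hq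
      rw [h2, Set.indicator_of_notMem hq', norm_zero, mul_zero, mul_zero]
  rw [LinearIsometry.norm_map, LinearIsometry.norm_map, ← div_eq_inv_mul, le_div_iff₀ hc0] at h1
  have h2 := h1.trans (ContinuousLinearMap.le_opNorm _ _)
  rw [mul_comm] at h2
  exact absurd (le_of_mul_le_mul_right h2 hv0) (not_le.mpr hcT)

theorem exists_uniform_bound {E ι : Type*} [Finite ι] {h : ι → E → ℂ}
    (hh : ∀ i, ∃ C, ∀ p, ‖h i p‖ ≤ C) : ∃ C, ∀ i p, ‖h i p‖ ≤ C := by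
  choose C hC using hh
  obtain ⟨M, hM⟩ := (Set.finite_range C).bddAbove
  exact ⟨M, fun i p => (hC i p).trans (hM ⟨i, rfl⟩)⟩

/-- The norm of a classical observable is the fibre norm at `ℏ = 0`. -/
theorem norm_eq_fibreNorm (hh : ∀ i, IsWave (h i)) {F : classicalAlgebra n D}
    (hF : ∀ x, F.1 x = trigSum b h (phaseProj n l x)) : ‖(F : BoundedContinuousFunction (PhaseInf n D) ℂ)‖ =
      fibreNorm (charBasis n D) (charMom l) (fun i => charOf l (b i)) h 0 := by
  obtain ⟨C, hC⟩ : ∃ C, ∀ i p, ‖h i p‖ ≤ C := exists_uniform_bound fun i => (hh i).exists_bound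
  refine le_antisymm ?_ (ciSup_le fun y => ?_)
  · refine (BoundedContinuousFunction.norm_le (Real.iSup_nonneg fun _ => norm_nonneg _)).mpr
      fun x => ?_
    rw [hF]
    exact (norm_trigSum_le hh _ _).trans (norm_fibreOp_le_fibreNorm _ _ _ hC 0 _)
  · refine norm_continuumOp_zero_le hh (norm_nonneg _) fun q => ?_
    obtain ⟨x, hx⟩ := phaseProj_surjective n l (q, y)
    rw [← hx, ← hF]
    exact F.1.norm_coe_le_norm x

theorem norm_continuumQuantization (hh : ∀ i, IsWave (h i)) {F : classicalAlgebra n D}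
    (hF : ∀ x, F.1 x = trigSum b h (phaseProj n l x)) {ℏ : ℝ} (hℏ : ℏ ≠ 0) :
    fibreNorm (charBasis n D) (charMom l) (fun i => charOf l (b i)) h ℏ =
      ‖continuumQuantization ℏ F‖ := by
  obtain ⟨C, hC⟩ : ∃ C, ∀ i p, ‖h i p‖ ≤ C := exists_uniform_bound fun i => (hh i).exists_bound
  choose L hL0 hL using fun i => (hh i).bandLimited.exists_lipschitz
  rw [continuumQuantization_eq (fun i => (hh i).exists_bound) hF]
  refine fibreNorm_eq_of_denseRange _ _ _ (denseRange_charMom n l) hC (L := ∑ i, L i)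
    (fun i p p' => (hL i p p').trans ?_) hℏ
  gcongr
  exact Finset.single_le_sum (fun i _ => hL0 i) (Finset.mem_univ i)

/-- The two cases are the values of the single function `fibreNorm`, for which ℏ = 0 is not
exceptional. -/
theorem continuous_norm_continuumQuantization (F : classicalAlgebra n D) :
    Continuous fun ℏ : ℝ => if ℏ = 0 then ‖(F : BoundedContinuousFunction (PhaseInf n D) ℂ)‖
      else ‖continuumQuantization ℏ F‖ := by
  obtain ⟨l, ι, _, b, h, hh, hF⟩ := exists_continuumOp_rep F
  obtain ⟨C, hC⟩ : ∃ C, ∀ i p, ‖h i p‖ ≤ C := exists_uniform_bound fun i => (hh i).exists_bound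
  choose L hL0 hL using fun i => (hh i).bandLimited.exists_lipschitz
  have h1 : Continuous (fibreNorm (charBasis n D) (charMom l) (fun i => charOf l (b i)) h) :=
    continuous_fibreNorm _ _ _ (L := ∑ i, L i) (Finset.sum_nonneg fun i _ => hL0 i) hC
      fun i p p' => (hL i p p').trans (by
        gcongr
        exact Finset.single_le_sum (fun i _ => hL0 i) (Finset.mem_univ i))
  convert h1 using 2 with ℏ
  split_ifs with hℏ
  · rw [hℏ, norm_eq_fibreNorm hh hF]
  · exact (norm_continuumQuantization hh hF hℏ).symm

/-- The norm of the quantization dominates the whole family of translates, so all of them vanish at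
ℏ. Their matrix elements between χ and χ' are those at ℏ = 0 up to a translation of y by πℏ P(χ +
χ'). Hence the multiplication operators vanish, and with them the sup norm of F. -/
theorem eq_zero_of_continuumQuantization_eq_zero {F : classicalAlgebra n D} {ℏ : ℝ} (hℏ : ℏ ≠ 0)
    (H : continuumQuantization ℏ F = 0) : F = 0 := by
  classical
  obtain ⟨l, ι, _, b, h, hh, hF⟩ := exists_continuumOp_rep F
  have B := fun i => (hh i).exists_bound
  obtain ⟨C, hC⟩ := exists_uniform_bound B
  have h0 : ∀ y, continuumOp l b h ℏ y = 0 := fun y => by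
    have h1 := norm_fibreOp_le_fibreNorm (charBasis n D) (charMom l) (fun i => charOf l (b i)) hC ℏ y
    rw [norm_continuumQuantization hh hF hℏ, H, norm_zero] at h1
    exact norm_le_zero_iff.mp h1
  have h1 : ∀ y, continuumOp l b h 0 y = 0 := fun y => by
    refine continuousLinearMap_ext_inner fun χ χ' => ?_
    -- This translate cancels the momentum for the pair χ, χ': whenever χ' = χ + bᵢ, each weight is
    -- evaluated exactly at y.
    have h2 := h0 (y - (Real.pi * ℏ) • charMom l (χ + χ'))
    have h3 := congrArg (fun S => inner ℂ (charBasis n D χ') (S (charBasis n D χ))) h2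
    simp only [continuumOp_charBasis B, inner_sum, inner_smul_right,
      orthonormal_iff_ite.mp (charBasis n D).orthonormal] at h3 ⊢
    refine Eq.trans (Finset.sum_congr rfl fun i _ => ?_) h3
    by_cases hi : χ' = χ + charOf l (b i)
    · rw [← hi]
      simp
    · rw [if_neg hi, mul_zero, mul_zero]
  have h2 : ‖(F : BoundedContinuousFunction (PhaseInf n D) ℂ)‖ ≤ 0 := by
    rw [norm_eq_fibreNorm hh hF]
    refine ciSup_le fun y => ?_
    rw [← continuumOp, h1, norm_zero]
  exact Subtype.ext (norm_le_zero_iff.mp h2)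

end ClassicalNorm

/-! ### The image of the quantization map -/

section Range

variable {n D : ℕ}

/-- Every finite sum of products of characters and waves is a classical observable. -/
theorem exists_classicalAlgebra_eq_trigSum {l : Lattice D} {ι : Type} [Fintype ι]
    (b : ι → l.edges × Fin n → ℤ) {h : ι → Mom n l → ℂ} (hh : ∀ i, IsWave (h i)) :
    ∃ F : classicalAlgebra n D, ∀ x, F.1 x = trigSum b h (phaseProj n l x) := by
  obtain ⟨f, hf, hfx⟩ := exists_eq_trigSum_mem b hh
  exact ⟨⟨_, StarAlgebra.subset_adjoin ℂ _ ⟨l, f, hf, rfl⟩⟩, fun x => hfx _⟩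

theorem continuumQuantization_one (ℏ : ℝ) :
    continuumQuantization ℏ (1 : classicalAlgebra n D) = 1 := by
  have hh : ∀ _ : Unit, IsWave fun _ : Mom n (emptyLattice D) => (1 : ℂ) := fun _ => isWave_one
  have hF : ∀ x, (1 : classicalAlgebra n D).1 x = trigSum (fun _ : Unit => 0)
      (fun _ _ => (1 : ℂ)) (phaseProj n (emptyLattice D) x) := fun x => by
    rw [trigSum, Fintype.sum_unique, UnitAddTorus.mFourier_zero]
    simp
  have B := fun i => (hh i).exists_bound
  refine HilbertBasis.ext_clm (charBasis n D) fun χ => ?_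
  rw [continuumQuantization_eq B hF, continuumOp_charBasis B, Fintype.sum_unique, charOf_zero]
  simp

/-- The factors in `continuumOp_mul` are products of translated waves, hence waves. So the image is
itself a *-algebra and passing to the generated one adds nothing. -/
theorem exists_continuumQuantization_eq_mul (ℏ : ℝ) (F G : classicalAlgebra n D) :
    ∃ H : classicalAlgebra n D,
      continuumQuantization ℏ H = continuumQuantization ℏ F * continuumQuantization ℏ G := by
  obtain ⟨l, hF, hG⟩ := exists_rep₂ F G
  obtain ⟨ι, _, b, h, hh, hF⟩ := exists_trigSum_rep F hF
  obtain ⟨ι', _, b', h', hh', hG⟩ := exists_trigSum_rep G hG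
  have hw : ∀ i : ι × ι', IsWave fun p => h i.1 (p + ℏ • Real.pi • intMom (b' i.2)) *
      h' i.2 (p + ℏ • -(Real.pi • intMom (b i.1))) := fun i =>
    ((hh i.1).translate _).mul ((hh' i.2).translate _)
  obtain ⟨H, hH⟩ := exists_classicalAlgebra_eq_trigSum (fun i : ι × ι' => b i.1 + b' i.2) hw
  refine ⟨H, ?_⟩
  have B := fun i => (hh i).exists_bound
  have B' := fun i => (hh' i).exists_bound
  rw [continuumQuantization_eq B hF, continuumQuantization_eq B' hG, continuumOp_mul B B',
    continuumQuantization_eq (fun i => (hw i).exists_bound) hH]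

/-- The image of the quantization map, a *-algebra. -/
def quantumAlgebra (n D : ℕ) (ℏ : ℝ) :
    StarSubalgebra ℂ (HilbertInf n D →L[ℂ] HilbertInf n D) where
  carrier := Set.range (continuumQuantization ℏ)
  mul_mem' := by
    rintro _ _ ⟨F, rfl⟩ ⟨G, rfl⟩
    exact exists_continuumQuantization_eq_mul ℏ F G
  add_mem' := by
    rintro _ _ ⟨F, rfl⟩ ⟨G, rfl⟩
    exact ⟨F + G, (isLinearMap_continuumQuantization ℏ).map_add F G⟩
  algebraMap_mem' c := ⟨c • 1, by
    rw [(isLinearMap_continuumQuantization ℏ).map_smul, continuumQuantization_one,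
      Algebra.algebraMap_eq_smul_one]⟩
  star_mem' := by
    rintro _ ⟨F, rfl⟩
    exact ⟨star F, continuumQuantization_star ℏ F⟩

theorem coe_quantumCStar (n D : ℕ) (ℏ : ℝ) : (quantumCStar n D ℏ : Set _) =
    closure (Set.range (continuumQuantization (n := n) (D := D) ℏ)) := by
  have h1 : StarAlgebra.adjoin ℂ (Set.range (continuumQuantization (n := n) (D := D) ℏ)) =
      quantumAlgebra n D ℏ :=
    le_antisymm (StarAlgebra.adjoin_le fun _ h => h) (StarAlgebra.subset_adjoin ℂ _)
  rw [quantumCStar, h1]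
  rfl

theorem isStrictDeformationQuantization (n D : ℕ) :
    IsStrictDeformationQuantization (classicalAlgebra n D) continuumBracket (classicalCStar n D)
      (Set.Icc (-1 : ℝ) 1) (quantumCStar n D) continuumQuantization where
  poisson := isPoissonStarBracket n D
  zero_mem := by simp
  zero_mem_closure := by
    have h1 : (0 : ℝ) ∈ closure (Set.Ioc (0 : ℝ) 1) := by
      rw [closure_Ioc zero_ne_one]
      simp
    refine closure_mono (fun x hx => ?_) h1
    exact ⟨⟨by linarith [hx.1], hx.2⟩, hx.1.ne'⟩
  isClosed_classical := StarSubalgebra.isClosed_topologicalClosure _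
  dense_classical := rfl
  isClosed_quantum _ _ := StarSubalgebra.isClosed_topologicalClosure _
  linear ℏ _ := isLinearMap_continuumQuantization ℏ
  map_star ℏ _ := continuumQuantization_star ℏ
  injective ℏ hℏ F G h := by
    refine sub_eq_zero.mp (eq_zero_of_continuumQuantization_eq_zero hℏ.2 ?_)
    rw [(isLinearMap_continuumQuantization ℏ).map_sub, h, sub_self]
  range_starSubalgebra ℏ _ := ⟨quantumAlgebra n D ℏ, rfl⟩
  dense_range ℏ _ := (coe_quantumCStar n D ℏ).symm
  vonNeumann F G := tendsto_vonNeumann F G _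
  dirac F G := tendsto_dirac F G _ fun _ h => h.2
  rieffel F := (continuous_norm_continuumQuantization F).continuousOn

theorem coe_classicalAlgebra (n D : ℕ) : (classicalAlgebra n D : Set _) =
    {F | ∃ l : Lattice D, ∃ f ∈ latticeAlgebra n l, F = f.compContinuous (phaseProj n l)} := by
  rw [classicalAlgebra_eq]
  rfl

theorem coe_classicalAlgebra_eq_operatorSystem (n D : ℕ) : (classicalAlgebra n D : Set _) =
    {F | ∃ l : Lattice D, ∃ f ∈ operatorSystem n l, F = f.compContinuous (phaseProj n l)} := by
  refine Set.Subset.antisymm (fun F hF => exists_operatorSystem_rep ⟨F, hF⟩) ?_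
  rintro _ ⟨l, f, hf, rfl⟩
  exact StarAlgebra.subset_adjoin ℂ _ ⟨l, f, operatorSystem_le n l hf, rfl⟩

end Range

end LatticeGauge

end

theorem mainTheorem12 (n D : ℕ) :
    -- the direct limit of the algebras is their union, and also that of the operator systems
    ((LatticeGauge.classicalAlgebra n D : Set _) =
      {F | ∃ l : LatticeGauge.Lattice D, ∃ f ∈ LatticeGauge.latticeAlgebra n l,
        F = f.compContinuous (LatticeGauge.phaseProj n l)}) ∧
    ((LatticeGauge.classicalAlgebra n D : Set _) =
      {F | ∃ l : LatticeGauge.Lattice D, ∃ f ∈ LatticeGauge.operatorSystem n l,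
        F = f.compContinuous (LatticeGauge.phaseProj n l)}) ∧
    -- the Poisson bracket and the quantization maps are well defined
    (∀ F G : LatticeGauge.classicalAlgebra n D,
      LatticeGauge.IsContinuumBracket F G (LatticeGauge.continuumBracket F G)) ∧
    (∀ (l : LatticeGauge.Lattice D), ∀ f ∈ LatticeGauge.operatorSystem n l,
      Nonempty (LatticeGauge.Expansion f) ∧
      ∀ ℏ ∈ Set.Icc (-1 : ℝ) 1, LatticeGauge.IsLatticeQuantization ℏ f
        (LatticeGauge.latticeQuantization ℏ f)) ∧
    (∀ ℏ ∈ Set.Icc (-1 : ℝ) 1, ∀ F : LatticeGauge.classicalAlgebra n D,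
      LatticeGauge.IsContinuumQuantization ℏ F (LatticeGauge.continuumQuantization ℏ F)) ∧
    -- strict deformation quantization
    LatticeGauge.IsStrictDeformationQuantization (LatticeGauge.classicalAlgebra n D)
      LatticeGauge.continuumBracket (LatticeGauge.classicalCStar n D) (Set.Icc (-1 : ℝ) 1)
      (LatticeGauge.quantumCStar n D) LatticeGauge.continuumQuantization := by
  refine ⟨LatticeGauge.coe_classicalAlgebra n D,
    LatticeGauge.coe_classicalAlgebra_eq_operatorSystem n D,
    LatticeGauge.isContinuumBracket_continuumBracket, fun l f hf =>
      ⟨LatticeGauge.nonempty_expansion hf,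
        fun ℏ _ => LatticeGauge.isLatticeQuantization_latticeQuantization hf ℏ⟩,
    fun ℏ _ => LatticeGauge.isContinuumQuantization_continuumQuantization ℏ,
    LatticeGauge.isStrictDeformationQuantization n D⟩
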